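/- Let $k$ be a field of characteristic $0$ and let $H$ be a Hopf algebra over $k$ with bijective antipode $S$. Assume that $H$ is cosemisimple: as a coalgebra $H=\bigoplus_{i\in I}C_i$ with every $C_i$ a finite-dimensional simple subcoalgebra. Write $\Delta(h)=h^1\otimes h^2$ and $\rho(m)=m_0\otimes m_1$. Let $\mathcal M^H$ and $\widehat{\mathcal M^H}$ be the categories of right $H$-comodules and of right $H$-contramodules; the latter are vector spaces $N$ with a linear map $\alpha:\mathrm{Hom}(H,N)\to N$ such that $\alpha(x\mapsto\alpha(y\mapsto f(x\otimes y)))=\alpha(h\mapsto f(h^1\otimes h^2))$ and $\alpha(h\mapsto\epsilon(h)n)=n$. For an $H$-comodule $M$ let $\widehat M=\mathrm{Hom}(H,M)^H$ (the comodule maps $H\to M$) with contraaction $\alpha(\theta)(h)=\theta_{h^1}(h^2)$. For an $H$-contramodule $N$ let $N'=H\odot_H N$ be the cokernel of the difference of the maps $h\otimes f\mapsto h\otimes\alpha(f)$ and $h\otimes f\mapsto h^2\otimes f(h^1)$ from $H\otimes\mathrm{Hom}(H,N)$ to $H\otimes N$, with coaction $h\otimes n\mapsto(h^1\otimes n)\otimes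 h^2$. For families $(M_i)_{i\in I}$ of right $C_i$-comodules, let $\Sigma(M_i)=\bigoplus_iM_i\in\mathcal M^H$, with the coaction induced by $C_i\subset H$, and let $\Pi(M_i)=\prod_iM_i\in\widehat{\mathcal M^H}$, with contraaction $\alpha(f)_i=\alpha^i(f_i|_{C_i})$, where $\alpha^i:\mathrm{Hom}(C_i,M_i)=C_i^*\otimes M_i\to M_i$ is $\chi\otimes m\mapsto\chi(m_1)m_0$. Then: 1. $\Sigma:\prod_i\mathcal M^{C_i}\to\mathcal M^H$ and $\Pi:\prod_i\mathcal M^{C_i}\to\widehat{\mathcal M^H}$ are equivalences of categories. 2. The functor $(-)'$ is left adjoint to $\widehat{(-)}$, with unit $n\mapsto(h\mapsto h\otimes n)$ and counit $h\otimes\varphi\mapsto\varphi(h)$, and this pair realizes the correspondence $\bigoplus_iM_i\leftrightarrow\prod_iM_i$: there are natural isomorphisms $\widehat{\Sigma(M_i)}\cong\Pi(M_i)$ of contramodules and $\Pi(M_i)'\cong\Sigma(M_i)$ of comodules. 3. The functors $\widehat{(-)}:\mathcal M^H\to\widehat{\mathcal M^H}$ and $(-)'$ are equivalences. 4. An anti-Yetter-Drinfeld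 ($aYD$) module is a left $H$-module and right $H$-comodule $M$ with $(hm)_0\otimes(hm)_1=h^2m_0\otimes h^3m_1S(h^1)$; it is stable ($saYD$) if $m_1m_0=m$ for all $m$. An $aYD$-contramodule is a left $H$-module and right $H$-contramodule $N$ with $h\,\alpha(f)=\alpha(h^2f(S(h^3)-h^1))$; it is stable if $\alpha(h\mapsto hn)=n$ for all $n$. With the action $h\cdot\varphi=h^2\varphi(S(h^3)-h^1)$ on $\widehat M$ and $x\cdot(h\otimes n)=x^3hS(x^1)\otimes x^2n$ on $N'$, the above functors lift to functors $\widehat{(-)}_H$ and $(-)'_H$ between $aYD$-modules and $aYD$-contramodules, and between $saYD$-modules and $saYD$-contramodules. In both cases $(-)'_H$ is left adjoint to $\widehat{(-)}_H$, with the same unit and counit, and both functors are equivalences. -/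

import Mathlib

open CategoryTheory TensorProduct

universe u

/-! ### Comodules and contramodules over a coalgebra -/

/-- A right comodule over the `k`-coalgebra `C`. -/
structure Comod (k C : Type u) [Field k] [AddCommGroup C] [Module k C] [Coalgebra k C] where
  carrier : Type u
  [addCommGroup : AddCommGroup carrier]
  [module : Module k carrier]
  /-- the coaction `m ↦ m₀ ⊗ m₁` -/
  coact : carrier →ₗ[k] carrier ⊗[k] C
  coassoc : (TensorProduct.assoc k carrier C C).toLinearMap ∘ₗ coact.rTensor C ∘ₗ coact =
    (Coalgebra.comul (R := k) (A := C)).lTensor carrier ∘ₗ coact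
  counit_coact : (TensorProduct.rid k carrier).toLinearMap ∘ₗ
    (Coalgebra.counit (R := k) (A := C)).lTensor carrier ∘ₗ coact = LinearMap.id

/-- A right contramodule over the `k`-coalgebra `C`. -/
structure Contra (k C : Type u) [Field k] [AddCommGroup C] [Module k C] [Coalgebra k C] where
  carrier : Type u
  [addCommGroup : AddCommGroup carrier]
  [module : Module k carrier]
  /-- the contraaction `Hom(C, N) → N` -/
  contr : (C →ₗ[k] carrier) →ₗ[k] carrier
  /-- `α(x ↦ α(y ↦ f(x ⊗ y))) = α(c ↦ f(c¹ ⊗ c²))` -/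
  contraassoc : ∀ f : C ⊗[k] C →ₗ[k] carrier,
    contr (contr ∘ₗ TensorProduct.curry f) = contr (f ∘ₗ Coalgebra.comul)
  /-- `α(c ↦ ε(c) n) = n` -/
  contr_counit : ∀ n : carrier,
    contr (LinearMap.toSpanSingleton k carrier n ∘ₗ Coalgebra.counit) = n

attribute [instance] Comod.addCommGroup Comod.module Contra.addCommGroup Contra.module

namespace Comod

variable {k C : Type u} [Field k] [AddCommGroup C] [Module k C] [Coalgebra k C]

/-- Morphisms of comodules: linear maps with `f(m)₀ ⊗ f(m)₁ = f(m₀) ⊗ m₁`. -/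
@[ext]
structure Hom (M N : Comod k C) where
  toLin : M.carrier →ₗ[k] N.carrier
  comm : N.coact ∘ₗ toLin = toLin.rTensor C ∘ₗ M.coact

instance : Category (Comod k C) where
  Hom M N := Hom M N
  id M := ⟨LinearMap.id, by simp⟩
  comp f g := ⟨g.toLin ∘ₗ f.toLin, by
    rw [← LinearMap.comp_assoc, g.comm, LinearMap.comp_assoc, f.comm, LinearMap.rTensor_comp,
      LinearMap.comp_assoc]⟩

@[ext]
theorem hom_ext {M N : Comod k C} {f g : M ⟶ N} (h : Hom.toLin f = Hom.toLin g) : f = g :=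
  Hom.ext h

/-- The space `Hom(C, M)^C` of comodule morphisms from `C` (coacted on by its comultiplication)
to `M`. -/
def homSub (M : Comod k C) : Submodule k (C →ₗ[k] M.carrier) where
  carrier := {f | M.coact ∘ₗ f = f.rTensor C ∘ₗ Coalgebra.comul}
  add_mem' := by
    intro f g hf hg
    simp only [Set.mem_ofPred_eq] at *
    rw [LinearMap.comp_add, hf, hg, LinearMap.rTensor_add, LinearMap.add_comp]
  zero_mem' := by simp
  smul_mem' := by
    intro c f hf
    simp only [Set.mem_ofPred_eq] at *
    rw [LinearMap.comp_smul, hf, LinearMap.rTensor_smul, LinearMap.smul_comp]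

end Comod

namespace Contra

variable {k C : Type u} [Field k] [AddCommGroup C] [Module k C] [Coalgebra k C]

/-- Morphisms of contramodules: linear maps with `f(α(g)) = α(f ∘ g)`. -/
@[ext]
structure Hom (M N : Contra k C) where
  toLin : M.carrier →ₗ[k] N.carrier
  comm : ∀ g : C →ₗ[k] M.carrier, toLin (M.contr g) = N.contr (toLin ∘ₗ g)

instance : Category (Contra k C) where
  Hom M N := Hom M N
  id M := ⟨LinearMap.id, fun _ => rfl⟩
  comp f g := ⟨g.toLin ∘ₗ f.toLin, fun h => by
    rw [LinearMap.comp_apply, f.comm, g.comm, LinearMap.comp_assoc]⟩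

@[ext]
theorem hom_ext {M N : Contra k C} {f g : M ⟶ N} (h : Hom.toLin f = Hom.toLin g) : f = g :=
  Hom.ext h

end Contra



/-! ### The functor `M ↦ Hom(C, M)^C` from comodules to contramodules -/

section Hat

variable {k C : Type u} [Field k] [AddCommGroup C] [Module k C] [Coalgebra k C]

/-- For `θ : C → Hom(C, V)`, the map `c ↦ θ_{c¹}(c²)`. -/
noncomputable def diagEval (k C V : Type u) [Field k] [AddCommGroup C] [Module k C]
    [Coalgebra k C] [AddCommGroup V] [Module k V] :
    (C →ₗ[k] C →ₗ[k] V) →ₗ[k] (C →ₗ[k] V) :=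
  LinearMap.lcomp k V (Coalgebra.comul (R := k) (A := C)) ∘ₗ
    TensorProduct.uncurry (RingHom.id k) C C V

theorem diagEval_apply {V : Type u} [AddCommGroup V] [Module k V] (θ : C →ₗ[k] C →ₗ[k] V)
    (c : C) : diagEval k C V θ c = TensorProduct.lift θ (Coalgebra.comul (R := k) c) := rfl

theorem diagEval_mem (M : Comod k C) (θ : C →ₗ[k] M.homSub) :
    diagEval k C M.carrier (M.homSub.subtype ∘ₗ θ) ∈ M.homSub := by
  change M.coact ∘ₗ (TensorProduct.lift (M.homSub.subtype ∘ₗ θ)) ∘ₗ Coalgebra.comul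
    = LinearMap.rTensor C ((TensorProduct.lift (M.homSub.subtype ∘ₗ θ)) ∘ₗ Coalgebra.comul) ∘ₗ
      Coalgebra.comul
  have key : M.coact ∘ₗ (TensorProduct.lift (M.homSub.subtype ∘ₗ θ)) =
      LinearMap.rTensor C (TensorProduct.lift (M.homSub.subtype ∘ₗ θ)) ∘ₗ
        (TensorProduct.assoc k C C C).symm.toLinearMap ∘ₗ
          LinearMap.lTensor C Coalgebra.comul := by
    refine TensorProduct.ext' fun a b => ?_
    have h1 := LinearMap.congr_fun (θ a).2 b
    simp only [LinearMap.comp_apply] at h1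
    simp only [LinearMap.comp_apply, TensorProduct.lift.tmul, LinearMap.lTensor_tmul,
      Submodule.subtype_apply, LinearEquiv.coe_coe]
    rw [h1]
    generalize (Coalgebra.comul (R := k) b) = t
    induction t using TensorProduct.induction_on with
    | zero => simp
    | tmul x y => simp
    | add x y hx hy => simp only [map_add, TensorProduct.tmul_add, hx, hy]
  rw [← LinearMap.comp_assoc, key, LinearMap.rTensor_comp]
  simp only [LinearMap.comp_assoc]
  rw [← Coalgebra.coassoc]
  congr 1
  ext c
  simp

/-- `Hom(C, M)^C` with the contraaction `α(θ)(c) = θ_{c¹}(c²)`. -/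
noncomputable def hatObj (M : Comod k C) : Contra k C where
  carrier := M.homSub
  contr := LinearMap.codRestrict M.homSub
    (diagEval k C M.carrier ∘ₗ LinearMap.compRight k M.homSub.subtype)
    (diagEval_mem M)
  contraassoc := by
    intro f
    apply Subtype.ext
    apply LinearMap.ext
    intro c
    change TensorProduct.lift (_ ∘ₗ _ ∘ₗ _) _ = TensorProduct.lift (_ ∘ₗ _ ∘ₗ _) _
    set F := M.homSub.subtype ∘ₗ f with hF
    trans TensorProduct.lift F
      ((TensorProduct.assoc k C C C).symm ((Coalgebra.comul (R := k)).lTensor C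
        (Coalgebra.comul (R := k) c)))
    · generalize (Coalgebra.comul (R := k) c) = t
      induction t using TensorProduct.induction_on with
      | zero => simp
      | tmul x y =>
        simp only [TensorProduct.lift.tmul, LinearMap.comp_apply, LinearMap.lTensor_tmul]
        change TensorProduct.lift _ (Coalgebra.comul (R := k) y) = _
        generalize (Coalgebra.comul (R := k) y) = s
        induction s using TensorProduct.induction_on with
        | zero => simp
        | tmul p q => rfl
        | add p q hp hq => simp only [map_add, TensorProduct.tmul_add, hp, hq]
      | add x y hx hy => simp only [map_add, hx, hy]
    · rw [Coalgebra.coassoc_symm_apply]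
      generalize (Coalgebra.comul (R := k) c) = t
      induction t using TensorProduct.induction_on with
      | zero => simp
      | tmul x y => rfl
      | add x y hx hy => simp only [map_add, hx, hy]
  contr_counit := by
    intro n
    apply Subtype.ext
    apply LinearMap.ext
    intro c
    change TensorProduct.lift (_ ∘ₗ _ ∘ₗ _) _ = _
    trans n.1 ((TensorProduct.lid k C) ((Coalgebra.counit (R := k)).rTensor C
      (Coalgebra.comul (R := k) c)))
    · generalize (Coalgebra.comul (R := k) c) = t
      induction t using TensorProduct.induction_on with
      | zero => simp
      | tmul x y => simp
      | add x y hx hy => simp only [map_add, hx, hy]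
    · simp

/-- A comodule morphism `f : M → N` induces `φ ↦ f ∘ φ`. -/
noncomputable def hatMap {M N : Comod k C} (f : M ⟶ N) : M.homSub →ₗ[k] N.homSub :=
  LinearMap.restrict (LinearMap.compRight k (Comod.Hom.toLin f)) (by
    intro φ hφ
    change _ = _
    change _ = _ at hφ
    rw [LinearMap.compRight_apply, ← LinearMap.comp_assoc, f.comm, LinearMap.comp_assoc, hφ,
      LinearMap.rTensor_comp, LinearMap.comp_assoc])

/-- The functor `M ↦ M̂ = Hom(C, M)^C` from comodules to contramodules. -/
noncomputable def hat (k C : Type u) [Field k] [AddCommGroup C] [Module k C] [Coalgebra k C] :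
    Comod k C ⥤ Contra k C where
  obj := hatObj
  map f := ⟨hatMap f, by
    intro g
    apply Subtype.ext
    apply LinearMap.ext
    intro c
    change Comod.Hom.toLin f (TensorProduct.lift _ (Coalgebra.comul (R := k) c)) =
      TensorProduct.lift _ (Coalgebra.comul (R := k) c)
    generalize (Coalgebra.comul (R := k) c) = t
    induction t using TensorProduct.induction_on with
    | zero => simp
    | tmul x y => rfl
    | add x y hx hy => simp only [map_add, hx, hy]⟩
  map_id _ := rfl
  map_comp _ _ := rfl

end Hat

/-! ### The functor `N ↦ C ⊙_C N` from contramodules to comodules -/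

section Prime

variable {k C : Type u} [Field k] [AddCommGroup C] [Module k C] [Coalgebra k C]

/-- The map `C ⊗ Hom(C, V) → C ⊗ V`, `c ⊗ f ↦ c² ⊗ f(c¹)`. -/
noncomputable def spread (k C V : Type u) [Field k] [AddCommGroup C] [Module k C]
    [Coalgebra k C] [AddCommGroup V] [Module k V] :
    C ⊗[k] (C →ₗ[k] V) →ₗ[k] C ⊗[k] V :=
  TensorProduct.lift (LinearMap.mk₂ k
    (fun (c : C) (f : C →ₗ[k] V) =>
      TensorProduct.comm k V C (f.rTensor C (Coalgebra.comul (R := k) c)))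
    (by intros; simp) (by intros; simp)
    (by intros; simp [LinearMap.rTensor_add]) (by intros; simp [LinearMap.rTensor_smul]))

@[simp]
theorem spread_tmul {V : Type u} [AddCommGroup V] [Module k V] (c : C) (f : C →ₗ[k] V) :
    spread k C V (c ⊗ₜ f) =
      TensorProduct.comm k V C (f.rTensor C (Coalgebra.comul (R := k) c)) := rfl

namespace Contra

/-- The image of the difference of `c ⊗ f ↦ c ⊗ α(f)` and `c ⊗ f ↦ c² ⊗ f(c¹)`. -/
noncomputable def relSub (N : Contra k C) : Submodule k (C ⊗[k] N.carrier) :=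
  LinearMap.range (N.contr.lTensor C - spread k C N.carrier)

/-- The space `C ⊙_C N`, the cokernel of that difference. -/
abbrev odot (N : Contra k C) : Type u := (C ⊗[k] N.carrier) ⧸ N.relSub

end Contra

/-- The coaction `c ⊗ v ↦ (c¹ ⊗ v) ⊗ c²` on `C ⊗ V`. -/
noncomputable def freeCoact (k C V : Type u) [Field k] [AddCommGroup C] [Module k C]
    [Coalgebra k C] [AddCommGroup V] [Module k V] :
    C ⊗[k] V →ₗ[k] (C ⊗[k] V) ⊗[k] C :=
  (TensorProduct.rightComm k C C V).toLinearMap ∘ₗ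
    (Coalgebra.comul (R := k) (A := C)).rTensor V

@[simp]
theorem freeCoact_tmul {V : Type u} [AddCommGroup V] [Module k V] (c : C) (v : V) :
    freeCoact k C V (c ⊗ₜ v) =
      TensorProduct.rightComm k C C V (Coalgebra.comul (R := k) c ⊗ₜ v) := rfl

theorem freeCoact_spread (V : Type u) [AddCommGroup V] [Module k V] :
    freeCoact k C V ∘ₗ spread k C V =
      (spread k C V).rTensor C ∘ₗ freeCoact k C (C →ₗ[k] V) := by
  refine TensorProduct.ext' fun c f => ?_
  simp only [LinearMap.comp_apply, spread_tmul, freeCoact_tmul]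
  trans (TensorProduct.rightComm k C C V) ((TensorProduct.comm k V (C ⊗[k] C))
    (f.rTensor (C ⊗[k] C) ((Coalgebra.comul (R := k)).lTensor C (Coalgebra.comul (R := k) c))))
  · generalize (Coalgebra.comul (R := k) c) = t
    induction t using TensorProduct.induction_on with
    | zero => simp
    | tmul x y => simp
    | add x y hx hy => simp only [map_add, hx, hy]
  · rw [← Coalgebra.coassoc_apply]
    generalize (Coalgebra.comul (R := k) c) = t
    induction t using TensorProduct.induction_on with
    | zero => simp
    | tmul x y =>
      simp only [LinearMap.rTensor_tmul, TensorProduct.rightComm_tmul, spread_tmul]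
      generalize (Coalgebra.comul (R := k) x) = s
      induction s using TensorProduct.induction_on with
      | zero => simp
      | tmul p q => simp
      | add p q hp hq => simp only [map_add, TensorProduct.add_tmul, hp, hq]
    | add x y hx hy => simp only [map_add, TensorProduct.add_tmul, hx, hy]

theorem freeCoact_contr (N : Contra k C) :
    freeCoact k C N.carrier ∘ₗ N.contr.lTensor C =
      (N.contr.lTensor C).rTensor C ∘ₗ freeCoact k C (C →ₗ[k] N.carrier) := by
  refine TensorProduct.ext' fun c f => ?_
  simp only [LinearMap.comp_apply, freeCoact_tmul, LinearMap.lTensor_tmul]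
  generalize (Coalgebra.comul (R := k) c) = t
  induction t using TensorProduct.induction_on with
  | zero => simp
  | tmul x y => simp
  | add x y hx hy => simp only [map_add, TensorProduct.add_tmul, hx, hy]

/-- The coaction `(c ⊗ n) ↦ (c¹ ⊗ n) ⊗ c²` on `C ⊙_C N`. -/
noncomputable def odotCoact (N : Contra k C) : N.odot →ₗ[k] N.odot ⊗[k] C :=
  N.relSub.liftQ (N.relSub.mkQ.rTensor C ∘ₗ freeCoact k C N.carrier) (by
    rintro _ ⟨t, rfl⟩
    have h1 := LinearMap.congr_fun (freeCoact_contr N) t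
    have h2 := LinearMap.congr_fun (freeCoact_spread (k := k) (C := C) N.carrier) t
    simp only [LinearMap.comp_apply] at h1 h2
    rw [LinearMap.mem_ker, LinearMap.comp_apply, LinearMap.sub_apply, map_sub, h1, h2,
      ← LinearMap.sub_apply, ← LinearMap.rTensor_sub, ← LinearMap.comp_apply,
      ← LinearMap.rTensor_comp]
    have : N.relSub.mkQ ∘ₗ (N.contr.lTensor C - spread k C N.carrier) = 0 := by
      refine LinearMap.ext fun s => ?_
      exact (Submodule.Quotient.mk_eq_zero _).2 ⟨s, rfl⟩
    rw [this]
    simp)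

theorem odotCoact_comp_mkQ (N : Contra k C) :
    odotCoact N ∘ₗ N.relSub.mkQ = N.relSub.mkQ.rTensor C ∘ₗ freeCoact k C N.carrier :=
  Submodule.liftQ_mkQ _ _ _

theorem odotCoact_mk (N : Contra k C) (t : C ⊗[k] N.carrier) :
    odotCoact N (N.relSub.mkQ t) = N.relSub.mkQ.rTensor C (freeCoact k C N.carrier t) := rfl

/-- `C ⊙_C N` as a comodule. -/
noncomputable def primeObj (N : Contra k C) : Comod k C where
  carrier := N.odot
  coact := odotCoact N
  coassoc := by
    apply Submodule.linearMap_qext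
    refine TensorProduct.ext' fun c n => ?_
    simp only [LinearMap.comp_apply, odotCoact_mk, freeCoact_tmul, LinearEquiv.coe_coe]
    trans (N.relSub.mkQ.rTensor (C ⊗[k] C)) ((TensorProduct.assoc k _ _ _)
      (((TensorProduct.rightComm k C C N.carrier).toLinearMap.rTensor C)
      ((TensorProduct.rightComm k (C ⊗[k] C) C N.carrier)
      (((Coalgebra.comul (R := k)).rTensor C (Coalgebra.comul (R := k) c)) ⊗ₜ n))))
    · generalize (Coalgebra.comul (R := k) c) = t
      induction t using TensorProduct.induction_on with
      | zero => simp
      | tmul x y =>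
        simp only [LinearMap.rTensor_tmul, TensorProduct.rightComm_tmul, odotCoact_mk,
          freeCoact_tmul, LinearEquiv.coe_coe]
        generalize (Coalgebra.comul (R := k) x) = s
        induction s using TensorProduct.induction_on with
        | zero => simp
        | tmul p q => simp
        | add p q hp hq => simp only [map_add, TensorProduct.add_tmul, hp, hq]
      | add x y hx hy => simp only [map_add, TensorProduct.add_tmul, hx, hy]
    · rw [← Coalgebra.coassoc_symm_apply]
      generalize (Coalgebra.comul (R := k) c) = t
      induction t using TensorProduct.induction_on with
      | zero => simp
      | tmul x y =>
        simp only [LinearMap.rTensor_tmul, LinearMap.lTensor_tmul, TensorProduct.rightComm_tmul]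
        generalize (Coalgebra.comul (R := k) y) = s
        induction s using TensorProduct.induction_on with
        | zero => simp
        | tmul p q => simp
        | add p q hp hq => simp only [map_add, TensorProduct.add_tmul, TensorProduct.tmul_add, hp, hq]
      | add x y hx hy => simp only [map_add, TensorProduct.add_tmul, hx, hy]
  counit_coact := by
    apply Submodule.linearMap_qext
    refine TensorProduct.ext' fun c n => ?_
    simp only [LinearMap.comp_apply, odotCoact_mk, freeCoact_tmul, LinearEquiv.coe_coe,
      LinearMap.id_apply]
    trans N.relSub.mkQ (TensorProduct.rid k C ((Coalgebra.counit (R := k)).lTensor C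
      (Coalgebra.comul (R := k) c)) ⊗ₜ n)
    · generalize (Coalgebra.comul (R := k) c) = t
      induction t using TensorProduct.induction_on with
      | zero => simp
      | tmul x y => simp [← TensorProduct.smul_tmul']
      | add x y hx hy => simp only [map_add, TensorProduct.add_tmul, hx, hy]
    · simp

theorem lTensor_spread {V W : Type u} [AddCommGroup V] [Module k V] [AddCommGroup W] [Module k W]
    (f : V →ₗ[k] W) :
    f.lTensor C ∘ₗ spread k C V = spread k C W ∘ₗ (LinearMap.compRight k f).lTensor C := by
  refine TensorProduct.ext' fun c g => ?_
  simp only [LinearMap.comp_apply, spread_tmul, LinearMap.lTensor_tmul, LinearMap.compRight_apply]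
  generalize (Coalgebra.comul (R := k) c) = t
  induction t using TensorProduct.induction_on with
  | zero => simp
  | tmul x y => simp
  | add x y hx hy => simp only [map_add, hx, hy]

/-- A contramodule morphism `f` induces `c ⊗ n ↦ c ⊗ f(n)`. -/
noncomputable def primeMap {M N : Contra k C} (f : M ⟶ N) : M.odot →ₗ[k] N.odot :=
  Submodule.mapQ _ _ ((Contra.Hom.toLin f).lTensor C) (by
    rintro _ ⟨t, rfl⟩
    refine ⟨(LinearMap.compRight k (Contra.Hom.toLin f)).lTensor C t, ?_⟩
    have h1 := LinearMap.congr_fun (lTensor_spread (C := C) (Contra.Hom.toLin f)) t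
    have h2 : N.contr.lTensor C ∘ₗ (LinearMap.compRight k (Contra.Hom.toLin f)).lTensor C =
        (Contra.Hom.toLin f).lTensor C ∘ₗ M.contr.lTensor C := by
      refine TensorProduct.ext' fun c g => ?_
      simp [f.comm]
    have h3 := LinearMap.congr_fun h2 t
    simp only [LinearMap.comp_apply] at h1 h3
    rw [LinearMap.sub_apply, LinearMap.sub_apply, map_sub, h1, h3])

/-- The functor `N ↦ N' = C ⊙_C N` from contramodules to comodules. -/
noncomputable def prime (k C : Type u) [Field k] [AddCommGroup C] [Module k C] [Coalgebra k C] :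
    Contra k C ⥤ Comod k C where
  obj := primeObj
  map f := ⟨primeMap f, by
    apply Submodule.linearMap_qext
    refine TensorProduct.ext' fun c n => ?_
    change odotCoact _ (Submodule.mkQ _ (c ⊗ₜ (Contra.Hom.toLin f n))) =
      (primeMap f).rTensor C (odotCoact _ (Submodule.mkQ _ (c ⊗ₜ n)))
    rw [odotCoact_mk, odotCoact_mk, freeCoact_tmul, freeCoact_tmul]
    generalize (Coalgebra.comul (R := k) c) = t
    induction t using TensorProduct.induction_on with
    | zero => simp
    | tmul x y => rfl
    | add x y hx hy => simp only [map_add, TensorProduct.add_tmul, hx, hy]⟩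
  map_id N := by
    apply Comod.hom_ext
    apply Submodule.linearMap_qext
    exact TensorProduct.ext' fun c n => rfl
  map_comp f g := by
    apply Comod.hom_ext
    apply Submodule.linearMap_qext
    exact TensorProduct.ext' fun c n => rfl

end Prime
/-! ### Simple coalgebras, and the correspondence `⨁ Mᵢ ↔ ∏ Mᵢ` -/

/-- A subspace `D` of a coalgebra is a subcoalgebra if `Δ(D) ⊆ D ⊗ D`. -/
def IsSubcoalg {k C : Type u} [Field k] [AddCommGroup C] [Module k C] [Coalgebra k C]
    (D : Submodule k C) : Prop :=
  ∀ c ∈ D, Coalgebra.comul (R := k) c ∈ LinearMap.range (TensorProduct.map D.subtype D.subtype)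

/-- A coalgebra is simple if it is nonzero and has no subcoalgebras besides `0` and itself. -/
def IsSimpleCoalg (k C : Type u) [Field k] [AddCommGroup C] [Module k C] [Coalgebra k C] : Prop :=
  Nontrivial C ∧ ∀ D : Submodule k C, IsSubcoalg D → D = ⊥ ∨ D = ⊤

section Finite

variable {k C : Type u} [Field k] [AddCommGroup C] [Module k C] [Coalgebra k C]

/-- The action `χ ⊗ m ↦ χ(m₁) m₀` of `C^*` on a comodule. -/
noncomputable def Comod.dualAct (M : Comod k C) :
    Module.Dual k C ⊗[k] M.carrier →ₗ[k] M.carrier :=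
  TensorProduct.lift (LinearMap.mk₂ k
    (fun (χ : Module.Dual k C) (m : M.carrier) =>
      TensorProduct.rid k M.carrier (χ.lTensor M.carrier (M.coact m)))
    (by intros; simp [LinearMap.lTensor_add]) (by intros; simp [LinearMap.lTensor_smul])
    (by intros; simp) (by intros; simp))

theorem Comod.dualAct_tmul (M : Comod k C) (χ : Module.Dual k C) (m : M.carrier) :
    M.dualAct (χ ⊗ₜ m) = TensorProduct.rid k M.carrier (χ.lTensor M.carrier (M.coact m)) := rfl

variable [FiniteDimensional k C]

/-- For `C` finite dimensional, the map `Hom(C, M) = C^* ⊗ M → M`, `χ ⊗ m ↦ χ(m₁) m₀`. -/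
noncomputable def Comod.finContr (M : Comod k C) : (C →ₗ[k] M.carrier) →ₗ[k] M.carrier :=
  M.dualAct ∘ₗ (dualTensorHomEquiv k C M.carrier).symm.toLinearMap

theorem Comod.finContr_hom (M : Comod k C) (χ : Module.Dual k C) (m : M.carrier) :
    M.finContr (dualTensorHom k C M.carrier (χ ⊗ₜ m)) = M.dualAct (χ ⊗ₜ m) := by
  rw [finContr, LinearMap.comp_apply]
  congr 1
  exact (dualTensorHomEquiv k C M.carrier).symm_apply_apply (χ ⊗ₜ m)

theorem Comod.finContr_assoc (M : Comod k C) (f : C ⊗[k] C →ₗ[k] M.carrier) :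
    M.finContr (M.finContr ∘ₗ TensorProduct.curry f) = M.finContr (f ∘ₗ Coalgebra.comul) := by
  have c0 : TensorProduct.curry (0 : C ⊗[k] C →ₗ[k] M.carrier) = 0 := rfl
  have ca : ∀ f g : C ⊗[k] C →ₗ[k] M.carrier, TensorProduct.curry (f + g) =
      TensorProduct.curry f + TensorProduct.curry g := fun _ _ => rfl
  obtain ⟨t, rfl⟩ := (dualTensorHomEquiv k (C ⊗[k] C) M.carrier).surjective f
  induction t using TensorProduct.induction_on with
  | zero => rw [map_zero, c0, LinearMap.comp_zero, LinearMap.zero_comp]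
  | add x y hx hy =>
    rw [map_add, ca, LinearMap.comp_add, LinearMap.add_comp, map_add, map_add, hx, hy]
  | tmul ξ m =>
    obtain ⟨s, rfl⟩ := (TensorProduct.dualDistribEquiv k C C).surjective ξ
    induction s using TensorProduct.induction_on with
    | zero =>
      rw [map_zero, TensorProduct.zero_tmul, map_zero, c0, LinearMap.comp_zero,
        LinearMap.zero_comp]
    | add x y hx hy =>
      rw [map_add, TensorProduct.add_tmul, map_add, ca, LinearMap.comp_add, LinearMap.add_comp,
        map_add, map_add, hx, hy]
    | tmul χ ψ =>
      have e1 : M.finContr ∘ₗ TensorProduct.curry (dualTensorHomEquiv k (C ⊗[k] C) M.carrier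
          ((TensorProduct.dualDistribEquiv k C C (χ ⊗ₜ ψ)) ⊗ₜ m)) =
          dualTensorHom k C M.carrier (χ ⊗ₜ M.dualAct (ψ ⊗ₜ m)) := by
        ext c
        have : TensorProduct.curry (dualTensorHomEquiv k (C ⊗[k] C) M.carrier
          ((TensorProduct.dualDistribEquiv k C C (χ ⊗ₜ ψ)) ⊗ₜ m)) c =
            χ c • dualTensorHom k C M.carrier (ψ ⊗ₜ m) := by
          ext d
          change (χ c * ψ d) • m = χ c • ψ d • m
          rw [mul_smul]
        rw [LinearMap.comp_apply, this, map_smul, finContr_hom]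
        rfl
      have e2 : (dualTensorHomEquiv k (C ⊗[k] C) M.carrier
          ((TensorProduct.dualDistribEquiv k C C (χ ⊗ₜ ψ)) ⊗ₜ m)) ∘ₗ Coalgebra.comul =
          dualTensorHom k C M.carrier
            (((TensorProduct.dualDistribEquiv k C C (χ ⊗ₜ ψ)) ∘ₗ Coalgebra.comul) ⊗ₜ m) := by
        ext c
        rfl
      rw [e1, e2, finContr_hom, finContr_hom]
      simp only [Comod.dualAct_tmul]
      have h := LinearMap.congr_fun M.coassoc m
      simp only [LinearMap.comp_apply] at h
      rw [LinearMap.lTensor_comp, LinearMap.comp_apply, ← h]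
      generalize M.coact m = t
      induction t using TensorProduct.induction_on with
      | zero => simp
      | add x y hx hy => simp only [map_add, hx, hy]
      | tmul x c =>
        simp only [LinearMap.lTensor_tmul, LinearMap.rTensor_tmul, TensorProduct.rid_tmul,
          LinearEquiv.coe_coe, map_smul]
        generalize M.coact x = s
        induction s using TensorProduct.induction_on with
        | zero => simp
        | add x y hx hy => simp only [map_add, hx, hy, TensorProduct.add_tmul, smul_add]
        | tmul y d =>
          simp only [TensorProduct.assoc_tmul, LinearMap.lTensor_tmul, TensorProduct.rid_tmul]
          change ψ c • χ d • y = (χ d * ψ c) • y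
          rw [smul_smul, mul_comm]

/-- A comodule over a finite dimensional coalgebra, viewed as a contramodule. -/
noncomputable def Comod.toContra (M : Comod k C) : Contra k C where
  carrier := M.carrier
  contr := M.finContr
  contraassoc := M.finContr_assoc
  contr_counit := by
    intro n
    have : LinearMap.toSpanSingleton k M.carrier n ∘ₗ Coalgebra.counit =
        dualTensorHom k C M.carrier (Coalgebra.counit ⊗ₜ n) := by
      ext c
      simp
    rw [this, Comod.finContr_hom]
    exact LinearMap.congr_fun M.counit_coact n

theorem Comod.Hom.finContr {M N : Comod k C} (f : Comod.Hom M N) (g : C →ₗ[k] M.carrier) :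
    f.toLin (M.finContr g) = N.finContr (f.toLin ∘ₗ g) := by
  obtain ⟨t, rfl⟩ := (dualTensorHomEquiv k C M.carrier).surjective g
  induction t using TensorProduct.induction_on with
  | zero => simp
  | add x y hx hy => simp only [map_add, LinearMap.comp_add, hx, hy]
  | tmul χ m =>
    have : f.toLin ∘ₗ dualTensorHomEquiv k C M.carrier (χ ⊗ₜ m) =
        dualTensorHom k C N.carrier (χ ⊗ₜ f.toLin m) := by
      ext c
      simp
    rw [this, finContr_hom]
    refine (congrArg f.toLin (M.finContr_hom χ m)).trans ?_
    have h := LinearMap.congr_fun f.comm m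
    simp only [LinearMap.comp_apply] at h
    rw [dualAct_tmul, dualAct_tmul, h]
    generalize M.coact m = t
    induction t using TensorProduct.induction_on with
    | zero => simp
    | add x y hx hy => simp only [map_add, hx, hy]
    | tmul x c => simp

end Finite

section SumProd

variable {k H ι : Type u} [Field k] [AddCommGroup H] [Module k H] [Coalgebra k H]
  {C : ι → Type u} [∀ i, AddCommGroup (C i)] [∀ i, Module k (C i)] [∀ i, Coalgebra k (C i)]

/-- The coaction `mᵢ ↦ (mᵢ)₀ ⊗ jᵢ((mᵢ)₁)` on `⨁ Mᵢ`. -/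
noncomputable def sumCoact [DecidableEq ι] (j : ∀ i, C i →ₗc[k] H) (M : ∀ i, Comod k (C i)) :
    (DirectSum ι fun i => (M i).carrier) →ₗ[k] (DirectSum ι fun i => (M i).carrier) ⊗[k] H :=
  DirectSum.toModule k ι _ fun i =>
    TensorProduct.map (DirectSum.lof k ι (fun i => (M i).carrier) i) (j i).toLinearMap ∘ₗ
      (M i).coact

theorem sumCoact_lof [DecidableEq ι] (j : ∀ i, C i →ₗc[k] H) (M : ∀ i, Comod k (C i)) (i : ι)
    (m : (M i).carrier) :
    sumCoact j M (DirectSum.lof k ι (fun i => (M i).carrier) i m) =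
      TensorProduct.map (DirectSum.lof k ι (fun i => (M i).carrier) i) (j i).toLinearMap
        ((M i).coact m) := by
  rw [sumCoact, DirectSum.toModule_lof, LinearMap.comp_apply]

/-- The direct sum of `C i`-comodules as an `H`-comodule, through coalgebra maps
`j i : C i → H`. -/
noncomputable def sumObj [DecidableEq ι] (j : ∀ i, C i →ₗc[k] H) (M : ∀ i, Comod k (C i)) :
    Comod k H where
  carrier := DirectSum ι fun i => (M i).carrier
  coact := sumCoact j M
  coassoc := by
    refine DirectSum.linearMap_ext _ fun i => LinearMap.ext fun m => ?_
    simp only [LinearMap.comp_apply, sumCoact_lof]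
    have h := congrArg (TensorProduct.map (DirectSum.lof k ι (fun i => (M i).carrier) i)
      (TensorProduct.map (j i).toLinearMap (j i).toLinearMap)) (LinearMap.congr_fun (M i).coassoc m)
    simp only [LinearMap.comp_apply] at h
    convert h using 1
    · generalize (M i).coact m = t
      induction t using TensorProduct.induction_on with
      | zero => simp
      | add x y hx hy => simp only [map_add, hx, hy]
      | tmul x c =>
        simp only [TensorProduct.map_tmul, LinearMap.rTensor_tmul, sumCoact_lof]
        generalize (M i).coact x = s
        induction s using TensorProduct.induction_on with
        | zero => simp
        | add x y hx hy => simp only [map_add, TensorProduct.add_tmul, hx, hy]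
        | tmul y d => simp
    · generalize (M i).coact m = t
      induction t using TensorProduct.induction_on with
      | zero => simp
      | add x y hx hy => simp only [map_add, hx, hy]
      | tmul x c =>
        have := LinearMap.congr_fun (j i).map_comp_comul c
        simp only [LinearMap.comp_apply] at this
        simp only [TensorProduct.map_tmul, LinearMap.lTensor_tmul]
        rw [this]
  counit_coact := by
    refine DirectSum.linearMap_ext _ fun i => LinearMap.ext fun m => ?_
    simp only [LinearMap.comp_apply, sumCoact_lof, LinearMap.id_apply]
    have h := congrArg (DirectSum.lof k ι (fun i => (M i).carrier) i)
      (LinearMap.congr_fun (M i).counit_coact m)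
    simp only [LinearMap.comp_apply, LinearMap.id_apply] at h
    refine Eq.trans ?_ h
    generalize (M i).coact m = t
    induction t using TensorProduct.induction_on with
    | zero => simp
    | add x y hx hy => simp only [map_add, hx, hy]
    | tmul x c =>
      simp

/-- The functor `(Mᵢ) ↦ ⨁ Mᵢ` from families of comodules to comodules. -/
noncomputable def sumComod [DecidableEq ι] (j : ∀ i, C i →ₗc[k] H) :
    (∀ i, Comod k (C i)) ⥤ Comod k H where
  obj M := sumObj j M
  map {M N} f := ⟨DirectSum.lmap fun i => Comod.Hom.toLin (f i), by
    refine DirectSum.linearMap_ext _ fun i => LinearMap.ext fun m => ?_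
    change sumCoact j N (DirectSum.lmap (fun i => Comod.Hom.toLin (f i)) (DirectSum.lof k ι _ i m)) =
      LinearMap.rTensor H (DirectSum.lmap fun i => Comod.Hom.toLin (f i))
        (sumCoact j M (DirectSum.lof k ι (fun i => (M i).carrier) i m))
    rw [DirectSum.lmap_lof, sumCoact_lof, sumCoact_lof]
    have h := LinearMap.congr_fun (f i).comm m
    simp only [LinearMap.comp_apply] at h
    rw [h]
    generalize (M i).coact m = t
    induction t using TensorProduct.induction_on with
    | zero => simp
    | add x y hx hy => simp only [map_add, hx, hy]
    | tmul x c => simp⟩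
  map_id M := by
    apply Comod.hom_ext
    refine DirectSum.linearMap_ext _ fun i => LinearMap.ext fun m => ?_
    exact DirectSum.lmap_lof _ _ _
  map_comp f g := by
    apply Comod.hom_ext
    refine DirectSum.linearMap_ext _ fun i => LinearMap.ext fun m => ?_
    change DirectSum.lmap _ _ = DirectSum.lmap (fun i => Comod.Hom.toLin (g i))
      (DirectSum.lmap (fun i => Comod.Hom.toLin (f i)) (DirectSum.lof k ι _ i m))
    rw [DirectSum.lmap_lof, DirectSum.lmap_lof, DirectSum.lmap_lof]
    rfl

variable [∀ i, FiniteDimensional k (C i)]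

/-- The product of `C i`-comodules, for finite dimensional `C i`, as an `H`-contramodule, through
coalgebra maps `j i : C i → H`: the `i`-th component of `α(f)` is `αⁱ(fᵢ ∘ jᵢ)`. -/
noncomputable def prodObj (j : ∀ i, C i →ₗc[k] H) (M : ∀ i, Comod k (C i)) : Contra k H where
  carrier := ∀ i, (M i).carrier
  contr := LinearMap.pi fun i =>
    (M i).finContr ∘ₗ LinearMap.lcomp k _ (j i).toLinearMap ∘ₗ
      LinearMap.compRight k (LinearMap.proj i)
  contraassoc := by
    intro f
    funext i
    have h := (M i).finContr_assoc (LinearMap.proj i ∘ₗ f ∘ₗ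
      TensorProduct.map (j i).toLinearMap (j i).toLinearMap)
    rw [LinearMap.comp_assoc, LinearMap.comp_assoc, (j i).map_comp_comul] at h
    exact h
  contr_counit := by
    intro n
    funext i
    refine Eq.trans ?_ ((M i).toContra.contr_counit (n i))
    rw [← (j i).counit_comp]
    rfl

/-- The functor `(Mᵢ) ↦ ∏ Mᵢ` from families of comodules to contramodules. -/
noncomputable def prodContra (j : ∀ i, C i →ₗc[k] H) :
    (∀ i, Comod k (C i)) ⥤ Contra k H where
  obj M := prodObj j M
  map {M N} f := ⟨LinearMap.pi fun i => Comod.Hom.toLin (f i) ∘ₗ LinearMap.proj i, by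
    intro g
    funext i
    exact (f i).finContr _⟩
  map_id _ := rfl
  map_comp _ _ := rfl

end SumProd
/-! ### The three-fold actions of a Hopf algebra -/

section Hopf

variable {k H : Type u} [Field k] [Ring H] [HopfAlgebra k H]

/-- For algebra maps `F`, `G` with commuting images, the algebra map `x ↦ F(x¹) G(x²)`. -/
noncomputable def convAlgHom {A : Type u} [Semiring A] [Algebra k A] (F G : H →ₐ[k] A)
    (h : ∀ a b, Commute (F a) (G b)) : H →ₐ[k] A :=
  (Algebra.TensorProduct.lift F G h).comp (Bialgebra.comulAlgHom k H)

open WithConv in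
theorem toConv_convAlgHom {A : Type u} [Semiring A] [Algebra k A] (F G : H →ₐ[k] A)
    (h : ∀ a b, Commute (F a) (G b)) :
    toConv (convAlgHom F G h).toLinearMap = toConv F.toLinearMap * toConv G.toLinearMap := by
  apply WithConv.ext
  apply LinearMap.ext
  intro x
  change Algebra.TensorProduct.lift F G h (Coalgebra.comul (R := k) x) =
    LinearMap.mul' k A (TensorProduct.map F.toLinearMap G.toLinearMap (Coalgebra.comul (R := k) x))
  generalize (Coalgebra.comul (R := k) x) = t
  induction t using TensorProduct.induction_on with
  | zero => simp
  | tmul x y => simp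
  | add x y hx hy => simp only [map_add, hx, hy]

theorem convAlgHom_commute {A : Type u} [Semiring A] [Algebra k A] (F G : H →ₐ[k] A)
    (h : ∀ a b, Commute (F a) (G b)) (z : A) (hF : ∀ a, Commute z (F a))
    (hG : ∀ a, Commute z (G a)) (x : H) : Commute z (convAlgHom F G h x) := by
  change Commute z (Algebra.TensorProduct.lift F G h (Coalgebra.comul (R := k) x))
  generalize (Coalgebra.comul (R := k) x) = t
  induction t using TensorProduct.induction_on with
  | zero => simp
  | tmul x y => simpa using (hF x).mul_right (hG y)
  | add x y hx hy => rw [map_add]; exact hx.add_right hy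

section Contra

variable (V : Type u) [AddCommGroup V] [Module k V]

/-- `x ↦ (φ ↦ φ(- x))` -/
noncomputable def preRight : H →ₐ[k] Module.End k (H →ₗ[k] V) :=
  AlgHom.ofLinearMap
    (LinearMap.mk₂ k (fun (x : H) (φ : H →ₗ[k] V) => φ ∘ₗ LinearMap.mulRight k x)
      (by intros; ext; simp [mul_add]) (by intros; ext; simp)
      (by intros; ext; simp) (by intros; ext; simp))
    (by ext; simp) (by intros; ext; simp [mul_assoc])

/-- `x ↦ (φ ↦ φ(S(x) -))` -/
noncomputable def preLeftS : H →ₐ[k] Module.End k (H →ₗ[k] V) :=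
  AlgHom.ofLinearMap
    (LinearMap.mk₂ k (fun (x : H) (φ : H →ₗ[k] V) =>
        φ ∘ₗ LinearMap.mulLeft k (HopfAlgebra.antipode k x))
      (by intros; ext; simp [add_mul]) (by intros; ext; simp)
      (by intros; ext; simp) (by intros; ext; simp))
    (by ext; simp) (by intros; ext; simp [HopfAlgebra.antipode_mul_antidistrib])

variable {V}

/-- `x ↦ (φ ↦ x φ(-))` -/
noncomputable def postAct (L : H →ₐ[k] Module.End k V) : H →ₐ[k] Module.End k (H →ₗ[k] V) :=
  AlgHom.ofLinearMap
    (LinearMap.mk₂ k (fun (x : H) (φ : H →ₗ[k] V) => L x ∘ₗ φ)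
      (by intros; ext; simp) (by intros; ext; simp)
      (by intros; ext; simp) (by intros; ext; simp))
    (by ext; simp) (by intros; ext; simp)

@[simp] theorem preRight_apply (x : H) (φ : H →ₗ[k] V) (h : H) :
    preRight V x φ h = φ (h * x) := rfl

@[simp] theorem preLeftS_apply (x : H) (φ : H →ₗ[k] V) (h : H) :
    preLeftS V x φ h = φ (HopfAlgebra.antipode k x * h) := rfl

@[simp] theorem postAct_apply (L : H →ₐ[k] Module.End k V) (x : H) (φ : H →ₗ[k] V) (h : H) :
    postAct L x φ h = L x (φ h) := rfl

theorem postAct_commute_preLeftS (L : H →ₐ[k] Module.End k V) (a b : H) :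
    Commute (postAct L a) (preLeftS V b) := rfl

theorem preRight_commute_postAct (L : H →ₐ[k] Module.End k V) (a b : H) :
    Commute (preRight V a) (postAct L b) := rfl

theorem preRight_commute_preLeftS (a b : H) :
    Commute (preRight (k := k) V a) (preLeftS V b) := by
  ext; simp [mul_assoc]

/-- The action `x · φ = x² φ(S(x³) - x¹)` of `H` on `Hom(H, V)`. -/
noncomputable def contraAct (L : H →ₐ[k] Module.End k V) : H →ₐ[k] Module.End k (H →ₗ[k] V) :=
  convAlgHom (preRight V) (convAlgHom (postAct L) (preLeftS V) (postAct_commute_preLeftS L))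
    fun a b => convAlgHom_commute _ _ _ _ (preRight_commute_postAct L a)
      (preRight_commute_preLeftS a) b

end Contra

section CoactTarget

variable (V : Type u) [AddCommGroup V] [Module k V]

/-- `x ↦ (v ⊗ h ↦ v ⊗ h S(x))` -/
noncomputable def tensRightS : H →ₐ[k] Module.End k (V ⊗[k] H) :=
  AlgHom.ofLinearMap
    (LinearMap.lTensorHom V ∘ₗ (LinearMap.mul k H).flip ∘ₗ HopfAlgebra.antipode k)
    (by ext; simp) (by intros; ext; simp [mul_assoc, HopfAlgebra.antipode_mul_antidistrib])

/-- `x ↦ (v ⊗ h ↦ v ⊗ x h)` -/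
noncomputable def tensLeft : H →ₐ[k] Module.End k (V ⊗[k] H) :=
  AlgHom.ofLinearMap (LinearMap.lTensorHom V ∘ₗ LinearMap.mul k H)
    (by ext; simp) (by intros; ext; simp [mul_assoc])

variable {V}

/-- `x ↦ (v ⊗ h ↦ x v ⊗ h)` -/
noncomputable def tensAct (L : H →ₐ[k] Module.End k V) : H →ₐ[k] Module.End k (V ⊗[k] H) :=
  AlgHom.ofLinearMap (LinearMap.rTensorHom H ∘ₗ L.toLinearMap)
    (by ext; simp) (by intros; ext; simp)

@[simp] theorem tensRightS_tmul (x : H) (v : V) (h : H) :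
    tensRightS (k := k) V x (v ⊗ₜ h) = v ⊗ₜ (h * HopfAlgebra.antipode k x) := rfl

@[simp] theorem tensLeft_tmul (x : H) (v : V) (h : H) :
    tensLeft (k := k) V x (v ⊗ₜ h) = v ⊗ₜ (x * h) := rfl

@[simp] theorem tensAct_tmul (L : H →ₐ[k] Module.End k V) (x : H) (v : V) (h : H) :
    tensAct L x (v ⊗ₜ h) = L x v ⊗ₜ h := rfl

theorem tensAct_commute_tensLeft (L : H →ₐ[k] Module.End k V) (a b : H) :
    Commute (tensAct L a) (tensLeft V b) := by
  refine TensorProduct.ext' fun v h => ?_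
  simp

theorem tensRightS_commute_tensAct (L : H →ₐ[k] Module.End k V) (a b : H) :
    Commute (tensRightS V a) (tensAct L b) := by
  refine TensorProduct.ext' fun v h => ?_
  simp

theorem tensRightS_commute_tensLeft (a b : H) :
    Commute (tensRightS (k := k) V a) (tensLeft V b) := by
  refine TensorProduct.ext' fun v h => ?_
  simp [mul_assoc]

/-- The action `x · (v ⊗ h) = x² v ⊗ x³ h S(x¹)` of `H` on `V ⊗ H`. -/
noncomputable def comodAct (L : H →ₐ[k] Module.End k V) : H →ₐ[k] Module.End k (V ⊗[k] H) :=
  convAlgHom (tensRightS V) (convAlgHom (tensAct L) (tensLeft V) (tensAct_commute_tensLeft L))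
    fun a b => convAlgHom_commute _ _ _ _ (tensRightS_commute_tensAct L a)
      (tensRightS_commute_tensLeft a) b

end CoactTarget

section Free

variable (V : Type u) [AddCommGroup V] [Module k V]

/-- `x ↦ (h ⊗ v ↦ h S(x) ⊗ v)` -/
noncomputable def freeRightS : H →ₐ[k] Module.End k (H ⊗[k] V) :=
  AlgHom.ofLinearMap
    (LinearMap.rTensorHom V ∘ₗ (LinearMap.mul k H).flip ∘ₗ HopfAlgebra.antipode k)
    (by ext; simp) (by intros; ext; simp [mul_assoc, HopfAlgebra.antipode_mul_antidistrib])

/-- `x ↦ (h ⊗ v ↦ x h ⊗ v)` -/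
noncomputable def freeLeft : H →ₐ[k] Module.End k (H ⊗[k] V) :=
  AlgHom.ofLinearMap (LinearMap.rTensorHom V ∘ₗ LinearMap.mul k H)
    (by ext; simp) (by intros; ext; simp [mul_assoc])

variable {V}

/-- `x ↦ (h ⊗ v ↦ h ⊗ x v)` -/
noncomputable def freeMid (L : H →ₐ[k] Module.End k V) : H →ₐ[k] Module.End k (H ⊗[k] V) :=
  AlgHom.ofLinearMap (LinearMap.lTensorHom H ∘ₗ L.toLinearMap)
    (by ext; simp) (by intros; ext; simp)

@[simp] theorem freeRightS_tmul (x : H) (v : V) (h : H) :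
    freeRightS (k := k) V x (h ⊗ₜ v) = (h * HopfAlgebra.antipode k x) ⊗ₜ v := rfl

@[simp] theorem freeLeft_tmul (x : H) (v : V) (h : H) :
    freeLeft (k := k) V x (h ⊗ₜ v) = (x * h) ⊗ₜ v := rfl

@[simp] theorem freeMid_tmul (L : H →ₐ[k] Module.End k V) (x : H) (v : V) (h : H) :
    freeMid L x (h ⊗ₜ v) = h ⊗ₜ L x v := rfl

theorem freeMid_commute_freeLeft (L : H →ₐ[k] Module.End k V) (a b : H) :
    Commute (freeMid L a) (freeLeft V b) := by
  refine TensorProduct.ext' fun v h => ?_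
  simp

theorem freeRightS_commute_freeMid (L : H →ₐ[k] Module.End k V) (a b : H) :
    Commute (freeRightS V a) (freeMid L b) := by
  refine TensorProduct.ext' fun v h => ?_
  simp

theorem freeRightS_commute_freeLeft (a b : H) :
    Commute (freeRightS (k := k) V a) (freeLeft V b) := by
  refine TensorProduct.ext' fun v h => ?_
  simp [mul_assoc]

/-- The action `x · (h ⊗ v) = x³ h S(x¹) ⊗ x² v` of `H` on `H ⊗ V`. -/
noncomputable def freeAct (L : H →ₐ[k] Module.End k V) : H →ₐ[k] Module.End k (H ⊗[k] V) :=
  convAlgHom (freeRightS V) (convAlgHom (freeMid L) (freeLeft V) (freeMid_commute_freeLeft L))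
    fun a b => convAlgHom_commute _ _ _ _ (freeRightS_commute_freeMid L a)
      (freeRightS_commute_freeLeft a) b

end Free

end Hopf
/-! ### Equivariance of the structure maps -/

section Equivariance

open WithConv

variable {k H : Type u} [Field k] [Ring H] [HopfAlgebra k H]

theorem conv_transport {A B X : Type u} [Semiring A] [Algebra k A] [Semiring B] [Algebra k B]
    [AddCommMonoid X] [Module k X] {F G : WithConv (H →ₗ[k] A)} {P Q : WithConv (H →ₗ[k] B)}
    (e : A →ₗ[k] X) (f : B →ₗ[k] X)
    (h : ∀ a b, e (F.ofConv a * G.ofConv b) = f (P.ofConv a * Q.ofConv b)) (x : H) :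
    e ((F * G).ofConv x) = f ((P * Q).ofConv x) := by
  change e (LinearMap.mul' k A (TensorProduct.map F.ofConv G.ofConv (Coalgebra.comul (R := k) x)))
    = f (LinearMap.mul' k B (TensorProduct.map P.ofConv Q.ofConv (Coalgebra.comul (R := k) x)))
  generalize (Coalgebra.comul (R := k) x) = t
  induction t using TensorProduct.induction_on with
  | zero => simp
  | tmul x y => simpa using h x y
  | add x y hx hy => simp only [map_add, hx, hy]

/-- `T` intertwines the families of operators `F` and `G`. -/
def Intertw {V W : Type u} [AddCommMonoid V] [Module k V] [AddCommMonoid W] [Module k W]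
    (T : V →ₗ[k] W) (F : WithConv (H →ₗ[k] Module.End k V))
    (G : WithConv (H →ₗ[k] Module.End k W)) : Prop :=
  ∀ x v, T (F.ofConv x v) = G.ofConv x (T v)

theorem Intertw.mul {V W : Type u} [AddCommMonoid V] [Module k V] [AddCommMonoid W] [Module k W]
    {T : V →ₗ[k] W} {F F' : WithConv (H →ₗ[k] Module.End k V)}
    {G G' : WithConv (H →ₗ[k] Module.End k W)} (h : Intertw T F G) (h' : Intertw T F' G') :
    Intertw T (F * F') (G * G') := by
  intro x v
  refine conv_transport (T ∘ₗ LinearMap.applyₗ v) (LinearMap.applyₗ (T v)) (fun a b => ?_) x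
  simp only [LinearMap.comp_apply, LinearMap.applyₗ_apply_apply, Module.End.mul_apply]
  rw [h, h']

/-! Identities in the convolution ring of maps `H → H ⊗ H`. -/

section Elements

theorem algHom_conv_antipode {A : Type u} [Semiring A] [Algebra k A] (g : H →ₐ[k] A) :
    toConv g.toLinearMap * toConv (g.toLinearMap ∘ₗ HopfAlgebra.antipode k) = 1 := by
  have h := LinearMap.algHom_comp_convMul_distrib g (toConv (LinearMap.id (R := k) (M := H)))
    (toConv (HopfAlgebra.antipode k (A := H)))
  rw [LinearMap.id_mul_antipode] at h
  apply WithConv.ext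
  refine Eq.trans h.symm ?_
  ext x
  simp

theorem antipode_conv_algHom {A : Type u} [Semiring A] [Algebra k A] (g : H →ₐ[k] A) :
    toConv (g.toLinearMap ∘ₗ HopfAlgebra.antipode k) * toConv g.toLinearMap = 1 := by
  have h := LinearMap.algHom_comp_convMul_distrib g (toConv (HopfAlgebra.antipode k (A := H)))
    (toConv (LinearMap.id (R := k) (M := H)))
  rw [LinearMap.antipode_mul_id] at h
  apply WithConv.ext
  refine Eq.trans h.symm ?_
  ext x
  simp

variable (k H)

/-- `x ↦ x ⊗ 1` -/
noncomputable def cU : WithConv (H →ₗ[k] H ⊗[k] H) :=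
  toConv (Algebra.TensorProduct.includeLeft : H →ₐ[k] H ⊗[k] H).toLinearMap

/-- `x ↦ 1 ⊗ x` -/
noncomputable def cV : WithConv (H →ₗ[k] H ⊗[k] H) :=
  toConv (Algebra.TensorProduct.includeRight : H →ₐ[k] H ⊗[k] H).toLinearMap

/-- `x ↦ Δ(x)` -/
noncomputable def cD : WithConv (H →ₗ[k] H ⊗[k] H) :=
  toConv (Bialgebra.comulAlgHom k H).toLinearMap

/-- `x ↦ S(x) ⊗ 1` -/
noncomputable def cUS : WithConv (H →ₗ[k] H ⊗[k] H) :=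
  toConv ((Algebra.TensorProduct.includeLeft : H →ₐ[k] H ⊗[k] H).toLinearMap ∘ₗ
    HopfAlgebra.antipode k)

/-- `x ↦ 1 ⊗ S(x)` -/
noncomputable def cVS : WithConv (H →ₗ[k] H ⊗[k] H) :=
  toConv ((Algebra.TensorProduct.includeRight : H →ₐ[k] H ⊗[k] H).toLinearMap ∘ₗ
    HopfAlgebra.antipode k)

/-- `x ↦ Δ(S(x))` -/
noncomputable def cDS : WithConv (H →ₗ[k] H ⊗[k] H) :=
  toConv ((Bialgebra.comulAlgHom k H).toLinearMap ∘ₗ HopfAlgebra.antipode k)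

theorem cU_mul_cV : cU k H * cV k H = cD k H := by
  apply WithConv.ext
  apply LinearMap.ext
  intro x
  change LinearMap.mul' k _ (TensorProduct.map _ _ (Coalgebra.comul (R := k) x)) =
    Coalgebra.comul (R := k) x
  generalize (Coalgebra.comul (R := k) x) = t
  induction t using TensorProduct.induction_on with
  | zero => simp
  | tmul x y => simp [cU, cV]
  | add x y hx hy => simp only [map_add, hx, hy]

theorem cU_cUS : cU k H * cUS k H = 1 := algHom_conv_antipode _
theorem cUS_cU : cUS k H * cU k H = 1 := antipode_conv_algHom _
theorem cV_cVS : cV k H * cVS k H = 1 := algHom_conv_antipode _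
theorem cVS_cV : cVS k H * cV k H = 1 := antipode_conv_algHom _
theorem cD_cDS : cD k H * cDS k H = 1 := algHom_conv_antipode _
theorem cDS_cD : cDS k H * cD k H = 1 := antipode_conv_algHom _

theorem cD_cVS : cD k H * cVS k H = cU k H := by
  rw [← cU_mul_cV, mul_assoc, cV_cVS, mul_one]

theorem cUS_cD : cUS k H * cD k H = cV k H := by
  rw [← cU_mul_cV, ← mul_assoc, cUS_cU, one_mul]

theorem cV_cDS : cV k H * cDS k H = cUS k H := by
  rw [← cUS_cD, mul_assoc, cD_cDS, mul_one]

theorem cDS_cU : cDS k H * cU k H = cVS k H := by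
  rw [← cD_cVS, ← mul_assoc, cDS_cD, one_mul]

theorem cVS_cUS : cVS k H * cUS k H = cDS k H := by
  rw [← cDS_cU, mul_assoc, cU_cUS, mul_one]

end Elements

/-! Decompositions of the actions in convolution rings. -/

section Decomp

variable {V : Type u} [AddCommGroup V] [Module k V]

theorem toConv_contraAct (L : H →ₐ[k] Module.End k V) :
    toConv (contraAct L).toLinearMap = toConv (preRight V).toLinearMap *
      (toConv (postAct L).toLinearMap * toConv (preLeftS V).toLinearMap) := by
  rw [contraAct, toConv_convAlgHom, toConv_convAlgHom]

theorem toConv_comodAct (L : H →ₐ[k] Module.End k V) :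
    toConv (comodAct L).toLinearMap = toConv (tensRightS V).toLinearMap *
      (toConv (tensAct L).toLinearMap * toConv (tensLeft V).toLinearMap) := by
  rw [comodAct, toConv_convAlgHom, toConv_convAlgHom]

theorem toConv_freeAct (L : H →ₐ[k] Module.End k V) :
    toConv (freeAct L).toLinearMap = toConv (freeRightS V).toLinearMap *
      (toConv (freeMid L).toLinearMap * toConv (freeLeft V).toLinearMap) := by
  rw [freeAct, toConv_convAlgHom, toConv_convAlgHom]

theorem conv_decomp {A B : Type u} [Semiring A] [Algebra k A] [Semiring B] [Algebra k B]
    (J : A →ₗ[k] B) (hJ : ∀ a b, J (a * b) = J a * J b) (F G : WithConv (H →ₗ[k] A)) :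
    toConv (J ∘ₗ (F * G).ofConv) = toConv (J ∘ₗ F.ofConv) * toConv (J ∘ₗ G.ofConv) := by
  apply WithConv.ext
  apply LinearMap.ext
  intro x
  exact conv_transport (F := F) (G := G) (P := toConv (J ∘ₗ F.ofConv))
    (Q := toConv (J ∘ₗ G.ofConv)) J LinearMap.id (fun a b => hJ _ _) x

theorem conv_decomp₃ {A B : Type u} [Semiring A] [Algebra k A] [Semiring B] [Algebra k B]
    (J : A →ₗ[k] B) (hJ : ∀ a b, J (a * b) = J a * J b) {E F G K : WithConv (H →ₗ[k] A)}
    (h : E = F * (G * K)) :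
    toConv (J ∘ₗ E.ofConv) = toConv (J ∘ₗ F.ofConv) *
      (toConv (J ∘ₗ G.ofConv) * toConv (J ∘ₗ K.ofConv)) := by
  rw [h, conv_decomp J hJ, conv_decomp J hJ]

/-- `T ↦ (φ ↦ T ∘ φ)` -/
noncomputable def jPost : Module.End k V →ₗ[k] Module.End k (H →ₗ[k] V) :=
  LinearMap.llcomp k H V V

/-- `T ↦ T ⊗ id` -/
noncomputable def jTens : Module.End k V →ₗ[k] Module.End k (V ⊗[k] H) :=
  LinearMap.rTensorHom H

/-- `T ↦ id ⊗ T` -/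
noncomputable def jFree : Module.End k V →ₗ[k] Module.End k (H ⊗[k] V) :=
  LinearMap.lTensorHom H

theorem jPost_mul (a b : Module.End k V) :
    jPost (H := H) (a * b) = jPost a * jPost b := rfl

theorem jTens_mul (a b : Module.End k V) :
    jTens (H := H) (a * b) = jTens a * jTens b := LinearMap.rTensor_mul H a b

theorem jFree_mul (a b : Module.End k V) :
    jFree (H := H) (a * b) = jFree a * jFree b := LinearMap.lTensor_mul H a b

theorem postAct_decomp (L : H →ₐ[k] Module.End k V) {F G K : WithConv (H →ₗ[k] Module.End k V)}
    (h : toConv L.toLinearMap = F * (G * K)) :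
    toConv (postAct L).toLinearMap =
      toConv (jPost ∘ₗ F.ofConv) * (toConv (jPost ∘ₗ G.ofConv) * toConv (jPost ∘ₗ K.ofConv)) :=
  conv_decomp₃ (E := toConv L.toLinearMap) (F := F) (G := G) (K := K) (jPost (H := H)) jPost_mul h

theorem tensAct_decomp (L : H →ₐ[k] Module.End k V) {F G K : WithConv (H →ₗ[k] Module.End k V)}
    (h : toConv L.toLinearMap = F * (G * K)) :
    toConv (tensAct L).toLinearMap =
      toConv (jTens ∘ₗ F.ofConv) * (toConv (jTens ∘ₗ G.ofConv) * toConv (jTens ∘ₗ K.ofConv)) :=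
  conv_decomp₃ (E := toConv L.toLinearMap) (F := F) (G := G) (K := K) (jTens (H := H)) jTens_mul h

theorem freeMid_decomp (L : H →ₐ[k] Module.End k V) {F G K : WithConv (H →ₗ[k] Module.End k V)}
    (h : toConv L.toLinearMap = F * (G * K)) :
    toConv (freeMid L).toLinearMap =
      toConv (jFree ∘ₗ F.ofConv) * (toConv (jFree ∘ₗ G.ofConv) * toConv (jFree ∘ₗ K.ofConv)) :=
  conv_decomp₃ (E := toConv L.toLinearMap) (F := F) (G := G) (K := K) (jFree (H := H)) jFree_mul h

theorem mul_regroup {A : Type u} [Semigroup A] (a b c d e : A) :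
    a * ((b * (c * d)) * e) = (a * b) * (c * (d * e)) := by
  simp only [mul_assoc]

end Decomp

/-! Naturality of the three actions. -/

section Natural

variable {V W : Type u} [AddCommGroup V] [Module k V] [AddCommGroup W] [Module k W]
  {L : H →ₐ[k] Module.End k V} {L' : H →ₐ[k] Module.End k W}

theorem contraAct_natural {T : V →ₗ[k] W} (hT : ∀ x v, T (L x v) = L' x (T v)) (x : H)
    (φ : H →ₗ[k] V) : T ∘ₗ contraAct L x φ = contraAct L' x (T ∘ₗ φ) := by
  have : Intertw (LinearMap.compRight k T : (H →ₗ[k] V) →ₗ[k] (H →ₗ[k] W))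
      (toConv (contraAct L).toLinearMap) (toConv (contraAct L').toLinearMap) := by
    rw [toConv_contraAct, toConv_contraAct]
    refine Intertw.mul (fun x φ => rfl) (Intertw.mul (fun x φ => ?_) (fun x φ => rfl))
    ext h
    exact hT _ _
  exact this x φ

theorem comodAct_natural {T : V →ₗ[k] W} (hT : ∀ x v, T (L x v) = L' x (T v)) (x : H)
    (t : V ⊗[k] H) : T.rTensor H (comodAct L x t) = comodAct L' x (T.rTensor H t) := by
  have : Intertw (T.rTensor H)
      (toConv (comodAct L).toLinearMap) (toConv (comodAct L').toLinearMap) := by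
    rw [toConv_comodAct, toConv_comodAct]
    refine Intertw.mul (fun x t => ?_) (Intertw.mul (fun x t => ?_) (fun x t => ?_)) <;>
    · induction t using TensorProduct.induction_on with
      | zero => simp
      | tmul x y => simp [hT]
      | add x y hx hy => simp only [map_add, hx, hy]
  exact this x t

theorem freeAct_natural {T : V →ₗ[k] W} (hT : ∀ x v, T (L x v) = L' x (T v)) (x : H)
    (t : H ⊗[k] V) : T.lTensor H (freeAct L x t) = freeAct L' x (T.lTensor H t) := by
  have : Intertw (T.lTensor H)
      (toConv (freeAct L).toLinearMap) (toConv (freeAct L').toLinearMap) := by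
    rw [toConv_freeAct, toConv_freeAct]
    refine Intertw.mul (fun x t => ?_) (Intertw.mul (fun x t => ?_) (fun x t => ?_)) <;>
    · induction t using TensorProduct.induction_on with
      | zero => simp
      | tmul x y => simp [hT]
      | add x y hx hy => simp only [map_add, hx, hy]
  exact this x t

end Natural

section Structure

variable {V : Type u} [AddCommGroup V] [Module k V] (L : H →ₐ[k] Module.End k V)

/-- `φ ↦ (φ ⊗ id) ∘ Δ` -/
noncomputable def homCoact (k H V : Type u) [Field k] [Ring H] [HopfAlgebra k H]
    [AddCommGroup V] [Module k V] : (H →ₗ[k] V) →ₗ[k] (H →ₗ[k] V ⊗[k] H) :=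
  LinearMap.lcomp k _ (Coalgebra.comul (R := k) (A := H)) ∘ₗ LinearMap.rTensorHom H

theorem homCoact_apply (φ : H →ₗ[k] V) (h : H) :
    homCoact k H V φ h = φ.rTensor H (Coalgebra.comul (R := k) h) := rfl

theorem homCoact_contraAct (x : H) (φ : H →ₗ[k] V) :
    homCoact k H V (contraAct L x φ) = contraAct (comodAct L) x (homCoact k H V φ) := by
  have : Intertw (homCoact k H V)
      (toConv (contraAct L).toLinearMap) (toConv (contraAct (comodAct L)).toLinearMap) := by
    rw [toConv_contraAct, toConv_contraAct]
    rw [postAct_decomp (comodAct L) (toConv_comodAct L), mul_regroup]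
    refine Intertw.mul (fun x φ => ?_) (Intertw.mul (fun x φ => ?_) (fun x φ => ?_))
    · ext h
      symm
      refine (conv_transport (P := cD k H) (Q := cVS k H)
        (LinearMap.applyₗ h ∘ₗ LinearMap.applyₗ (homCoact k H V φ))
        (φ.rTensor H ∘ₗ LinearMap.mulLeft k (Coalgebra.comul (R := k) h))
        (fun a b => ?_) x).trans ?_
      · change LinearMap.lTensor V _ (φ.rTensor H (Coalgebra.comul (R := k) (h * a))) =
          φ.rTensor H (Coalgebra.comul (R := k) h * (Coalgebra.comul (R := k) a *
            (1 ⊗ₜ[k] HopfAlgebra.antipode k b)))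
        rw [Bialgebra.comul_mul, ← mul_assoc]
        generalize Coalgebra.comul (R := k) h * Coalgebra.comul (R := k) a = t
        induction t using TensorProduct.induction_on with
        | zero => simp
        | tmul x y => simp
        | add x y hx hy => simp only [map_add, add_mul, hx, hy]
      · rw [cD_cVS]
        change φ.rTensor H (Coalgebra.comul (R := k) h * (x ⊗ₜ[k] 1)) =
          (φ ∘ₗ LinearMap.mulRight k x).rTensor H (Coalgebra.comul (R := k) h)
        generalize Coalgebra.comul (R := k) h = t
        induction t using TensorProduct.induction_on with
        | zero => simp
        | tmul x y => simp
        | add x y hx hy => simp only [map_add, add_mul, hx, hy]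
    · ext h
      change (L x ∘ₗ φ).rTensor H (Coalgebra.comul (R := k) h) =
        (L x).rTensor H (φ.rTensor H (Coalgebra.comul (R := k) h))
      rw [LinearMap.rTensor_comp, LinearMap.comp_apply]
    · ext h
      symm
      refine (conv_transport (P := cV k H) (Q := cDS k H)
        (LinearMap.applyₗ h ∘ₗ LinearMap.applyₗ (homCoact k H V φ))
        (φ.rTensor H ∘ₗ LinearMap.mulRight k (Coalgebra.comul (R := k) h))
        (fun a b => ?_) x).trans ?_
      · change LinearMap.lTensor V _ (φ.rTensor H (Coalgebra.comul (R := k)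
            (HopfAlgebra.antipode k b * h))) =
          φ.rTensor H ((1 ⊗ₜ[k] a) * Coalgebra.comul (R := k) (HopfAlgebra.antipode k b) *
            Coalgebra.comul (R := k) h)
        rw [Bialgebra.comul_mul, mul_assoc]
        generalize Coalgebra.comul (R := k) (HopfAlgebra.antipode k b) *
          Coalgebra.comul (R := k) h = t
        induction t using TensorProduct.induction_on with
        | zero => simp
        | tmul x y => simp
        | add x y hx hy => simp only [map_add, mul_add, hx, hy]
      · rw [cV_cDS]
        change φ.rTensor H ((HopfAlgebra.antipode k x ⊗ₜ[k] 1) * Coalgebra.comul (R := k) h) =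
          (φ ∘ₗ LinearMap.mulLeft k (HopfAlgebra.antipode k x)).rTensor H
            (Coalgebra.comul (R := k) h)
        generalize Coalgebra.comul (R := k) h = t
        induction t using TensorProduct.induction_on with
        | zero => simp
        | tmul x y => simp
        | add x y hx hy => simp only [map_add, mul_add, hx, hy]
  exact this x φ

theorem diagEval_contraAct (x : H) (θ : H →ₗ[k] H →ₗ[k] V) :
    diagEval k H V (contraAct (contraAct L) x θ) = contraAct L x (diagEval k H V θ) := by
  have : Intertw (diagEval k H V) (toConv (contraAct (contraAct L)).toLinearMap)
      (toConv (contraAct L).toLinearMap) := by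
    rw [toConv_contraAct, toConv_contraAct]
    rw [postAct_decomp (contraAct L) (toConv_contraAct L), mul_regroup]
    refine Intertw.mul (fun x θ => ?_) (Intertw.mul (fun x θ => ?_) (fun x θ => ?_))
    · ext h
      refine (conv_transport (P := cU k H) (Q := cV k H)
        (LinearMap.applyₗ h ∘ₗ diagEval k H V ∘ₗ LinearMap.applyₗ θ)
        (TensorProduct.lift θ ∘ₗ LinearMap.mulLeft k (Coalgebra.comul (R := k) h))
        (fun a b => ?_) x).trans ?_
      · change TensorProduct.lift _ (Coalgebra.comul (R := k) h) =
          TensorProduct.lift θ (Coalgebra.comul (R := k) h * ((a ⊗ₜ[k] 1) * (1 ⊗ₜ[k] b)))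
        generalize Coalgebra.comul (R := k) h = t
        induction t using TensorProduct.induction_on with
        | zero => simp
        | tmul x y => simp; rfl
        | add x y hx hy => simp only [map_add, add_mul, hx, hy]
      · rw [cU_mul_cV]
        change TensorProduct.lift θ (Coalgebra.comul (R := k) h * Coalgebra.comul (R := k) x) =
          TensorProduct.lift θ (Coalgebra.comul (R := k) (h * x))
        rw [Bialgebra.comul_mul]
    · ext h
      change TensorProduct.lift _ (Coalgebra.comul (R := k) h) =
        L x (TensorProduct.lift θ (Coalgebra.comul (R := k) h))
      generalize Coalgebra.comul (R := k) h = t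
      induction t using TensorProduct.induction_on with
      | zero => simp
      | tmul x y => rfl
      | add x y hx hy => simp only [map_add, hx, hy]
    · ext h
      refine (conv_transport (P := cVS k H) (Q := cUS k H)
        (LinearMap.applyₗ h ∘ₗ diagEval k H V ∘ₗ LinearMap.applyₗ θ)
        (TensorProduct.lift θ ∘ₗ LinearMap.mulRight k (Coalgebra.comul (R := k) h))
        (fun a b => ?_) x).trans ?_
      · change TensorProduct.lift _ (Coalgebra.comul (R := k) h) =
          TensorProduct.lift θ (((1 ⊗ₜ[k] HopfAlgebra.antipode k a) *
            (HopfAlgebra.antipode k b ⊗ₜ[k] 1)) * Coalgebra.comul (R := k) h)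
        generalize Coalgebra.comul (R := k) h = t
        induction t using TensorProduct.induction_on with
        | zero => simp
        | tmul x y => simp; rfl
        | add x y hx hy => simp only [map_add, mul_add, hx, hy]
      · rw [cVS_cUS]
        change TensorProduct.lift θ (Coalgebra.comul (R := k) (HopfAlgebra.antipode k x) *
            Coalgebra.comul (R := k) h) =
          TensorProduct.lift θ (Coalgebra.comul (R := k) (HopfAlgebra.antipode k x * h))
        rw [Bialgebra.comul_mul]
  exact this x θ

theorem spread_freeAct (x : H) (t : H ⊗[k] (H →ₗ[k] V)) :
    spread k H V (freeAct (contraAct L) x t) = freeAct L x (spread k H V t) := by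
  have : Intertw (spread k H V) (toConv (freeAct (contraAct L)).toLinearMap)
      (toConv (freeAct L).toLinearMap) := by
    rw [toConv_freeAct, toConv_freeAct]
    rw [freeMid_decomp (contraAct L) (toConv_contraAct L), mul_regroup]
    refine Intertw.mul (fun x t => ?_) (Intertw.mul (fun x t => ?_) (fun x t => ?_))
    · induction t using TensorProduct.induction_on with
      | zero => simp
      | add x y hx hy => simp only [map_add, hx, hy]
      | tmul h φ =>
      refine (conv_transport (P := cDS k H) (Q := cU k H)
        (spread k H V ∘ₗ LinearMap.applyₗ (h ⊗ₜ[k] φ))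
        ((TensorProduct.comm k V H).toLinearMap ∘ₗ φ.rTensor H ∘ₗ
          LinearMap.mulLeft k (Coalgebra.comul (R := k) h))
        (fun a b => ?_) x).trans ?_
      · change TensorProduct.comm k V H ((φ ∘ₗ LinearMap.mulRight k b).rTensor H
            (Coalgebra.comul (R := k) (h * HopfAlgebra.antipode k a))) =
          TensorProduct.comm k V H (φ.rTensor H (Coalgebra.comul (R := k) h *
            (Coalgebra.comul (R := k) (HopfAlgebra.antipode k a) * (b ⊗ₜ[k] 1))))
        rw [Bialgebra.comul_mul, ← mul_assoc]
        generalize Coalgebra.comul (R := k) h *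
          Coalgebra.comul (R := k) (HopfAlgebra.antipode k a) = t
        induction t using TensorProduct.induction_on with
        | zero => simp
        | tmul x y => simp
        | add x y hx hy => simp only [map_add, add_mul, hx, hy]
      · rw [cDS_cU]
        change TensorProduct.comm k V H (φ.rTensor H (Coalgebra.comul (R := k) h *
            (1 ⊗ₜ[k] HopfAlgebra.antipode k x))) =
          freeRightS V x (TensorProduct.comm k V H (φ.rTensor H (Coalgebra.comul (R := k) h)))
        generalize Coalgebra.comul (R := k) h = t
        induction t using TensorProduct.induction_on with
        | zero => simp
        | tmul x y => simp
        | add x y hx hy => simp only [map_add, add_mul, hx, hy]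
    · induction t using TensorProduct.induction_on with
      | zero => simp
      | add x y hx hy => simp only [map_add, hx, hy]
      | tmul h φ =>
        change TensorProduct.comm k V H ((L x ∘ₗ φ).rTensor H (Coalgebra.comul (R := k) h)) =
          freeMid L x (TensorProduct.comm k V H (φ.rTensor H (Coalgebra.comul (R := k) h)))
        generalize Coalgebra.comul (R := k) h = t
        induction t using TensorProduct.induction_on with
        | zero => simp
        | tmul x y => simp
        | add x y hx hy => simp only [map_add, hx, hy]
    · induction t using TensorProduct.induction_on with
      | zero => simp
      | add x y hx hy => simp only [map_add, hx, hy]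
      | tmul h φ =>
      refine (conv_transport (P := cUS k H) (Q := cD k H)
        (spread k H V ∘ₗ LinearMap.applyₗ (h ⊗ₜ[k] φ))
        ((TensorProduct.comm k V H).toLinearMap ∘ₗ φ.rTensor H ∘ₗ
          LinearMap.mulRight k (Coalgebra.comul (R := k) h))
        (fun a b => ?_) x).trans ?_
      · change TensorProduct.comm k V H
            ((φ ∘ₗ LinearMap.mulLeft k (HopfAlgebra.antipode k a)).rTensor H
              (Coalgebra.comul (R := k) (b * h))) =
          TensorProduct.comm k V H (φ.rTensor H ((HopfAlgebra.antipode k a ⊗ₜ[k] 1) *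
            Coalgebra.comul (R := k) b * Coalgebra.comul (R := k) h))
        rw [Bialgebra.comul_mul, mul_assoc]
        generalize Coalgebra.comul (R := k) b * Coalgebra.comul (R := k) h = t
        induction t using TensorProduct.induction_on with
        | zero => simp
        | tmul x y => simp
        | add x y hx hy => simp only [map_add, mul_add, hx, hy]
      · rw [cUS_cD]
        change TensorProduct.comm k V H (φ.rTensor H ((1 ⊗ₜ[k] x) *
            Coalgebra.comul (R := k) h)) =
          freeLeft V x (TensorProduct.comm k V H (φ.rTensor H (Coalgebra.comul (R := k) h)))
        generalize Coalgebra.comul (R := k) h = t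
        induction t using TensorProduct.induction_on with
        | zero => simp
        | tmul x y => simp
        | add x y hx hy => simp only [map_add, mul_add, hx, hy]
  exact this x t

theorem freeCoact_freeAct (x : H) (t : H ⊗[k] V) :
    freeCoact k H V (freeAct L x t) = comodAct (freeAct L) x (freeCoact k H V t) := by
  have : Intertw (freeCoact k H V) (toConv (freeAct L).toLinearMap)
      (toConv (comodAct (freeAct L)).toLinearMap) := by
    rw [toConv_freeAct, toConv_comodAct]
    rw [tensAct_decomp (freeAct L) (toConv_freeAct L), mul_regroup]
    refine Intertw.mul (fun x t => ?_) (Intertw.mul (fun x t => ?_) (fun x t => ?_))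
    · induction t using TensorProduct.induction_on with
      | zero => simp
      | add x y hx hy => simp only [map_add, hx, hy]
      | tmul h v =>
      symm
      refine (conv_transport (P := cVS k H) (Q := cUS k H)
        (LinearMap.applyₗ (freeCoact k H V (h ⊗ₜ[k] v)))
        ((TensorProduct.rightComm k H H V).toLinearMap ∘ₗ (TensorProduct.mk k _ V).flip v ∘ₗ
          LinearMap.mulLeft k (Coalgebra.comul (R := k) h))
        (fun a b => ?_) x).trans ?_
      · change LinearMap.lTensor _ _ (LinearMap.rTensor H _
            (TensorProduct.rightComm k H H V (Coalgebra.comul (R := k) h ⊗ₜ v))) =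
          TensorProduct.rightComm k H H V ((Coalgebra.comul (R := k) h *
            ((1 ⊗ₜ[k] HopfAlgebra.antipode k a) * (HopfAlgebra.antipode k b ⊗ₜ[k] 1))) ⊗ₜ v)
        generalize Coalgebra.comul (R := k) h = t
        induction t using TensorProduct.induction_on with
        | zero => simp
        | tmul x y => simp
        | add x y hx hy => simp only [map_add, add_mul, TensorProduct.add_tmul, hx, hy]
      · rw [cVS_cUS]
        change TensorProduct.rightComm k H H V ((Coalgebra.comul (R := k) h *
            Coalgebra.comul (R := k) (HopfAlgebra.antipode k x)) ⊗ₜ v) =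
          TensorProduct.rightComm k H H V
            (Coalgebra.comul (R := k) (h * HopfAlgebra.antipode k x) ⊗ₜ v)
        rw [Bialgebra.comul_mul]
    · induction t using TensorProduct.induction_on with
      | zero => simp
      | add x y hx hy => simp only [map_add, hx, hy]
      | tmul h v =>
        change TensorProduct.rightComm k H H V (Coalgebra.comul (R := k) h ⊗ₜ L x v) =
          LinearMap.rTensor H _ (TensorProduct.rightComm k H H V
            (Coalgebra.comul (R := k) h ⊗ₜ v))
        generalize Coalgebra.comul (R := k) h = t
        induction t using TensorProduct.induction_on with
        | zero => simp
        | tmul x y => simp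
        | add x y hx hy => simp only [map_add, TensorProduct.add_tmul, hx, hy]
    · induction t using TensorProduct.induction_on with
      | zero => simp
      | add x y hx hy => simp only [map_add, hx, hy]
      | tmul h v =>
      symm
      refine (conv_transport (P := cU k H) (Q := cV k H)
        (LinearMap.applyₗ (freeCoact k H V (h ⊗ₜ[k] v)))
        ((TensorProduct.rightComm k H H V).toLinearMap ∘ₗ (TensorProduct.mk k _ V).flip v ∘ₗ
          LinearMap.mulRight k (Coalgebra.comul (R := k) h))
        (fun a b => ?_) x).trans ?_
      · change LinearMap.rTensor H _ (LinearMap.lTensor _ _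
            (TensorProduct.rightComm k H H V (Coalgebra.comul (R := k) h ⊗ₜ v))) =
          TensorProduct.rightComm k H H V ((((a ⊗ₜ[k] 1) * (1 ⊗ₜ[k] b)) *
            Coalgebra.comul (R := k) h) ⊗ₜ v)
        generalize Coalgebra.comul (R := k) h = t
        induction t using TensorProduct.induction_on with
        | zero => simp
        | tmul x y => simp
        | add x y hx hy => simp only [map_add, mul_add, TensorProduct.add_tmul, hx, hy]
      · rw [cU_mul_cV]
        change TensorProduct.rightComm k H H V ((Coalgebra.comul (R := k) x *
            Coalgebra.comul (R := k) h) ⊗ₜ v) =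
          TensorProduct.rightComm k H H V (Coalgebra.comul (R := k) (x * h) ⊗ₜ v)
        rw [Bialgebra.comul_mul]
  exact this x t

end Structure

end Equivariance
/-! ### Anti-Yetter-Drinfeld modules and contramodules -/

section AYD

/-- A left-right anti-Yetter-Drinfeld module over the Hopf algebra `H`: a left `H`-module and right
`H`-comodule with `(hm)₀ ⊗ (hm)₁ = h² m₀ ⊗ h³ m₁ S(h¹)`. -/
structure AYDMod (k H : Type u) [Field k] [Ring H] [HopfAlgebra k H] extends Comod k H where
  [moduleH : Module H carrier]
  [tower : IsScalarTower k H carrier]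
  ayd : ∀ (h : H) (m : carrier),
    coact (h • m) = comodAct (Algebra.lsmul k k carrier) h (coact m)

/-- A left-right anti-Yetter-Drinfeld contramodule over the Hopf algebra `H`: a left `H`-module and
right `H`-contramodule with `h α(f) = α(h² f(S(h³) - h¹))`. -/
structure AYDContra (k H : Type u) [Field k] [Ring H] [HopfAlgebra k H] extends Contra k H where
  [moduleH : Module H carrier]
  [tower : IsScalarTower k H carrier]
  ayd : ∀ (h : H) (f : H →ₗ[k] carrier),
    h • contr f = contr (contraAct (Algebra.lsmul k k carrier) h f)

attribute [instance] AYDMod.moduleH AYDMod.tower AYDContra.moduleH AYDContra.tower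

variable {k H : Type u} [Field k] [Ring H] [HopfAlgebra k H]

namespace AYDMod

/-- Morphisms: `H`-linear comodule morphisms. -/
@[ext]
structure Hom (M N : AYDMod k H) extends Comod.Hom M.toComod N.toComod where
  map_smul : ∀ (h : H) (m : M.carrier), toLin (h • m) = h • toLin m

instance : Category (AYDMod k H) where
  Hom M N := Hom M N
  id M := ⟨𝟙 M.toComod, fun _ _ => rfl⟩
  comp {X Y Z} f g :=
    ⟨(show X.toComod ⟶ Y.toComod from f.toHom) ≫ (show Y.toComod ⟶ Z.toComod from g.toHom),
      fun h m => by
        change g.toLin (f.toLin (h • m)) = h • g.toLin (f.toLin m)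
        rw [f.map_smul, g.map_smul]⟩

/-- Stability: `m₁ m₀ = m` for all `m`. -/
def IsStable : ObjectProperty (AYDMod k H) := fun M =>
  ∀ m : M.carrier,
    TensorProduct.lift (Algebra.lsmul k k M.carrier).toLinearMap.flip (M.coact m) = m

end AYDMod

namespace AYDContra

/-- Morphisms: `H`-linear contramodule morphisms. -/
@[ext]
structure Hom (M N : AYDContra k H) extends Contra.Hom M.toContra N.toContra where
  map_smul : ∀ (h : H) (m : M.carrier), toLin (h • m) = h • toLin m

instance : Category (AYDContra k H) where
  Hom M N := Hom M N
  id M := ⟨𝟙 M.toContra, fun _ _ => rfl⟩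
  comp {X Y Z} f g :=
    ⟨(show X.toContra ⟶ Y.toContra from f.toHom) ≫ (show Y.toContra ⟶ Z.toContra from g.toHom),
      fun h m => by
        change g.toLin (f.toLin (h • m)) = h • g.toLin (f.toLin m)
        rw [f.map_smul, g.map_smul]⟩

/-- Stability: `α(h ↦ h n) = n` for all `n`. -/
def IsStable : ObjectProperty (AYDContra k H) := fun N =>
  ∀ n : N.carrier, N.contr ((Algebra.lsmul k k N.carrier).toLinearMap.flip n) = n

end AYDContra

/-! #### The functor `M ↦ M̂` on anti-Yetter-Drinfeld modules -/

theorem contraAct_mem (M : AYDMod k H) (x : H) (φ : H →ₗ[k] M.carrier) (hφ : φ ∈ M.homSub) :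
    contraAct (Algebra.lsmul k k M.carrier) x φ ∈ M.homSub := by
  have h1 := contraAct_natural (T := M.coact) (L := Algebra.lsmul k k M.carrier)
    (L' := comodAct (Algebra.lsmul k k M.carrier)) M.ayd x φ
  change _ = _
  change _ = _ at hφ
  rw [h1, hφ]
  exact (homCoact_contraAct (Algebra.lsmul k k M.carrier) x φ).symm

/-- The action `h · φ = h² φ(S(h³) - h¹)` on `Hom(H, M)^H`. -/
noncomputable def hatAct (M : AYDMod k H) : H →ₐ[k] Module.End k M.homSub :=
  AlgHom.ofLinearMap
    { toFun := fun x => (contraAct (Algebra.lsmul k k M.carrier) x).restrict (contraAct_mem M x)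
      map_add' := fun x y => by
        apply LinearMap.ext; intro φ; apply Subtype.ext
        change contraAct _ (x + y) φ.1 = _
        rw [map_add]; rfl
      map_smul' := fun c x => by
        apply LinearMap.ext; intro φ; apply Subtype.ext
        change contraAct _ (c • x) φ.1 = _
        rw [map_smul]; rfl }
    (by
      apply LinearMap.ext; intro φ; apply Subtype.ext
      change contraAct _ 1 φ.1 = _
      rw [map_one]; rfl)
    (fun x y => by
      apply LinearMap.ext; intro φ; apply Subtype.ext
      change contraAct _ (x * y) φ.1 = _
      rw [map_mul]; rfl)

/-- The `H`-module structure given by `hatAct`. -/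
noncomputable abbrev hatModule (M : AYDMod k H) : Module H M.homSub :=
  Module.compHom M.homSub (hatAct M).toRingHom

theorem hatTower (M : AYDMod k H) :
    letI := hatModule M
    IsScalarTower k H M.homSub := by
  let _ := hatModule M
  refine ⟨fun c x φ => ?_⟩
  change hatAct M (c • x) φ = c • hatAct M x φ
  rw [map_smul]; rfl

/-- `Hom(H, M)^H` as an anti-Yetter-Drinfeld contramodule. -/
noncomputable def hatHObj (M : AYDMod k H) : AYDContra k H where
  toContra := hatObj M.toComod
  moduleH := hatModule M
  tower := hatTower M
  ayd := by
    intro x θ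
    let _ := hatModule M
    have _ := hatTower M
    apply Subtype.ext
    have h1 := contraAct_natural (T := M.homSub.subtype) (L := Algebra.lsmul k k M.homSub)
      (L' := contraAct (Algebra.lsmul k k M.carrier)) (fun _ _ => rfl) x θ
    change contraAct (Algebra.lsmul k k M.carrier) x
        (diagEval k H M.carrier (M.homSub.subtype ∘ₗ θ)) =
      diagEval k H M.carrier (M.homSub.subtype ∘ₗ contraAct (Algebra.lsmul k k M.homSub) x θ)
    rw [h1, diagEval_contraAct]

/-- The functor `M ↦ M̂` from anti-Yetter-Drinfeld modules to contramodules. -/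
noncomputable def hatH (k H : Type u) [Field k] [Ring H] [HopfAlgebra k H] :
    AYDMod k H ⥤ AYDContra k H where
  obj := hatHObj
  map {M N} f := ⟨(hat k H).map (show M.toComod ⟶ N.toComod from f.toHom), fun x φ => by
    apply Subtype.ext
    exact contraAct_natural (T := f.toLin) (L := Algebra.lsmul k k M.carrier)
      (L' := Algebra.lsmul k k N.carrier) f.map_smul x φ.1⟩
  map_id _ := rfl
  map_comp _ _ := rfl

/-! #### The functor `N ↦ N'` on anti-Yetter-Drinfeld contramodules -/

theorem freeAct_relSub (N : AYDContra k H) (x : H) :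
    N.relSub ≤ N.relSub.comap (freeAct (Algebra.lsmul k k N.carrier) x) := by
  rintro _ ⟨t, rfl⟩
  refine ⟨freeAct (contraAct (Algebra.lsmul k k N.carrier)) x t, ?_⟩
  rw [LinearMap.sub_apply, LinearMap.sub_apply, map_sub, spread_freeAct,
    freeAct_natural (T := N.contr) (L' := Algebra.lsmul k k N.carrier)
      (fun h f => (N.ayd h f).symm)]

/-- The action `x · (h ⊗ n) = x³ h S(x¹) ⊗ x² n` on `H ⊙_H N`. -/
noncomputable def odotAct (N : AYDContra k H) : H →ₐ[k] Module.End k N.odot :=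
  AlgHom.ofLinearMap
    { toFun := fun x => N.relSub.mapQ N.relSub (freeAct (Algebra.lsmul k k N.carrier) x)
        (freeAct_relSub N x)
      map_add' := fun x y => by
        apply Submodule.linearMap_qext
        apply LinearMap.ext; intro t
        change N.relSub.mkQ (freeAct _ (x + y) t) = _
        rw [map_add]; rfl
      map_smul' := fun c x => by
        apply Submodule.linearMap_qext
        apply LinearMap.ext; intro t
        change N.relSub.mkQ (freeAct _ (c • x) t) = _
        rw [map_smul]; rfl }
    (by
      apply Submodule.linearMap_qext
      apply LinearMap.ext; intro t
      change N.relSub.mkQ (freeAct _ 1 t) = _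
      rw [map_one]; rfl)
    (fun x y => by
      apply Submodule.linearMap_qext
      apply LinearMap.ext; intro t
      change N.relSub.mkQ (freeAct _ (x * y) t) = _
      rw [map_mul]; rfl)

/-- The `H`-module structure given by `odotAct`. -/
noncomputable abbrev odotModule (N : AYDContra k H) : Module H N.odot :=
  Module.compHom N.odot (odotAct N).toRingHom

theorem odotTower (N : AYDContra k H) :
    letI := odotModule N
    IsScalarTower k H N.odot := by
  let _ := odotModule N
  refine ⟨fun c x φ => ?_⟩
  change odotAct N (c • x) φ = c • odotAct N x φ
  rw [map_smul]; rfl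

/-- `H ⊙_H N` as an anti-Yetter-Drinfeld module. -/
noncomputable def primeHObj (N : AYDContra k H) : AYDMod k H where
  toComod := primeObj N.toContra
  moduleH := odotModule N
  tower := odotTower N
  ayd := by
    intro x m
    let _ := odotModule N
    have _ := odotTower N
    obtain ⟨t, rfl⟩ := N.relSub.mkQ_surjective m
    change odotCoact N.toContra (N.relSub.mkQ (freeAct (Algebra.lsmul k k N.carrier) x t)) =
      comodAct (Algebra.lsmul k k N.odot) x (odotCoact N.toContra (N.relSub.mkQ t))
    rw [odotCoact_mk, odotCoact_mk, freeCoact_freeAct]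
    exact comodAct_natural (T := N.relSub.mkQ) (L' := Algebra.lsmul k k N.odot)
      (fun _ _ => rfl) x _

/-- The functor `N ↦ N'` from anti-Yetter-Drinfeld contramodules to modules. -/
noncomputable def primeH (k H : Type u) [Field k] [Ring H] [HopfAlgebra k H] :
    AYDContra k H ⥤ AYDMod k H where
  obj := primeHObj
  map {M N} f := ⟨(prime k H).map (show M.toContra ⟶ N.toContra from f.toHom), fun x m => by
    obtain ⟨t, rfl⟩ := M.relSub.mkQ_surjective m
    exact congrArg N.relSub.mkQ (freeAct_natural (T := f.toLin)
      (L := Algebra.lsmul k k M.carrier) (L' := Algebra.lsmul k k N.carrier) f.map_smul x t)⟩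
  map_id N := by
    apply AYDMod.Hom.ext
    exact congrArg Comod.Hom.toLin ((prime k H).map_id N.toContra)
  map_comp {X Y Z} f g := by
    apply AYDMod.Hom.ext
    exact congrArg Comod.Hom.toLin ((prime k H).map_comp
      (show X.toContra ⟶ Y.toContra from f.toHom) (show Y.toContra ⟶ Z.toContra from g.toHom))

/-! #### Preservation of stability -/

open WithConv

theorem conv_anti {A B : Type u} [Semiring A] [Algebra k A] [Semiring B] [Algebra k B]
    (J : A →ₗ[k] B) (hJ : ∀ a b, J (a * b) = J b * J a) (F G : WithConv (H →ₗ[k] A))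
    (h : ∀ a b, Commute (F.ofConv a) (G.ofConv b)) :
    toConv (J ∘ₗ (F * G).ofConv) = toConv (J ∘ₗ F.ofConv) * toConv (J ∘ₗ G.ofConv) := by
  apply WithConv.ext
  apply LinearMap.ext
  intro x
  exact conv_transport (F := F) (G := G) (P := toConv (J ∘ₗ F.ofConv))
    (Q := toConv (J ∘ₗ G.ofConv)) J LinearMap.id (fun a b => by rw [(h a b).eq]; exact hJ _ _) x

/-- `toConv` of a linear map into `A`, regarded as valued in the opposite algebra. -/
noncomputable def cOp {A : Type u} [Semiring A] [Algebra k A] (F : H →ₗ[k] A) :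
    WithConv (H →ₗ[k] Aᵐᵒᵖ) :=
  toConv ((MulOpposite.opLinearEquiv k).toLinearMap ∘ₗ F)

theorem cOp_convAlgHom {A : Type u} [Semiring A] [Algebra k A] (F G : H →ₐ[k] A)
    (h : ∀ a b, Commute (F a) (G b)) :
    cOp (convAlgHom F G h).toLinearMap = cOp F.toLinearMap * cOp G.toLinearMap := by
  have := conv_anti (MulOpposite.opLinearEquiv k : A ≃ₗ[k] Aᵐᵒᵖ).toLinearMap
    (fun _ _ => rfl) (toConv F.toLinearMap) (toConv G.toLinearMap) h
  rw [← toConv_convAlgHom F G h] at this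
  exact this

section

variable {V : Type u} [AddCommGroup V] [Module k V] (L : H →ₐ[k] Module.End k V)

/-- `x ↦ (φ ↦ φ(x -))` -/
noncomputable def preLeft (k H V : Type u) [Field k] [Ring H] [HopfAlgebra k H]
    [AddCommGroup V] [Module k V] : H →ₗ[k] Module.End k (H →ₗ[k] V) :=
  LinearMap.mk₂ k (fun (x : H) (φ : H →ₗ[k] V) => φ ∘ₗ LinearMap.mulLeft k x)
    (by intros; ext; simp [add_mul]) (by intros; ext; simp)
    (by intros; ext; simp) (by intros; ext; simp)

theorem cOp_preLeftS_preLeft :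
    cOp (preLeftS V).toLinearMap * cOp (preLeft k H V) = 1 := by
  apply WithConv.ext
  apply LinearMap.ext
  intro x
  refine (conv_transport (P := toConv (HopfAlgebra.antipode k (A := H)))
    (Q := toConv (LinearMap.id (R := k) (M := H))) LinearMap.id
    ((MulOpposite.opLinearEquiv k).toLinearMap ∘ₗ preLeft k H V) (fun a b => ?_) x).trans ?_
  · change MulOpposite.op (_ * _) = MulOpposite.op _
    congr 1
    ext φ h
    change φ (HopfAlgebra.antipode k a * (b * h)) = φ ((HopfAlgebra.antipode k a * b) * h)
    rw [mul_assoc]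
  · rw [LinearMap.antipode_mul_id]
    change MulOpposite.op _ = MulOpposite.op _
    congr 1
    ext φ h
    change φ (algebraMap k H (Coalgebra.counit (R := k) x) * h) =
      (Coalgebra.counit (R := k) x) • φ h
    rw [← Algebra.smul_def, map_smul]

theorem contraAct_diag (x : H) (φ : H →ₗ[k] V) :
    TensorProduct.lift ((contraAct L).toLinearMap.flip φ) (Coalgebra.comul (R := k) x) =
      TensorProduct.lift L.toLinearMap.flip (φ.rTensor H (Coalgebra.comul (R := k) x)) := by
  have key : cOp (contraAct L).toLinearMap * cOp (preLeft k H V) =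
      cOp (preRight V).toLinearMap * cOp (postAct L).toLinearMap := by
    rw [contraAct, cOp_convAlgHom, cOp_convAlgHom, mul_assoc, mul_assoc, cOp_preLeftS_preLeft,
      mul_one]
  have h := congrArg (fun F => (MulOpposite.unop (F.ofConv x)) φ 1) key
  refine Eq.trans ?_ (h.trans ?_)
  · change _ = (LinearMap.applyₗ 1 ∘ₗ LinearMap.applyₗ φ ∘ₗ
      (MulOpposite.opLinearEquiv k).symm.toLinearMap)
      (LinearMap.mul' k _ (TensorProduct.map _ _ (Coalgebra.comul (R := k) x)))
    generalize Coalgebra.comul (R := k) x = t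
    induction t using TensorProduct.induction_on with
    | zero => simp
    | tmul a b =>
      change contraAct L a φ b = contraAct L a φ (b * 1)
      rw [mul_one]
    | add x y hx hy => simp only [map_add, hx, hy]
  · change (LinearMap.applyₗ 1 ∘ₗ LinearMap.applyₗ φ ∘ₗ
      (MulOpposite.opLinearEquiv k).symm.toLinearMap)
      (LinearMap.mul' k _ (TensorProduct.map _ _ (Coalgebra.comul (R := k) x))) = _
    generalize Coalgebra.comul (R := k) x = t
    induction t using TensorProduct.induction_on with
    | zero => simp
    | tmul a b =>
      change L b (φ (1 * a)) = L b (φ a)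
      rw [one_mul]
    | add x y hx hy => simp only [map_add, hx, hy]

/-- `x ↦ (h ⊗ v ↦ h x ⊗ v)` -/
noncomputable def freeRight (k H V : Type u) [Field k] [Ring H] [HopfAlgebra k H]
    [AddCommGroup V] [Module k V] : H →ₗ[k] Module.End k (H ⊗[k] V) :=
  LinearMap.rTensorHom V ∘ₗ (LinearMap.mul k H).flip

theorem cOp_freeRight_freeRightS :
    cOp (freeRight k H V) * cOp (freeRightS V).toLinearMap = 1 := by
  apply WithConv.ext
  apply LinearMap.ext
  intro x
  refine (conv_transport (P := toConv (LinearMap.id (R := k) (M := H)))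
    (Q := toConv (HopfAlgebra.antipode k (A := H))) LinearMap.id
    ((MulOpposite.opLinearEquiv k).toLinearMap ∘ₗ freeRight k H V) (fun a b => ?_) x).trans ?_
  · change MulOpposite.op (_ * _) = MulOpposite.op _
    congr 1
    refine TensorProduct.ext' fun h v => ?_
    change ((h * a) * HopfAlgebra.antipode k b) ⊗ₜ[k] v = (h * (a * HopfAlgebra.antipode k b)) ⊗ₜ v
    rw [mul_assoc]
  · rw [LinearMap.id_mul_antipode]
    change MulOpposite.op _ = MulOpposite.op _
    congr 1
    refine TensorProduct.ext' fun h v => ?_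
    change (h * algebraMap k H (Coalgebra.counit (R := k) x)) ⊗ₜ[k] v =
      (Coalgebra.counit (R := k) x) • (h ⊗ₜ[k] v)
    rw [← Algebra.commutes, ← Algebra.smul_def, TensorProduct.smul_tmul']

theorem freeAct_diag (x : H) (v : V) :
    TensorProduct.lift (freeAct L).toLinearMap.flip (freeCoact k H V (x ⊗ₜ v)) =
      spread k H V (x ⊗ₜ L.toLinearMap.flip v) := by
  have key : cOp (freeRight k H V) * cOp (freeAct L).toLinearMap =
      cOp (freeMid L).toLinearMap * cOp (freeLeft V).toLinearMap := by
    rw [freeAct, cOp_convAlgHom, cOp_convAlgHom, ← mul_assoc, cOp_freeRight_freeRightS, one_mul]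
  have h := congrArg (fun F => (MulOpposite.unop (F.ofConv x)) (1 ⊗ₜ[k] v)) key
  refine Eq.trans ?_ (h.trans ?_)
  · change TensorProduct.lift (freeAct L).toLinearMap.flip
        (TensorProduct.rightComm k H H V (Coalgebra.comul (R := k) x ⊗ₜ v)) =
      (LinearMap.applyₗ (1 ⊗ₜ[k] v) ∘ₗ (MulOpposite.opLinearEquiv k).symm.toLinearMap)
      (LinearMap.mul' k _ (TensorProduct.map _ _ (Coalgebra.comul (R := k) x)))
    generalize Coalgebra.comul (R := k) x = t
    induction t using TensorProduct.induction_on with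
    | zero => simp
    | tmul a b =>
      change freeAct L b (a ⊗ₜ[k] v) = freeAct L b ((1 * a) ⊗ₜ[k] v)
      rw [one_mul]
    | add x y hx hy => simp only [map_add, TensorProduct.add_tmul, hx, hy]
  · change (LinearMap.applyₗ (1 ⊗ₜ[k] v) ∘ₗ (MulOpposite.opLinearEquiv k).symm.toLinearMap)
        (LinearMap.mul' k _ (TensorProduct.map _ _ (Coalgebra.comul (R := k) x))) =
      TensorProduct.comm k V H ((L.toLinearMap.flip v).rTensor H (Coalgebra.comul (R := k) x))
    generalize Coalgebra.comul (R := k) x = t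
    induction t using TensorProduct.induction_on with
    | zero => simp
    | tmul a b =>
      change (b * 1) ⊗ₜ[k] L a v = b ⊗ₜ[k] L a v
      rw [mul_one]
    | add x y hx hy => simp only [map_add, hx, hy]

end

theorem hatH_isStable (M : AYDMod k H) (hM : M.IsStable) : ((hatH k H).obj M).IsStable := by
  intro φ
  apply Subtype.ext
  apply LinearMap.ext
  intro x
  have h1 := contraAct_diag (Algebra.lsmul k k M.carrier) x φ.1
  have h2 : M.coact ∘ₗ φ.1 = φ.1.rTensor H ∘ₗ Coalgebra.comul := φ.2
  have h3 := LinearMap.congr_fun h2 x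
  simp only [LinearMap.comp_apply] at h3
  rw [← h3] at h1
  exact h1.trans (hM _)

theorem odot_stable (N : AYDContra k H) (hN : N.IsStable) (m : N.odot) :
    TensorProduct.lift (odotAct N).toLinearMap.flip (odotCoact N.toContra m) = m := by
  obtain ⟨t, rfl⟩ := N.relSub.mkQ_surjective m
  induction t using TensorProduct.induction_on with
  | zero => rw [map_zero, map_zero, map_zero]
  | add x y hx hy => rw [map_add, map_add, map_add, hx, hy]
  | tmul x v =>
    have h1 := congrArg N.relSub.mkQ (freeAct_diag (Algebra.lsmul k k N.carrier) x v)
    have h2 : N.relSub.mkQ (spread k H N.carrier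
        (x ⊗ₜ (Algebra.lsmul k k N.carrier).toLinearMap.flip v)) = N.relSub.mkQ (x ⊗ₜ v) := by
      have h3 : x ⊗ₜ v - spread k H N.carrier
          (x ⊗ₜ (Algebra.lsmul k k N.carrier).toLinearMap.flip v) ∈ N.relSub := by
        refine ⟨x ⊗ₜ (Algebra.lsmul k k N.carrier).toLinearMap.flip v, ?_⟩
        rw [LinearMap.sub_apply, LinearMap.lTensor_tmul, hN v]
      exact ((Submodule.Quotient.eq _).2 h3).symm
    refine Eq.trans ?_ (h1.trans h2)
    rw [odotCoact_mk]
    generalize freeCoact k H N.carrier (x ⊗ₜ v) = t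
    induction t using TensorProduct.induction_on with
    | zero => rw [map_zero, map_zero, map_zero, map_zero]
    | tmul a b => rfl
    | add x y hx hy => rw [map_add, map_add, map_add, map_add, hx, hy]

theorem primeH_isStable (N : AYDContra k H) (hN : N.IsStable) :
    ((primeH k H).obj N).IsStable :=
  fun m => odot_stable N hN m

/-- The functor `M ↦ M̂` from stable anti-Yetter-Drinfeld modules to contramodules. -/
noncomputable def hatSH (k H : Type u) [Field k] [Ring H] [HopfAlgebra k H] :
    (AYDMod.IsStable (k := k) (H := H)).FullSubcategory ⥤
      (AYDContra.IsStable (k := k) (H := H)).FullSubcategory :=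
  ObjectProperty.lift _ (ObjectProperty.ι _ ⋙ hatH k H) fun M => hatH_isStable M.1 M.2

/-- The functor `N ↦ N'` from stable anti-Yetter-Drinfeld contramodules to modules. -/
noncomputable def primeSH (k H : Type u) [Field k] [Ring H] [HopfAlgebra k H] :
    (AYDContra.IsStable (k := k) (H := H)).FullSubcategory ⥤
      (AYDMod.IsStable (k := k) (H := H)).FullSubcategory :=
  ObjectProperty.lift _ (ObjectProperty.ι _ ⋙ primeH k H) fun N => primeH_isStable N.1 N.2

end AYD

/-! The slices `v ⊗ c ↦ χ(c) v` separate the points of `V ⊗ C` (`slice_ext`), so a comodule `M` can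
be handled through the operators `m ↦ χ(m₁) m₀` of functionals `χ`. Coassociativity, being a
morphism and lying in `Hom(C, M)^C` become statements about modules over the convolution algebra
`C^*`. Contramodules have similar operators `n ↦ α(c ↦ χ(c) n)`, although these need not determine
`α`.

Let `pᵢ` be the projection of `H` to `C i`. The functionals `eᵢ = ε ∘ pᵢ` (`sumIdem`) are central
orthogonal idempotents of `H^*`. An element of `V ⊗ H` meets only finitely many summands
(`exists_sum_slice_idem`), so a comodule is the direct sum of its blocks `eᵢ M`. For a contramodule
`N` the contraaction plays the role of an infinite sum: contraassociativity forces `n = 0` when all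
`eᵢ n` vanish (`eq_zero_of_op_idem`), and `α` glues an arbitrary family of block elements
(`exists_op_idem`). So `N` is the product of its blocks. Over the finite dimensional `C i`,
contramodules and comodules agree; hence `⨁` and `∏` are equivalences.

The link between the two sides is the case of one simple coalgebra `C`, where `Hom(C, M)^C` has to
be identified with `M`, compatibly with the contraactions. The trace of the regular action of `C^*`
on `C` is given by an element `e` of `C`, symmetric because `tr(ab) = tr(ba)`. The map `C^* → C`, `χ
↦ χ(e²) e¹`, is `C^*`-linear; by symmetry its image is a subcoalgebra, and it is nonzero because
`ε(e) = dim C` does not vanish in characteristic zero. Simplicity makes it bijective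
(`traceMap_bijective`), so `C` is free on `e` over `C^*` and `φ ↦ φ(e)` is the required
identification. Applied in each block it gives `hatSumIso`; the symmetry of `e` is used again to
match the contraactions (`hatSumMap_contr`).

Consequently `hat` is an equivalence, being an equivalence up to composition with `⨁`, and so is its
left adjoint `prime`. The unit and counit are explicit over any coalgebra. Over `H` they are also
linear for the Hopf actions, by cancellations `x¹ S(x²) = ε(x) = S(x¹) x²` (`contraAct_freeAct_mk`,
`eval_freeAct_contraAct`). The lifted unit and counit are therefore bijective as soon as the
underlying ones are, which gives the anti-Yetter-Drinfeld equivalences; the stable objects form full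
subcategories, and everything restricts to them. -/

/-! ### Slices and the action of the dual on a comodule -/

section Slice

variable {k : Type u} [Field k]

/-- The slice map `v ⊗ c ↦ χ(c) v`. -/
noncomputable def slice {C : Type u} [AddCommGroup C] [Module k C] (χ : Module.Dual k C)
    (V : Type u) [AddCommGroup V] [Module k V] : V ⊗[k] C →ₗ[k] V :=
  (TensorProduct.rid k V).toLinearMap ∘ₗ χ.lTensor V

variable {C D V W : Type u} [AddCommGroup C] [Module k C] [AddCommGroup D] [Module k D]
  [AddCommGroup V] [Module k V] [AddCommGroup W] [Module k W]

@[simp]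
theorem slice_tmul (χ : Module.Dual k C) (v : V) (c : C) : slice χ V (v ⊗ₜ c) = χ c • v := by
  simp [slice]

theorem slice_add (χ ψ : Module.Dual k C) (t : V ⊗[k] C) :
    slice (χ + ψ) V t = slice χ V t + slice ψ V t := by
  simp only [slice, LinearMap.lTensor_add, LinearMap.comp_apply, LinearMap.add_apply, map_add]

theorem slice_smul (a : k) (χ : Module.Dual k C) (t : V ⊗[k] C) :
    slice (a • χ) V t = a • slice χ V t := by
  simp only [slice, LinearMap.lTensor_smul, LinearMap.comp_apply, LinearMap.smul_apply, map_smul]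

theorem slice_map (χ : Module.Dual k D) (f : V →ₗ[k] W) (g : C →ₗ[k] D) (t : V ⊗[k] C) :
    slice χ W (TensorProduct.map f g t) = f (slice (χ ∘ₗ g) V t) := by
  induction t using TensorProduct.induction_on with
  | zero => simp
  | tmul x y => simp
  | add x y hx hy => simp only [map_add, hx, hy]

theorem slice_rTensor (χ : Module.Dual k C) (f : V →ₗ[k] W) (t : V ⊗[k] C) :
    slice χ W (f.rTensor C t) = f (slice χ V t) :=
  slice_map χ f LinearMap.id t

/-- A basis of `C` identifies `V ⊗ C` with finitely supported families in `V`, and the entries of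
such a family are slices by coordinate functionals. No finiteness of `C` is needed. -/
theorem slice_ext {t t' : V ⊗[k] C} (h : ∀ χ : Module.Dual k C, slice χ V t = slice χ V t') :
    t = t' := by
  classical
  let b := Module.Free.chooseBasis k C
  apply (TensorProduct.equivFinsuppOfBasisRight b).injective
  ext i
  have key : ∀ s : V ⊗[k] C,
      TensorProduct.equivFinsuppOfBasisRight b s i = slice (b.coord i) V s := by
    intro s
    induction s using TensorProduct.induction_on with
    | zero => simp
    | tmul x y => simp
    | add x y hx hy => simp only [map_add, Finsupp.add_apply, hx, hy]
  rw [key, key, h]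

theorem slice_assoc (ψ : Module.Dual k C) (χ : Module.Dual k D) (t : (V ⊗[k] C) ⊗[k] D) :
    slice (TensorProduct.dualDistrib k C D (ψ ⊗ₜ χ)) V (TensorProduct.assoc k V C D t) =
      slice ψ V (slice χ (V ⊗[k] C) t) := by
  induction t using TensorProduct.induction_on with
  | zero => simp
  | add x y hx hy => simp only [map_add, hx, hy]
  | tmul s d =>
    induction s using TensorProduct.induction_on with
    | zero => simp
    | tmul v c => simp [smul_smul, mul_comm]
    | add x y hx hy => simp only [map_add, TensorProduct.add_tmul, hx, hy]

/-- Product functionals suffice, by slicing one tensor leg at a time. This reduces coassociativity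
to multiplicativity of the operators of functionals. -/
theorem slice_slice_ext {t t' : V ⊗[k] (C ⊗[k] D)}
    (h : ∀ (ψ : Module.Dual k C) (χ : Module.Dual k D),
      slice (TensorProduct.dualDistrib k C D (ψ ⊗ₜ χ)) V t =
        slice (TensorProduct.dualDistrib k C D (ψ ⊗ₜ χ)) V t') : t = t' := by
  obtain ⟨s, rfl⟩ := (TensorProduct.assoc k V C D).surjective t
  obtain ⟨s', rfl⟩ := (TensorProduct.assoc k V C D).surjective t'
  congr 1
  refine slice_ext fun χ => slice_ext fun ψ => ?_
  rw [← slice_assoc, ← slice_assoc, h]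

theorem dual_slice (ψ : Module.Dual k C) (χ : Module.Dual k D) (t : C ⊗[k] D) :
    ψ (slice χ C t) = TensorProduct.dualDistrib k C D (ψ ⊗ₜ χ) t := by
  induction t using TensorProduct.induction_on with
  | zero => simp
  | tmul x y => simp [mul_comm]
  | add x y hx hy => simp only [map_add, hx, hy]

theorem dual_ext {c c' : C} (h : ∀ ψ : Module.Dual k C, ψ c = ψ c') : c = c' := by
  rw [← sub_eq_zero, ← Module.forall_dual_apply_eq_zero_iff k]
  intro ψ
  rw [map_sub, h, sub_self]

theorem dualDistrib_ext {t t' : C ⊗[k] D}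
    (h : ∀ (ψ : Module.Dual k C) (χ : Module.Dual k D),
      TensorProduct.dualDistrib k C D (ψ ⊗ₜ χ) t =
        TensorProduct.dualDistrib k C D (ψ ⊗ₜ χ) t') : t = t' :=
  slice_ext fun χ => dual_ext fun ψ => by rw [dual_slice, dual_slice, h]

/-- Linear maps out of `Hom(C, V)` agree if they agree on the maps `c ↦ χ(c) v`. -/
theorem finHom_ext [FiniteDimensional k C]
    {f g : (C →ₗ[k] V) →ₗ[k] W}
    (h : ∀ (χ : Module.Dual k C) (v : V), f (dualTensorHom k C V (χ ⊗ₜ v)) =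
      g (dualTensorHom k C V (χ ⊗ₜ v))) : f = g := by
  have h2 : f ∘ₗ (dualTensorHomEquiv k C V).toLinearMap =
      g ∘ₗ (dualTensorHomEquiv k C V).toLinearMap := TensorProduct.ext' h
  refine LinearMap.ext fun φ => ?_
  obtain ⟨t, rfl⟩ := (dualTensorHomEquiv k C V).surjective φ
  exact LinearMap.congr_fun h2 t

end Slice

/-! ### The convolution algebra of functionals acting on comodules -/

section Act

variable {k C : Type u} [Field k] [AddCommGroup C] [Module k C] [Coalgebra k C]

/-- The convolution product `c ↦ ψ(c¹) χ(c²)` of two functionals on a coalgebra. -/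
noncomputable def dualMul (ψ χ : Module.Dual k C) : Module.Dual k C :=
  TensorProduct.dualDistrib k C C (ψ ⊗ₜ χ) ∘ₗ Coalgebra.comul

theorem dualMul_apply (ψ χ : Module.Dual k C) (c : C) : dualMul ψ χ c =
    TensorProduct.dualDistrib k C C (ψ ⊗ₜ χ) (Coalgebra.comul (R := k) c) := rfl

theorem slice_counit_comul (c : C) :
    slice (Coalgebra.counit (R := k)) C (Coalgebra.comul (R := k) c) = c := by
  simp [slice]

theorem dualMul_counit (ψ : Module.Dual k C) : dualMul ψ Coalgebra.counit = ψ := by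
  ext c
  rw [dualMul_apply, ← dual_slice, slice_counit_comul]

namespace Comod

/-- The operator `m ↦ χ(m₁) m₀` of a functional on a comodule. -/
noncomputable def act (M : Comod k C) (χ : Module.Dual k C) : Module.End k M.carrier :=
  slice χ M.carrier ∘ₗ M.coact

theorem act_apply (M : Comod k C) (χ : Module.Dual k C) (m : M.carrier) :
    M.act χ m = slice χ M.carrier (M.coact m) := rfl

/-- This is coassociativity sliced by `ψ ⊗ χ`: the functional applied first meets the outer tensor
leg, so right comodules become left modules over the convolution algebra. -/
theorem act_act (M : Comod k C) (ψ χ : Module.Dual k C) (m : M.carrier) :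
    M.act ψ (M.act χ m) = M.act (dualMul ψ χ) m := by
  have h := LinearMap.congr_fun M.coassoc m
  simp only [LinearMap.comp_apply] at h
  have h2 := slice_map (TensorProduct.dualDistrib k C C (ψ ⊗ₜ χ)) LinearMap.id
    (Coalgebra.comul (R := k)) (M.coact m)
  refine Eq.trans ?_ h2
  change _ = slice _ _ ((Coalgebra.comul (R := k)).lTensor M.carrier (M.coact m))
  rw [← h, LinearEquiv.coe_coe, slice_assoc, slice_rTensor]
  rfl

theorem act_counit (M : Comod k C) (m : M.carrier) : M.act Coalgebra.counit m = m :=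
  LinearMap.congr_fun M.counit_coact m

/-- A coaction is a comodule structure as soon as the operators of functionals are multiplicative
and unital. -/
noncomputable def ofSlice (V : Type u) [AddCommGroup V] [Module k V] (ρ : V →ₗ[k] V ⊗[k] C)
    (hmul : ∀ (ψ χ : Module.Dual k C) (v : V),
      slice ψ V (ρ (slice χ V (ρ v))) = slice (dualMul ψ χ) V (ρ v))
    (hone : ∀ v : V, slice Coalgebra.counit V (ρ v) = v) : Comod k C where
  carrier := V
  coact := ρ
  coassoc := by
    refine LinearMap.ext fun v => slice_slice_ext fun ψ χ => ?_
    simp only [LinearMap.comp_apply, LinearEquiv.coe_coe]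
    rw [slice_assoc, slice_rTensor, hmul]
    exact (slice_map (TensorProduct.dualDistrib k C C (ψ ⊗ₜ χ)) LinearMap.id
      (Coalgebra.comul (R := k)) (ρ v)).symm
  counit_coact := LinearMap.ext hone

/-- A linear map commuting with the operators of functionals is a comodule morphism. -/
theorem comm_of_act {M N : Comod k C} {f : M.carrier →ₗ[k] N.carrier}
    (h : ∀ χ m, f (M.act χ m) = N.act χ (f m)) : N.coact ∘ₗ f = f.rTensor C ∘ₗ M.coact := by
  refine LinearMap.ext fun m => slice_ext fun χ => ?_
  rw [LinearMap.comp_apply, LinearMap.comp_apply, slice_rTensor]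
  exact (h χ m).symm

theorem Hom.act {M N : Comod k C} (f : Comod.Hom M N) (χ : Module.Dual k C) (m : M.carrier) :
    f.toLin (M.act χ m) = N.act χ (f.toLin m) := by
  have h := LinearMap.congr_fun f.comm m
  simp only [LinearMap.comp_apply] at h
  rw [act_apply, act_apply, h, slice_rTensor]

variable (k C) in
/-- A coalgebra as a comodule over itself. -/
noncomputable abbrev regular : Comod k C where
  carrier := C
  coact := Coalgebra.comul
  coassoc := Coalgebra.coassoc
  counit_coact := by ext; simp

/-- The elements of `Hom(C, M)^C` are the comodule morphisms from the regular comodule, so they are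
the `C^*`-linear maps. In this form membership can be tested on the elements `traceMap k C χ`. -/
theorem mem_homSub_iff (M : Comod k C) (φ : C →ₗ[k] M.carrier) :
    φ ∈ M.homSub ↔ ∀ χ c, φ ((regular k C).act χ c) = M.act χ (φ c) :=
  ⟨fun h => Hom.act (M := regular k C) ⟨φ, h⟩, fun h => comm_of_act (M := regular k C) h⟩

theorem regular_act (χ : Module.Dual k C) (c : C) :
    (regular k C).act χ c = slice χ C (Coalgebra.comul (R := k) c) := rfl

theorem dual_regular_act (ψ χ : Module.Dual k C) (c : C) :
    ψ ((regular k C).act χ c) = dualMul ψ χ c := dual_slice ψ χ _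

/-- A bijective comodule morphism is an isomorphism. -/
theorem isIso_of_bijective {M N : Comod k C} (f : M ⟶ N)
    (h : Function.Bijective (Hom.toLin f)) : IsIso f := by
  let e := LinearEquiv.ofBijective _ h
  have he : ∀ χ n, e.symm (N.act χ n) = M.act χ (e.symm n) := by
    intro χ n
    obtain ⟨m, rfl⟩ := e.surjective n
    rw [e.symm_apply_apply, ← e.symm_apply_apply (M.act χ m)]
    exact congrArg e.symm (Hom.act f χ m).symm
  refine ⟨⟨⟨e.symm.toLinearMap, comm_of_act he⟩, ?_, ?_⟩⟩
  · exact hom_ext (LinearMap.ext e.symm_apply_apply)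
  · exact hom_ext (LinearMap.ext e.apply_symm_apply)

end Comod

/-- A bijective contramodule morphism is an isomorphism. -/
theorem Contra.isIso_of_bijective {M N : Contra k C} (f : M ⟶ N)
    (h : Function.Bijective (Hom.toLin f)) : IsIso f := by
  let e := LinearEquiv.ofBijective _ h
  refine ⟨⟨⟨e.symm.toLinearMap, fun g => ?_⟩, ?_, ?_⟩⟩
  · have h1 := Hom.comm f (e.symm.toLinearMap ∘ₗ g)
    have h2 : Hom.toLin f ∘ₗ e.symm.toLinearMap ∘ₗ g = g :=
      LinearMap.ext fun c => e.apply_symm_apply (g c)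
    rw [h2] at h1
    rw [← h1]
    exact e.symm_apply_apply _
  · exact hom_ext (LinearMap.ext e.symm_apply_apply)
  · exact hom_ext (LinearMap.ext e.apply_symm_apply)

/-- Contraassociativity for the rank one map `x ⊗ y ↦ ψ(x) χ(y) n`. This is the counterpart of
`Comod.act_act` for contramodules. -/
theorem Contra.contr_contr (N : Contra k C) (ψ χ : Module.Dual k C) (n : N.carrier) :
    N.contr (dualTensorHom k C N.carrier
      (ψ ⊗ₜ N.contr (dualTensorHom k C N.carrier (χ ⊗ₜ n)))) =
    N.contr (dualTensorHom k C N.carrier (dualMul ψ χ ⊗ₜ n)) := by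
  have h := N.contraassoc
    (dualTensorHom k (C ⊗[k] C) N.carrier (TensorProduct.dualDistrib k C C (ψ ⊗ₜ χ) ⊗ₜ n))
  refine Eq.trans (congrArg N.contr (LinearMap.ext fun c => ?_)) h
  rw [dualTensorHom_apply, LinearMap.comp_apply, ← map_smul]
  congr 1
  ext d
  simp [mul_smul]

end Act

/-! ### Finite dimensional coalgebras -/

section Finite

variable {k C : Type u} [Field k] [AddCommGroup C] [Module k C] [Coalgebra k C]
  [FiniteDimensional k C]

theorem Comod.finContr_act (M : Comod k C) (χ : Module.Dual k C) (m : M.carrier) :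
    M.finContr (dualTensorHom k C M.carrier (χ ⊗ₜ m)) = M.act χ m :=
  M.finContr_hom χ m

/-- For a finite dimensional coalgebra, linear maps compatible with the induced contraactions are
comodule morphisms. -/
theorem Comod.comm_of_finContr {M N : Comod k C} {f : M.carrier →ₗ[k] N.carrier}
    (h : ∀ g, f (M.finContr g) = N.finContr (f ∘ₗ g)) :
    N.coact ∘ₗ f = f.rTensor C ∘ₗ M.coact := by
  refine comm_of_act fun χ m => ?_
  rw [← M.finContr_act, h, ← N.finContr_act]
  congr 1
  ext c
  simp

/-! ### Contramodules over a finite dimensional coalgebra are comodules -/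

namespace Contra

/-- The coaction `v ↦ Σ α(bᵢ^* v) ⊗ bᵢ` of a finite dimensional coalgebra on a contramodule. -/
noncomputable def finCoact (N : Contra k C) : N.carrier →ₗ[k] N.carrier ⊗[k] C :=
  ∑ i, (TensorProduct.mk k N.carrier C).flip (Module.finBasis k C i) ∘ₗ N.contr ∘ₗ
    dualTensorHom k C N.carrier ∘ₗ TensorProduct.mk k _ _ ((Module.finBasis k C).coord i)

/-- Expanding `χ` in the dual basis used to define the coaction; in particular the coaction does not
depend on that basis. -/
theorem slice_finCoact (N : Contra k C) (χ : Module.Dual k C) (n : N.carrier) :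
    slice χ N.carrier (N.finCoact n) = N.contr (dualTensorHom k C N.carrier (χ ⊗ₜ n)) := by
  rw [finCoact, LinearMap.sum_apply, map_sum]
  conv_rhs => rw [← (Module.finBasis k C).sum_dual_apply_smul_coord χ, TensorProduct.sum_tmul,
    map_sum, map_sum]
  refine Finset.sum_congr rfl fun i _ => ?_
  simp [← TensorProduct.smul_tmul']

/-- A contramodule over a finite dimensional coalgebra, viewed as a comodule. -/
noncomputable def toComod (N : Contra k C) : Comod k C :=
  Comod.ofSlice N.carrier N.finCoact
    (fun ψ χ n => by rw [slice_finCoact, slice_finCoact, slice_finCoact, contr_contr])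
    (fun n => by
      rw [slice_finCoact]
      refine Eq.trans (congrArg N.contr ?_) (N.contr_counit n)
      ext c
      simp)

/-- For finite dimensional `C` the maps `c ↦ χ(c) n` span `Hom(C, N)`, so the contraaction is
recovered from the operators of functionals. This turns the blocks of a contramodule into comodules
for `prodContra_essSurj`. -/
theorem toComod_finContr (N : Contra k C) : N.toComod.finContr = N.contr :=
  finHom_ext fun χ n => (N.toComod.finContr_act χ n).trans (N.slice_finCoact χ n)

end Contra

/-! ### The symmetric element of a simple coalgebra in characteristic zero -/

variable (k C) in
/-- The element of `C` representing `χ ↦ tr(c ↦ χ(c²) c¹)`. -/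
noncomputable def traceElem : C :=
  (Module.evalEquiv k C).symm (LinearMap.trace k C ∘ₗ
    { toFun := fun χ => (Comod.regular k C).act χ
      map_add' := fun χ ψ => by
        refine LinearMap.ext fun c => ?_
        exact slice_add χ ψ _
      map_smul' := fun a χ => by
        refine LinearMap.ext fun c => ?_
        exact slice_smul a χ _ })

theorem apply_traceElem (χ : Module.Dual k C) :
    χ (traceElem k C) = LinearMap.trace k C ((Comod.regular k C).act χ) :=
  LinearMap.congr_fun ((Module.evalEquiv k C).apply_symm_apply _) χ

/-- The regular action is multiplicative and `tr(ab) = tr(ba)`. -/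
theorem dualMul_traceElem (ψ χ : Module.Dual k C) :
    dualMul ψ χ (traceElem k C) = dualMul χ ψ (traceElem k C) := by
  have h : ∀ ψ χ : Module.Dual k C, (Comod.regular k C).act (dualMul ψ χ) =
      (Comod.regular k C).act ψ * (Comod.regular k C).act χ :=
    fun ψ χ => LinearMap.ext fun c => ((Comod.regular k C).act_act ψ χ c).symm
  rw [apply_traceElem, apply_traceElem, h, h]
  exact LinearMap.trace_mul_comm k _ _

variable (k C) in
/-- The map `C^* → C`, `χ ↦ χ(e²) e¹`, for the element `e` above. -/
noncomputable def traceMap : Module.Dual k C →ₗ[k] C where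
  toFun χ := (Comod.regular k C).act χ (traceElem k C)
  map_add' χ ψ := slice_add χ ψ _
  map_smul' a χ := slice_smul a χ _

theorem traceMap_apply (χ : Module.Dual k C) :
    traceMap k C χ = (Comod.regular k C).act χ (traceElem k C) := rfl

theorem act_traceMap (ψ χ : Module.Dual k C) :
    (Comod.regular k C).act ψ (traceMap k C χ) = traceMap k C (dualMul ψ χ) :=
  (Comod.regular k C).act_act ψ χ _

/-- Both sides are values of the bilinear form `(ψ, χ) ↦ (ψ * χ)(e)` on `C^*`, which is symmetric
because `e` is a trace. -/
theorem dual_traceMap_symm (ψ χ : Module.Dual k C) :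
    ψ (traceMap k C χ) = χ (traceMap k C ψ) := by
  rw [traceMap_apply, traceMap_apply, Comod.dual_regular_act, Comod.dual_regular_act,
    dualMul_traceElem]

/-- Linearity over `C^*` puts the first leg of `Δ(d)` in the range for each `d` in the range, and
symmetry of the form does the same for the second leg. -/
theorem isSubcoalg_range_traceMap : IsSubcoalg (LinearMap.range (traceMap k C)) := by
  rintro _ ⟨ξ, rfl⟩
  set D := LinearMap.range (traceMap k C)
  -- `P` is a linear retraction onto the range `D`. The claim becomes that `P ⊗ P`, followed by the
  -- inclusion, fixes `Δ` of elements of `D`.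
  obtain ⟨P, hP⟩ := D.subtype.exists_leftInverse_of_injective D.ker_subtype
  have hP' : ∀ χ, D.subtype (P (traceMap k C χ)) = traceMap k C χ := fun χ =>
    congrArg D.subtype (LinearMap.congr_fun hP ⟨_, χ, rfl⟩)
  refine ⟨TensorProduct.map P P (Coalgebra.comul (R := k) (traceMap k C ξ)), ?_⟩
  rw [← LinearMap.comp_apply, ← TensorProduct.map_comp]
  refine dualDistrib_ext fun ψ χ => ?_
  rw [← dual_slice, slice_map]
  have h : ∀ χ, slice χ C (Coalgebra.comul (R := k) (traceMap k C ξ)) =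
      traceMap k C (dualMul χ ξ) := fun χ => act_traceMap χ ξ
  -- The retraction disappears from the first leg by `hP'`. Exchanging `ψ` with the argument by
  -- symmetry brings the second leg into the range as well, where `P` can be removed again.
  rw [h, LinearMap.comp_apply, hP', ← dual_slice, h, dual_traceMap_symm, dual_traceMap_symm ψ,
    ← Comod.dual_regular_act, ← Comod.dual_regular_act, act_traceMap, LinearMap.comp_apply,
    LinearMap.comp_apply, hP']

/-- The range is a subcoalgebra, hence zero or everything. If it were zero then `e = 0`, against
`ε(e) = tr(id) = dim C ≠ 0` in characteristic zero. Injectivity is a dimension count. -/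
theorem traceMap_bijective [CharZero k] (hC : IsSimpleCoalg k C) :
    Function.Bijective (traceMap k C) := by
  have hs : Function.Surjective (traceMap k C) := by
    rw [← LinearMap.range_eq_top]
    refine (hC.2 _ isSubcoalg_range_traceMap).resolve_left fun h => ?_
    rw [LinearMap.range_eq_bot] at h
    have h1 : traceElem k C = 0 := by
      refine ((Comod.regular k C).act_counit _).symm.trans ?_
      exact LinearMap.congr_fun h _
    have h2 := apply_traceElem (k := k) (C := C) Coalgebra.counit
    have h3 : (Comod.regular k C).act Coalgebra.counit = 1 :=
      LinearMap.ext (Comod.regular k C).act_counit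
    rw [h1, map_zero, h3] at h2
    have h4 := h2.trans (LinearMap.trace_one k C)
    have := hC.1
    exact Module.finrank_pos.ne (Nat.cast_injective (by simpa using h4))
  exact ⟨(LinearMap.injective_iff_surjective_of_finrank_eq_finrank
    (Subspace.dual_finrank_eq)).2 hs, hs⟩

end Finite

/-! ### Direct sums of coalgebras -/

section Decomposition

variable {k H ι : Type u} [Field k] [AddCommGroup H] [Module k H] [Coalgebra k H]
  [DecidableEq ι] {C : ι → Type u} [∀ i, AddCommGroup (C i)] [∀ i, Module k (C i)]
  [∀ i, Coalgebra k (C i)] {j : ∀ i, C i →ₗc[k] H}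
  (hj : Function.Bijective (DirectSum.toModule k ι H fun i => (j i).toLinearMap))

include hj in
/-- Linear maps on `H` agree if they agree on all the summands. -/
theorem sumCoalg_ext {V : Type u} [AddCommGroup V] [Module k V] {f g : H →ₗ[k] V}
    (h : ∀ i c, f (j i c) = g (j i c)) : f = g := by
  have h2 : f ∘ₗ DirectSum.toModule k ι H (fun i => (j i).toLinearMap) =
      g ∘ₗ DirectSum.toModule k ι H (fun i => (j i).toLinearMap) := by
    refine DirectSum.linearMap_ext _ fun i => LinearMap.ext fun c => ?_
    simp only [LinearMap.comp_apply, DirectSum.toModule_lof]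
    exact h i c
  refine LinearMap.ext fun x => ?_
  obtain ⟨y, rfl⟩ := hj.2 x
  exact LinearMap.congr_fun h2 y

/-- The linear map on `H` with given restrictions to the summands. -/
noncomputable def sumDesc {V : Type u} [AddCommGroup V] [Module k V] (f : ∀ i, C i →ₗ[k] V) :
    H →ₗ[k] V :=
  DirectSum.toModule k ι V f ∘ₗ (LinearEquiv.ofBijective _ hj).symm.toLinearMap

@[simp]
theorem sumDesc_apply {V : Type u} [AddCommGroup V] [Module k V] (f : ∀ i, C i →ₗ[k] V) (i : ι)
    (c : C i) : sumDesc hj f (j i c) = f i c := by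
  have h : (LinearEquiv.ofBijective _ hj).symm (j i c) = DirectSum.lof k ι C i c := by
    rw [LinearEquiv.symm_apply_eq]
    simp
  rw [sumDesc, LinearMap.comp_apply, LinearEquiv.coe_coe, h, DirectSum.toModule_lof]

/-- The projection of `H` to a summand. -/
noncomputable def sumProj (i : ι) : H →ₗ[k] C i :=
  DirectSum.component k ι C i ∘ₗ (LinearEquiv.ofBijective _ hj).symm.toLinearMap

theorem sumProj_eq (i l : ι) (c : C l) :
    sumProj hj i (j l c) = DirectSum.component k ι C i (DirectSum.lof k ι C l c) := by
  have h : (LinearEquiv.ofBijective _ hj).symm (j l c) = DirectSum.lof k ι C l c := by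
    rw [LinearEquiv.symm_apply_eq]
    simp
  rw [sumProj, LinearMap.comp_apply, LinearEquiv.coe_coe, h]

@[simp]
theorem sumProj_self (i : ι) (c : C i) : sumProj hj i (j i c) = c := by
  rw [sumProj_eq, DirectSum.component.lof_self]

theorem sumProj_ne {i l : ι} (h : l ≠ i) (c : C l) : sumProj hj i (j l c) = 0 := by
  rw [sumProj_eq, DirectSum.component.of, dif_neg h]

theorem sumProj_comp_self (i : ι) : sumProj hj i ∘ₗ (j i).toLinearMap = LinearMap.id :=
  LinearMap.ext fun c => sumProj_self hj i c

theorem sumProj_comp_ne {i l : ι} (h : l ≠ i) : sumProj hj i ∘ₗ (j l).toLinearMap = 0 :=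
  LinearMap.ext fun c => sumProj_ne hj h c

/-! ### Convolution on the direct sum and its central idempotents -/

theorem comul_coalgHom (i : ι) (c : C i) : Coalgebra.comul (R := k) (j i c) =
    TensorProduct.map (j i).toLinearMap (j i).toLinearMap (Coalgebra.comul (R := k) c) :=
  (LinearMap.congr_fun (j i).map_comp_comul c).symm

theorem dualDistrib_map {C C' D D' : Type u} [AddCommGroup C] [Module k C] [AddCommGroup D]
    [Module k D] [AddCommGroup C'] [Module k C'] [AddCommGroup D'] [Module k D']
    (f : C →ₗ[k] D) (f' : C' →ₗ[k] D') (ψ : Module.Dual k D) (χ : Module.Dual k D') :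
    TensorProduct.dualDistrib k D D' (ψ ⊗ₜ χ) ∘ₗ TensorProduct.map f f' =
      TensorProduct.dualDistrib k C C' ((ψ ∘ₗ f) ⊗ₜ (χ ∘ₗ f')) :=
  TensorProduct.ext' fun _ _ => rfl

/-- Since `j i` respects comultiplication, restriction of functionals to a block is multiplicative.
With `sumCoalg_ext`, identities in the dual of `H` can then be checked block by block. -/
theorem dualMul_coalgHom (ψ χ : Module.Dual k H) (i : ι) (c : C i) :
    dualMul ψ χ (j i c) = dualMul (ψ ∘ₗ (j i).toLinearMap) (χ ∘ₗ (j i).toLinearMap) c := by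
  rw [dualMul_apply, comul_coalgHom, ← LinearMap.comp_apply, dualDistrib_map]
  rfl

theorem zero_dualMul {C : Type u} [AddCommGroup C] [Module k C] [Coalgebra k C]
    (χ : Module.Dual k C) : dualMul 0 χ = 0 := by
  rw [dualMul, TensorProduct.zero_tmul, map_zero, LinearMap.zero_comp]

theorem dualMul_zero {C : Type u} [AddCommGroup C] [Module k C] [Coalgebra k C]
    (χ : Module.Dual k C) : dualMul χ 0 = 0 := by
  rw [dualMul, TensorProduct.tmul_zero, map_zero, LinearMap.zero_comp]

theorem counit_dualMul {C : Type u} [AddCommGroup C] [Module k C] [Coalgebra k C]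
    (χ : Module.Dual k C) : dualMul Coalgebra.counit χ = χ := by
  ext c
  have h : ∀ t : C ⊗[k] C, TensorProduct.dualDistrib k C C (Coalgebra.counit ⊗ₜ χ) t =
      χ (TensorProduct.lid k C ((Coalgebra.counit (R := k)).rTensor C t)) := by
    intro t
    induction t using TensorProduct.induction_on with
    | zero => simp
    | tmul x y => simp
    | add x y hx hy => simp only [map_add, hx, hy]
  rw [dualMul_apply, h]
  simp

/-- Extension by zero is multiplicative because `Δ` keeps each block inside its own tensor square.
It is not unital in general: the image of `ε` is only the idempotent of the block. -/
theorem dualMul_sumProj (i : ι) (ψ χ : Module.Dual k (C i)) :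
    dualMul (ψ ∘ₗ sumProj hj i) (χ ∘ₗ sumProj hj i) = dualMul ψ χ ∘ₗ sumProj hj i := by
  refine sumCoalg_ext hj fun l c => ?_
  rw [dualMul_coalgHom, LinearMap.comp_assoc, LinearMap.comp_assoc]
  by_cases h : l = i
  · subst h
    rw [sumProj_comp_self, LinearMap.comp_id, LinearMap.comp_id, LinearMap.comp_apply,
      sumProj_self]
  · rw [sumProj_comp_ne hj h, LinearMap.comp_zero, zero_dualMul, LinearMap.comp_apply,
      sumProj_ne hj h, map_zero, LinearMap.zero_apply]

/-- The idempotent functional `ε ∘ pᵢ`. -/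
noncomputable def sumIdem (i : ι) : Module.Dual k H := Coalgebra.counit ∘ₗ sumProj hj i

/-- On the block `C i` the idempotent is the counit and on the others it is zero. Together with
`sumIdem_dualMul`, which has the same right-hand side, this makes the idempotent central. -/
theorem dualMul_sumIdem (ξ : Module.Dual k H) (i : ι) :
    dualMul ξ (sumIdem hj i) = ξ ∘ₗ (j i).toLinearMap ∘ₗ sumProj hj i := by
  refine sumCoalg_ext hj fun l c => ?_
  rw [dualMul_coalgHom, sumIdem, LinearMap.comp_assoc]
  by_cases h : l = i
  · subst h
    rw [sumProj_comp_self, LinearMap.comp_id, dualMul_counit, LinearMap.comp_apply, LinearMap.comp_apply,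
      LinearMap.comp_apply, sumProj_self]
  · rw [sumProj_comp_ne hj h, LinearMap.comp_zero, dualMul_zero, LinearMap.comp_apply,
      LinearMap.comp_apply, sumProj_ne hj h, map_zero, map_zero, LinearMap.zero_apply]

theorem sumIdem_dualMul (ξ : Module.Dual k H) (i : ι) :
    dualMul (sumIdem hj i) ξ = ξ ∘ₗ (j i).toLinearMap ∘ₗ sumProj hj i := by
  refine sumCoalg_ext hj fun l c => ?_
  rw [dualMul_coalgHom, sumIdem, LinearMap.comp_assoc]
  by_cases h : l = i
  · subst h
    rw [sumProj_comp_self, LinearMap.comp_id, counit_dualMul, LinearMap.comp_apply, LinearMap.comp_apply,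
      LinearMap.comp_apply, sumProj_self]
  · rw [sumProj_comp_ne hj h, LinearMap.comp_zero, zero_dualMul, LinearMap.comp_apply,
      LinearMap.comp_apply, sumProj_ne hj h, map_zero, map_zero, LinearMap.zero_apply]

theorem sumIdem_dualMul_proj (i : ι) (χ : Module.Dual k (C i)) :
    dualMul (sumIdem hj i) (χ ∘ₗ sumProj hj i) = χ ∘ₗ sumProj hj i := by
  rw [sumIdem, dualMul_sumProj, counit_dualMul]

theorem sumIdem_self (i : ι) : dualMul (sumIdem hj i) (sumIdem hj i) = sumIdem hj i :=
  sumIdem_dualMul_proj hj i _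

theorem sumIdem_ne {i l : ι} (h : l ≠ i) : dualMul (sumIdem hj i) (sumIdem hj l) = 0 := by
  rw [sumIdem_dualMul, sumIdem, LinearMap.comp_assoc, ← LinearMap.comp_assoc (sumProj hj i),
    sumProj_comp_ne hj h.symm]
  simp

/-! ### The functor `⨁` -/

theorem sumObj_act (M : ∀ i, Comod k (C i)) (ξ : Module.Dual k H) (i : ι) (m : (M i).carrier) :
    (sumObj j M).act ξ (DirectSum.lof k ι (fun i => (M i).carrier) i m) =
      DirectSum.lof k ι (fun i => (M i).carrier) i ((M i).act (ξ ∘ₗ (j i).toLinearMap) m) := by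
  change slice ξ _ (sumCoact j M _) = _
  rw [sumCoact_lof, slice_map]
  rfl

theorem Comod.act_zero {D : Type u} [AddCommGroup D] [Module k D] [Coalgebra k D] (M : Comod k D) :
    M.act 0 = 0 := by
  refine LinearMap.ext fun m => ?_
  rw [act_apply, slice, LinearMap.lTensor_zero]
  simp

/-- A functional extended by zero from `C i` kills the coactions of all the other blocks, so it sees
only the `i`-th component. -/
theorem sumObj_act_proj (M : ∀ i, Comod k (C i)) (i : ι) (χ : Module.Dual k (C i))
    (x : DirectSum ι fun i => (M i).carrier) :
    (sumObj j M).act (χ ∘ₗ sumProj hj i) x =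
      DirectSum.lof k ι (fun i => (M i).carrier) i ((M i).act χ (x i)) := by
  refine LinearMap.congr_fun (f := (sumObj j M).act (χ ∘ₗ sumProj hj i))
    (g := DirectSum.lof k ι (fun i => (M i).carrier) i ∘ₗ
      (M i).act χ ∘ₗ DirectSum.component k ι (fun i => (M i).carrier) i) ?_ x
  refine DirectSum.linearMap_ext _ fun l => LinearMap.ext fun m => ?_
  refine (sumObj_act M _ l m).trans ?_
  change DirectSum.lof k ι (fun i => (M i).carrier) l _ =
    DirectSum.lof k ι (fun i => (M i).carrier) i ((M i).act χ
      (DirectSum.component k ι (fun i => (M i).carrier) i (DirectSum.lof k ι _ l m)))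
  rw [LinearMap.comp_assoc]
  by_cases h : l = i
  · subst h
    rw [sumProj_comp_self, DirectSum.component.lof_self, LinearMap.comp_id]
  · rw [sumProj_comp_ne hj h, DirectSum.component.of, dif_neg h, LinearMap.comp_zero,
      Comod.act_zero, map_zero, map_zero, LinearMap.zero_apply, map_zero]

theorem sumObj_act_idem (M : ∀ i, Comod k (C i)) (i : ι)
    (x : DirectSum ι fun i => (M i).carrier) :
    (sumObj j M).act (sumIdem hj i) x = DirectSum.lof k ι (fun i => (M i).carrier) i (x i) := by
  rw [sumIdem, sumObj_act_proj, Comod.act_counit]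

theorem sumComod_faithful : (sumComod j).Faithful where
  map_injective {M N f g} h := by
    funext i
    apply Comod.hom_ext
    refine LinearMap.ext fun m => ?_
    have h1 := LinearMap.congr_fun (congrArg Comod.Hom.toLin h)
      (DirectSum.lof k ι (fun i => (M i).carrier) i m)
    change DirectSum.lmap (fun i => Comod.Hom.toLin (f i)) _ =
      DirectSum.lmap (fun i => Comod.Hom.toLin (g i)) _ at h1
    rw [DirectSum.lmap_lof, DirectSum.lmap_lof] at h1
    exact DirectSum.of_injective i h1

include hj in
-- A morphism commutes with the idempotents, so it maps block to block; its diagonal components are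
-- the preimage.
theorem sumComod_full : (sumComod j).Full where
  map_surjective {M N} f := by
    let F : (DirectSum ι fun i => (M i).carrier) →ₗ[k] DirectSum ι fun i => (N i).carrier :=
      Comod.Hom.toLin f
    have hF : ∀ ξ x, F ((sumObj j M).act ξ x) = (sumObj j N).act ξ (F x) := Comod.Hom.act f
    refine ⟨fun i => ⟨DirectSum.component k ι (fun i => (N i).carrier) i ∘ₗ F ∘ₗ
      DirectSum.lof k ι (fun i => (M i).carrier) i,
      Comod.comm_of_act fun χ m => ?_⟩, ?_⟩
    · have h1 := sumObj_act (j := j) M (χ ∘ₗ sumProj hj i) i m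
      rw [LinearMap.comp_assoc, sumProj_comp_self, LinearMap.comp_id] at h1
      exact congrArg (DirectSum.component k ι (fun i => (N i).carrier) i)
        ((congrArg F h1.symm).trans ((hF _ _).trans (sumObj_act_proj hj N i χ _))) |>.trans
          (DirectSum.component.lof_self k i _)
    · apply Comod.hom_ext
      refine DirectSum.linearMap_ext _ fun i => LinearMap.ext fun m => ?_
      change DirectSum.lmap _ (DirectSum.lof k ι (fun i => (M i).carrier) i m) =
        F (DirectSum.lof k ι (fun i => (M i).carrier) i m)
      rw [DirectSum.lmap_lof]
      have h1 := sumObj_act_idem hj M i (DirectSum.lof k ι (fun i => (M i).carrier) i m)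
      refine (sumObj_act_idem hj N i _).symm.trans ((hF _ _).symm.trans (congrArg F (h1.trans ?_)))
      exact congrArg (DirectSum.lof k ι (fun i => (M i).carrier) i)
        (DirectSum.component.lof_self (M := fun i => (M i).carrier) k i m)

/-! ### Splitting a comodule into its blocks -/

theorem Comod.slice_rangeRestrict (M : Comod k H) (i : ι) (χ : Module.Dual k (C i))
    (v : LinearMap.range (M.act (sumIdem hj i))) :
    (slice χ (LinearMap.range (M.act (sumIdem hj i))) ((TensorProduct.map
      (M.act (sumIdem hj i)).rangeRestrict (sumProj hj i) ∘ₗ M.coact ∘ₗ Submodule.subtype _)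
        v)).1 = M.act (χ ∘ₗ sumProj hj i) v.1 := by
  rw [LinearMap.comp_apply, slice_map]
  change M.act _ (M.act _ v.1) = _
  rw [M.act_act, sumIdem_dualMul_proj]

/-- The `C i`-comodule `eᵢ M` of an `H`-comodule `M`. -/
noncomputable def Comod.summand (M : Comod k H) (i : ι) : Comod k (C i) :=
  Comod.ofSlice (LinearMap.range (M.act (sumIdem hj i)))
    (TensorProduct.map (M.act (sumIdem hj i)).rangeRestrict (sumProj hj i) ∘ₗ M.coact ∘ₗ
      Submodule.subtype _)
    (fun ψ χ v => by
      apply Subtype.ext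
      rw [slice_rangeRestrict, slice_rangeRestrict, slice_rangeRestrict, M.act_act,
        dualMul_sumProj])
    (fun v => by
      apply Subtype.ext
      rw [slice_rangeRestrict]
      obtain ⟨_, m, rfl⟩ := v
      change M.act (sumIdem hj i) (M.act (sumIdem hj i) m) = _
      rw [M.act_act, sumIdem_self])

/-- The inclusion of `eᵢ M` in `M`. -/
noncomputable def Comod.summandIncl (M : Comod k H) (i : ι) :
    (M.summand hj i).carrier →ₗ[k] M.carrier :=
  (LinearMap.range (M.act (sumIdem hj i))).subtype

theorem Comod.summandIncl_injective (M : Comod k H) (i : ι) :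
    Function.Injective (M.summandIncl hj i) := Subtype.val_injective

theorem Comod.exists_summandIncl (M : Comod k H) (i : ι) (m : M.carrier) :
    ∃ v, M.summandIncl hj i v = M.act (sumIdem hj i) m := ⟨⟨_, m, rfl⟩, rfl⟩

theorem Comod.summandIncl_act (M : Comod k H) (i : ι) (χ : Module.Dual k (C i))
    (v : (M.summand hj i).carrier) : M.summandIncl hj i ((M.summand hj i).act χ v) =
      M.act (χ ∘ₗ sumProj hj i) (M.summandIncl hj i v) := 
  M.slice_rangeRestrict hj i χ v

theorem Comod.act_idem_summandIncl (M : Comod k H) (i : ι) (v : (M.summand hj i).carrier) :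
    M.act (sumIdem hj i) (M.summandIncl hj i v) = M.summandIncl hj i v := by
  rw [sumIdem, ← M.summandIncl_act, Comod.act_counit]

/-- A tensor involves finitely many elements of `H`, each supported on finitely many blocks, where
the counit is the sum of the idempotents. Allowing every larger finite set makes the claim stable
under addition of tensors. -/
theorem exists_sum_slice_idem {V : Type u} [AddCommGroup V] [Module k V] (t : V ⊗[k] H) :
    ∃ s : Finset ι, ∀ s', s ⊆ s' →
      slice Coalgebra.counit V t = ∑ i ∈ s', slice (sumIdem hj i) V t := by
  induction t using TensorProduct.induction_on with
  | zero => exact ⟨∅, by simp⟩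
  | add x y hx hy =>
    obtain ⟨s, hs⟩ := hx
    obtain ⟨s', hs'⟩ := hy
    refine ⟨s ∪ s', fun u hu => ?_⟩
    simp only [map_add, Finset.sum_add_distrib]
    rw [hs u (Finset.union_subset_left hu), hs' u (Finset.union_subset_right hu)]
  | tmul v x =>
    obtain ⟨y, rfl⟩ := hj.2 x
    classical
    refine ⟨DFinsupp.support y, fun u hu => ?_⟩
    simp only [slice_tmul]
    rw [← Finset.sum_smul]
    congr 1
    have h1 : ∀ i, sumIdem hj i (DirectSum.toModule k ι H (fun i => (j i).toLinearMap) y) =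
        Coalgebra.counit (R := k) (y i) := by
      intro i
      change Coalgebra.counit (DirectSum.component k ι C i
        ((LinearEquiv.ofBijective _ hj).symm (LinearEquiv.ofBijective _ hj y))) = _
      rw [LinearEquiv.symm_apply_apply]
      rfl
    simp only [h1]
    have h2 : ∀ i, i ∉ DFinsupp.support y → Coalgebra.counit (R := k) (y i) = 0 := by
      intro i hi
      rw [DFinsupp.notMem_support_iff.1 hi, map_zero]
    rw [← Finset.sum_subset hu fun i _ hi => h2 i hi]
    conv_lhs => rw [← DirectSum.sum_support_of y]
    rw [map_sum, map_sum]
    refine Finset.sum_congr rfl fun i _ => ?_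
    refine (congrArg _ (DirectSum.toModule_lof k i (y i))).trans ?_
    simp

/-- The sum map from the direct sum of the comodules `eᵢ M` to `M`. -/
noncomputable def Comod.summandDesc (M : Comod k H) :
    (DirectSum ι fun i => (M.summand hj i).carrier) →ₗ[k] M.carrier :=
  DirectSum.toModule k ι M.carrier fun i => M.summandIncl hj i

theorem Comod.summandDesc_lof (M : Comod k H) (i : ι) (v : (M.summand hj i).carrier) :
    M.summandDesc hj (DirectSum.lof k ι (fun i => (M.summand hj i).carrier) i v) =
      M.summandIncl hj i v := by
  rw [summandDesc, DirectSum.toModule_lof]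

/-- Orthogonality of the idempotents lets each one read off a component. Injectivity of the sum map
follows. -/
theorem Comod.act_summandDesc (M : Comod k H) (i : ι)
    (x : DirectSum ι fun i => (M.summand hj i).carrier) :
    M.act (sumIdem hj i) (M.summandDesc hj x) = M.summandIncl hj i (x i) := by
  refine LinearMap.congr_fun (f := M.act (sumIdem hj i) ∘ₗ M.summandDesc hj)
    (g := M.summandIncl hj i ∘ₗ
      DirectSum.component k ι (fun i => (M.summand hj i).carrier) i) ?_ x
  refine DirectSum.linearMap_ext _ fun l => LinearMap.ext fun m => ?_
  simp only [LinearMap.comp_apply]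
  rw [summandDesc_lof, ← M.act_idem_summandIncl hj l m, M.act_act, DirectSum.component.of]
  by_cases h : l = i
  · subst h
    rw [sumIdem_self, M.act_idem_summandIncl, dif_pos rfl]
  · rw [sumIdem_ne hj h, Comod.act_zero, dif_neg h, map_zero, LinearMap.zero_apply]

theorem Comod.summandDesc_comm (M : Comod k H) (ξ : Module.Dual k H)
    (x : DirectSum ι fun i => (M.summand hj i).carrier) :
    M.summandDesc hj ((sumObj j fun i => M.summand hj i).act ξ x) =
      M.act ξ (M.summandDesc hj x) := by
  refine LinearMap.congr_fun
    (f := M.summandDesc hj ∘ₗ (sumObj j fun i => M.summand hj i).act ξ)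
    (g := M.act ξ ∘ₗ M.summandDesc hj) ?_ x
  refine DirectSum.linearMap_ext _ fun i => LinearMap.ext fun m => ?_
  refine (congrArg (M.summandDesc hj) (sumObj_act _ ξ i m)).trans ?_
  refine Eq.trans ?_ (congrArg (M.act ξ) (M.summandDesc_lof hj i m)).symm
  -- Writing `m` as `eᵢ m` turns both sides into operators of convolution products with `eᵢ`. Such
  -- products depend only on the restriction to `C i`, where the two functionals agree.
  rw [summandDesc_lof, summandIncl_act, ← M.act_idem_summandIncl hj i m, M.act_act, M.act_act,
    dualMul_sumIdem, dualMul_sumIdem, LinearMap.comp_assoc]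
  congr 2
  refine sumCoalg_ext hj fun l c => ?_
  simp only [LinearMap.comp_apply]
  by_cases h : l = i
  · subst h
    simp
  · simp [sumProj_ne hj h]

theorem Comod.summandDesc_bijective (M : Comod k H) : Function.Bijective (M.summandDesc hj) := by
  constructor
  · rw [← LinearMap.ker_eq_bot, LinearMap.ker_eq_bot']
    intro x hx
    refine DFinsupp.ext fun i => M.summandIncl_injective hj i ?_
    rw [← M.act_summandDesc, hx, map_zero]
    exact (map_zero _).symm
  · intro m
    -- For a finite set `s` covering the coaction of `m`, the identity `ε · m = m` reads `m = ∑ eᵢ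
    -- m`.
    obtain ⟨s, hs⟩ := exists_sum_slice_idem hj (M.coact m)
    choose v hv using fun i => M.exists_summandIncl hj i m
    refine ⟨∑ i ∈ s, DirectSum.lof k ι (fun i => (M.summand hj i).carrier) i (v i), ?_⟩
    rw [map_sum, Finset.sum_congr rfl fun i _ => (M.summandDesc_lof hj i (v i)).trans (hv i)]
    exact (hs s subset_rfl).symm.trans (M.act_counit m)

include hj in
theorem sumComod_essSurj : (sumComod j).EssSurj where
  mem_essImage M := by
    let F : (sumComod j).obj (fun i => M.summand hj i) ⟶ M :=
      ⟨M.summandDesc hj, Comod.comm_of_act (M.summandDesc_comm hj)⟩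
    have := Comod.isIso_of_bijective F (M.summandDesc_bijective hj)
    exact ⟨_, ⟨asIso F⟩⟩

include hj in
theorem sumComod_isEquivalence : (sumComod j).IsEquivalence where
  faithful := sumComod_faithful
  full := sumComod_full hj
  essSurj := sumComod_essSurj hj

end Decomposition

/-! ### The functor `∏` -/

namespace Contra

variable {k D : Type u} [Field k] [AddCommGroup D] [Module k D] [Coalgebra k D]

/-- The operator `n ↦ α(c ↦ χ(c) n)` of a functional on a contramodule. -/
noncomputable def op (N : Contra k D) (χ : Module.Dual k D) : Module.End k N.carrier :=
  N.contr ∘ₗ dualTensorHom k D N.carrier ∘ₗ TensorProduct.mk k _ _ χ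

theorem op_op (N : Contra k D) (ψ χ : Module.Dual k D) (n : N.carrier) :
    N.op ψ (N.op χ n) = N.op (dualMul ψ χ) n :=
  N.contr_contr ψ χ n

theorem op_counit (N : Contra k D) (n : N.carrier) : N.op Coalgebra.counit n = n := by
  refine Eq.trans (congrArg N.contr ?_) (N.contr_counit n)
  ext c
  simp

end Contra

section Product

variable {k H ι : Type u} [Field k] [AddCommGroup H] [Module k H] [Coalgebra k H]
  [DecidableEq ι] {C : ι → Type u} [∀ i, AddCommGroup (C i)] [∀ i, Module k (C i)]
  [∀ i, Coalgebra k (C i)] {j : ∀ i, C i →ₗc[k] H}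
  (hj : Function.Bijective (DirectSum.toModule k ι H fun i => (j i).toLinearMap))

/-- Dual form of `dualMul_sumProj`: the projection respects comultiplication, though not in general
the counit. -/
theorem map_sumProj_comul (i : ι) :
    TensorProduct.map (sumProj hj i) (sumProj hj i) ∘ₗ Coalgebra.comul =
      Coalgebra.comul ∘ₗ sumProj hj i := by
  refine LinearMap.ext fun x => dualDistrib_ext fun ψ χ => ?_
  rw [LinearMap.comp_apply, ← LinearMap.comp_apply, dualDistrib_map]
  exact LinearMap.congr_fun (dualMul_sumProj hj i ψ χ) x

/-! ### Splitting a contramodule into its blocks -/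

namespace Contra

/-- Contraassociativity for `x ⊗ y ↦ eᵢ(x) f(y)`, together with `eᵢ(x¹) f(x²) = f(jᵢ(pᵢ(x)))`. The
latter is the convolution identity `sumIdem_dualMul` tested on functionals of `N`. -/
theorem op_idem_contr (N : Contra k H) (i : ι) (f : H →ₗ[k] N.carrier) :
    N.op (sumIdem hj i) (N.contr f) = N.contr (f ∘ₗ (j i).toLinearMap ∘ₗ sumProj hj i) := by
  have h := N.contraassoc ((TensorProduct.lid k N.carrier).toLinearMap ∘ₗ
    TensorProduct.map (sumIdem hj i) f)
  refine Eq.trans (congrArg N.contr (LinearMap.ext fun x => ?_))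
    (h.trans (congrArg N.contr (LinearMap.ext fun x => dual_ext (k := k) fun ξ => ?_)))
  · exact (map_smul N.contr (sumIdem hj i x) f).symm
  · have h2 : ξ ∘ₗ (TensorProduct.lid k N.carrier).toLinearMap ∘ₗ
        TensorProduct.map (sumIdem hj i) f =
        TensorProduct.dualDistrib k H H (sumIdem hj i ⊗ₜ (ξ ∘ₗ f)) :=
      TensorProduct.ext' fun a b => by simp
    refine (LinearMap.congr_fun h2 _).trans ?_
    exact LinearMap.congr_fun (sumIdem_dualMul hj (ξ ∘ₗ f) i) x

/-- The mirror image of `op_idem_contr`, with the idempotent in the second tensor factor; centrality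
makes the two right-hand sides equal. -/
theorem contr_op_idem (N : Contra k H) (i : ι) (f : H →ₗ[k] N.carrier) :
    N.contr (N.op (sumIdem hj i) ∘ₗ f) = N.contr (f ∘ₗ (j i).toLinearMap ∘ₗ sumProj hj i) := by
  have h := N.contraassoc ((TensorProduct.rid k N.carrier).toLinearMap ∘ₗ
    TensorProduct.map f (sumIdem hj i))
  refine Eq.trans (congrArg N.contr (LinearMap.ext fun x => ?_))
    (h.trans (congrArg N.contr (LinearMap.ext fun x => dual_ext (k := k) fun ξ => ?_)))
  · refine congrArg N.contr (LinearMap.ext fun y => ?_)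
    simp
  · have h2 : ξ ∘ₗ (TensorProduct.rid k N.carrier).toLinearMap ∘ₗ
        TensorProduct.map f (sumIdem hj i) =
        TensorProduct.dualDistrib k H H ((ξ ∘ₗ f) ⊗ₜ sumIdem hj i) :=
      TensorProduct.ext' fun a b => by simp [mul_comm]
    refine (LinearMap.congr_fun h2 _).trans ?_
    exact LinearMap.congr_fun (dualMul_sumIdem hj (ξ ∘ₗ f) i) x

theorem op_idem_subtype (N : Contra k H) (i : ι)
    (n : LinearMap.range (N.op (sumIdem hj i))) : N.op (sumIdem hj i) n.1 = n.1 := by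
  obtain ⟨_, n, rfl⟩ := n
  change N.op _ (N.op _ n) = N.op _ n
  rw [op_op, sumIdem_self]

/-- The `C i`-contramodule `eᵢ N` of an `H`-contramodule `N`. -/
noncomputable def summand (N : Contra k H) (i : ι) : Contra k (C i) where
  carrier := LinearMap.range (N.op (sumIdem hj i))
  contr := LinearMap.codRestrict _
    (N.contr ∘ₗ LinearMap.lcomp k _ (sumProj hj i) ∘ₗ LinearMap.compRight k (Submodule.subtype _))
    (fun g => by
      -- A contraaction that factors through `pᵢ` is fixed by the idempotent, since `pᵢ ∘ jᵢ = id`,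
      -- so it is its own preimage.
      refine ⟨N.contr (Submodule.subtype _ ∘ₗ g ∘ₗ sumProj hj i), ?_⟩
      rw [op_idem_contr, LinearMap.comp_assoc, LinearMap.comp_assoc,
        ← LinearMap.comp_assoc (sumProj hj i), sumProj_comp_self]
      rfl)
  contraassoc := fun f => by
    apply Subtype.ext
    have h := N.contraassoc (Submodule.subtype _ ∘ₗ f ∘ₗ
      TensorProduct.map (sumProj hj i) (sumProj hj i))
    rw [LinearMap.comp_assoc, LinearMap.comp_assoc, map_sumProj_comul] at h
    exact h
  contr_counit := fun n => by
    apply Subtype.ext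
    exact Eq.trans (congrArg N.contr (LinearMap.ext fun x => rfl)) (N.op_idem_subtype hj i n)

/-- The inclusion of `eᵢ N` in `N`. -/
noncomputable def summandIncl (N : Contra k H) (i : ι) :
    (N.summand hj i).carrier →ₗ[k] N.carrier :=
  (LinearMap.range (N.op (sumIdem hj i))).subtype

/-- The projection of `N` to `eᵢ N`. -/
noncomputable def summandProj (N : Contra k H) (i : ι) :
    N.carrier →ₗ[k] (N.summand hj i).carrier :=
  (N.op (sumIdem hj i)).rangeRestrict

theorem summandIncl_injective (N : Contra k H) (i : ι) :
    Function.Injective (N.summandIncl hj i) := Subtype.val_injective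

theorem summandIncl_proj (N : Contra k H) (i : ι) (n : N.carrier) :
    N.summandIncl hj i (N.summandProj hj i n) = N.op (sumIdem hj i) n := rfl

theorem summandIncl_contr (N : Contra k H) (i : ι) (g : C i →ₗ[k] (N.summand hj i).carrier) :
    N.summandIncl hj i ((N.summand hj i).contr g) =
      N.contr (N.summandIncl hj i ∘ₗ g ∘ₗ sumProj hj i) := rfl

theorem op_idem_summandIncl (N : Contra k H) (i : ι) (n : (N.summand hj i).carrier) :
    N.op (sumIdem hj i) (N.summandIncl hj i n) = N.summandIncl hj i n :=
  N.op_idem_subtype hj i n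

/-- The idempotent restricts the integrand to the block, by `op_idem_contr`; by `contr_op_idem` it
may also be applied to the values of the integrand at no cost. -/
theorem summandProj_contr (N : Contra k H) (i : ι) (f : H →ₗ[k] N.carrier) :
    N.summandProj hj i (N.contr f) =
      (N.summand hj i).contr (N.summandProj hj i ∘ₗ f ∘ₗ (j i).toLinearMap) := by
  apply N.summandIncl_injective
  rw [summandIncl_proj, summandIncl_contr, op_idem_contr]
  have h := N.contr_op_idem hj i (f ∘ₗ (j i).toLinearMap ∘ₗ sumProj hj i)
  have h2 : (f ∘ₗ (j i).toLinearMap ∘ₗ sumProj hj i) ∘ₗ (j i).toLinearMap ∘ₗ sumProj hj i =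
      f ∘ₗ (j i).toLinearMap ∘ₗ sumProj hj i := by
    ext x
    simp
  rw [h2] at h
  exact h.symm

/-- Separation of blocks, where finite sums are not available. On the block `C i` one writes `ε = ε
* eᵢ`; contraassociativity then expresses `n` as a single contraaction of a map whose value at `c`
in `C i` is `ε(c) eᵢ n`. -/
theorem eq_zero_of_op_idem (N : Contra k H) (n : N.carrier)
    (h : ∀ i, N.op (sumIdem hj i) n = 0) : n = 0 := by
  -- On `C i` this is `c ↦ (y ↦ ε(c) eᵢ(y) n)`. The inner contraaction gives `ε(c) eᵢ n = 0`, while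
  -- composition with `Δ` gives `c ↦ ε(c) n`.
  let F : H →ₗ[k] H →ₗ[k] N.carrier := sumDesc hj fun i =>
    dualTensorHom k (C i) _ (Coalgebra.counit ⊗ₜ dualTensorHom k H _ (sumIdem hj i ⊗ₜ n))
  have h1 := N.contraassoc (TensorProduct.lift F)
  have h2 : N.contr ∘ₗ TensorProduct.curry (TensorProduct.lift F) = 0 := by
    refine sumCoalg_ext hj fun i c => ?_
    have h3 : TensorProduct.curry (TensorProduct.lift F) = F := by ext; rfl
    rw [h3, LinearMap.comp_apply, sumDesc_apply, dualTensorHom_apply,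
      map_smul]
    change _ • N.op _ n = _
    rw [h, smul_zero, LinearMap.zero_apply]
  have h3 : TensorProduct.lift F ∘ₗ Coalgebra.comul =
      dualTensorHom k H N.carrier (Coalgebra.counit ⊗ₜ n) := by
    refine sumCoalg_ext hj fun i c => ?_
    have h4 : TensorProduct.lift F ∘ₗ TensorProduct.map (j i).toLinearMap (j i).toLinearMap =
        LinearMap.toSpanSingleton k _ n ∘ₗ TensorProduct.dualDistrib k (C i) (C i)
          (Coalgebra.counit ⊗ₜ Coalgebra.counit) :=
      TensorProduct.ext' fun a b => by
        simp [F, sumIdem, smul_smul]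
    rw [LinearMap.comp_apply, comul_coalgHom, ← LinearMap.comp_apply, h4, LinearMap.comp_apply,
      ← dualMul_apply, dualMul_counit]
    simp
  rw [h2, h3, map_zero] at h1
  exact (N.op_counit n).symm.trans h1.symm

theorem exists_op_idem (N : Contra k H) (n : ∀ i, (N.summand hj i).carrier) :
    ∃ m, ∀ i, N.summandProj hj i m = n i := by
  -- The element playing the role of the infinite sum of the `n i`: the contraaction of the map
  -- equal to `c ↦ ε(c) n i` on the block `C i`.
  refine ⟨N.contr (sumDesc hj fun i => dualTensorHom k (C i) N.carrier
    (Coalgebra.counit ⊗ₜ N.summandIncl hj i (n i))), fun i => N.summandIncl_injective hj i ?_⟩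
  rw [summandIncl_proj, op_idem_contr]
  refine Eq.trans (congrArg N.contr (LinearMap.ext fun x => ?_)) (N.op_idem_summandIncl hj i (n i))
  simp [sumIdem]

end Contra

/-! ### The product functor is an equivalence -/

variable [∀ i, FiniteDimensional k (C i)]

theorem prodObj_contr (M : ∀ i, Comod k (C i)) (f : H →ₗ[k] ∀ i, (M i).carrier) (i : ι) :
    (show ∀ i, (M i).carrier from (prodObj j M).contr f) i =
      (M i).finContr (LinearMap.proj i ∘ₗ f ∘ₗ (j i).toLinearMap) := rfl

theorem prodObj_contr_single (M : ∀ i, Comod k (C i)) (i : ι) (g : C i →ₗ[k] (M i).carrier) :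
    (prodObj j M).contr (LinearMap.single k (fun i => (M i).carrier) i ∘ₗ g ∘ₗ sumProj hj i) =
      LinearMap.single k (fun i => (M i).carrier) i ((M i).finContr g) := by
  funext l
  refine (prodObj_contr M _ l).trans ?_
  by_cases h : l = i
  · subst h
    have h1 : ∀ m : (M l).carrier, (Pi.single l m : ∀ i, (M i).carrier) l = m :=
      fun m => by rw [Pi.single_eq_same]
    refine Eq.trans (congrArg _ (LinearMap.ext fun c => ?_)) (h1 _).symm
    exact (h1 _).trans (congrArg g (sumProj_self hj l c))
  · have h1 : ∀ m : (M i).carrier, (Pi.single i m : ∀ i, (M i).carrier) l = 0 :=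
      fun m => by rw [Pi.single_eq_of_ne h]
    refine Eq.trans ?_ (h1 _).symm
    exact Eq.trans (congrArg _ (LinearMap.ext (g := 0) fun c =>
      h1 (g (sumProj hj i (j l c))))) (map_zero _)

theorem prodObj_op_idem (M : ∀ i, Comod k (C i)) (i : ι) (n : ∀ i, (M i).carrier) :
    (prodObj j M).op (sumIdem hj i) n = LinearMap.single k (fun i => (M i).carrier) i (n i) := by
  have h1 : (M i).finContr (dualTensorHom k (C i) _ (Coalgebra.counit ⊗ₜ n i)) = n i :=
    ((M i).finContr_act _ _).trans ((M i).act_counit _)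
  funext l
  refine (prodObj_contr M _ l).trans ?_
  by_cases h : l = i
  · subst h
    have h2 : (Pi.single l (n l) : ∀ i, (M i).carrier) l = n l := Pi.single_eq_same l _
    refine Eq.trans ?_ h2.symm
    refine Eq.trans (congrArg _ (LinearMap.ext fun c => ?_)) h1
    change Coalgebra.counit (R := k) (sumProj hj l (j l c)) • n l =
      Coalgebra.counit (R := k) c • n l
    rw [sumProj_self]
  · have h2 : (Pi.single i (n i) : ∀ i, (M i).carrier) l = 0 := Pi.single_eq_of_ne h _
    refine Eq.trans ?_ h2.symm
    refine Eq.trans (congrArg _ (LinearMap.ext fun c => ?_)) (map_zero _)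
    change Coalgebra.counit (R := k) (sumProj hj i (j l c)) • n l = 0
    rw [sumProj_ne hj h, map_zero, zero_smul]

theorem prodContra_faithful : (prodContra j).Faithful where
  map_injective {M N f g} h := by
    funext i
    apply Comod.hom_ext
    refine LinearMap.ext fun m => ?_
    have h1 := congrFun (LinearMap.congr_fun (congrArg Contra.Hom.toLin h)
      (Pi.single i m : ∀ i, (M i).carrier)) i
    change Comod.Hom.toLin (f i) ((Pi.single i m : ∀ i, (M i).carrier) i) =
      Comod.Hom.toLin (g i) ((Pi.single i m : ∀ i, (M i).carrier) i) at h1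
    rwa [Pi.single_eq_same] at h1

include hj in
-- A linear map on an infinite product is not determined by its restrictions to the factors. A
-- contramodule morphism is: it commutes with the idempotents, so the `i`-th component of `F n` is
-- that of `F` on the `i`-th component of `n` alone.
theorem prodContra_full : (prodContra j).Full where
  map_surjective {M N} f := by
    let F : (∀ i, (M i).carrier) →ₗ[k] ∀ i, (N i).carrier := Contra.Hom.toLin f
    have hF : ∀ g, F ((prodObj j M).contr g) = (prodObj j N).contr (F ∘ₗ g) := Contra.Hom.comm f
    have hF' : ∀ i n, F ((prodObj j M).op (sumIdem hj i) n) =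
        (prodObj j N).op (sumIdem hj i) (F n) := fun i n => by
      refine (hF _).trans (congrArg (prodObj j N).contr (LinearMap.ext fun x => ?_))
      exact map_smul F _ _
    refine ⟨fun i => ⟨LinearMap.proj i ∘ₗ F ∘ₗ LinearMap.single k (fun i => (M i).carrier) i,
      Comod.comm_of_finContr fun g => ?_⟩, ?_⟩
    · refine (congrArg (fun n => F n i) (prodObj_contr_single hj M i g).symm).trans ?_
      refine (congrFun (hF _) i).trans ((prodObj_contr N _ i).trans ?_)
      refine congrArg (N i).finContr (LinearMap.ext fun c => ?_)
      simp only [LinearMap.comp_apply]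
      exact congrArg (fun c => F (LinearMap.single k _ i (g c)) i) (sumProj_self hj i c)
    · apply Contra.hom_ext
      refine LinearMap.ext fun n => funext fun i => ?_
      refine (congrArg (fun n => F n i) (prodObj_op_idem hj M i n).symm).trans ?_
      refine (congrFun ((hF' i n).trans (prodObj_op_idem hj N i _)) i).trans ?_
      exact Pi.single_eq_same i _

include hj in
-- The block projections map `N` bijectively onto the product of its blocks: `eq_zero_of_op_idem`
-- gives injectivity and `exists_op_idem` surjectivity.
theorem prodContra_essSurj : (prodContra j).EssSurj where
  mem_essImage N := by
    let F : N ⟶ (prodContra j).obj (fun i => (N.summand hj i).toComod) :=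
      ⟨LinearMap.pi fun i => N.summandProj hj i, fun f => funext fun i => by
        refine (N.summandProj_contr hj i f).trans ?_
        rw [← Contra.toComod_finContr]
        rfl⟩
    have hF : Function.Bijective (Contra.Hom.toLin F) := by
      constructor
      · rw [← LinearMap.ker_eq_bot, LinearMap.ker_eq_bot']
        intro n hn
        refine N.eq_zero_of_op_idem hj n fun i => ?_
        rw [← N.summandIncl_proj]
        refine (congrArg _ (congrFun hn i)).trans (map_zero _)
      · intro n
        obtain ⟨m, hm⟩ := N.exists_op_idem hj n
        exact ⟨m, funext hm⟩
    have := Contra.isIso_of_bijective F hF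
    exact ⟨_, ⟨(asIso F).symm⟩⟩

include hj in
theorem prodContra_isEquivalence : (prodContra j).IsEquivalence where
  faithful := prodContra_faithful
  full := prodContra_full hj
  essSurj := prodContra_essSurj hj

end Product

/-! ### The isomorphism `Hom(H, ⨁ Mᵢ)^H ≅ ∏ Mᵢ` -/

section Simple

variable {k C : Type u} [Field k] [AddCommGroup C] [Module k C] [Coalgebra k C]
  [FiniteDimensional k C]

/-- Symmetry of `e` in the form `χ(e¹) e² = χ(e²) e¹`. It is needed because the contraaction on
`Hom(C, M)^C` feeds the first leg to the family, while `traceMap` slices the second. -/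
theorem lid_rTensor_traceElem (χ : Module.Dual k C) :
    TensorProduct.lid k C (χ.rTensor C (Coalgebra.comul (R := k) (traceElem k C))) =
      traceMap k C χ := by
  refine dual_ext (k := k) fun ψ => ?_
  have h : ψ ∘ₗ (TensorProduct.lid k C).toLinearMap ∘ₗ χ.rTensor C =
      TensorProduct.dualDistrib k C C (χ ⊗ₜ ψ) := TensorProduct.ext' fun a b => by simp
  refine (LinearMap.congr_fun h _).trans ?_
  rw [← dualMul_apply, dualMul_traceElem, traceMap_apply, Comod.dual_regular_act]

namespace Comod

/-- In a simple coalgebra, every element of a comodule is the value at the symmetric element of a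
comodule morphism. -/
theorem exists_homSub [CharZero k] (hC : IsSimpleCoalg k C) (M : Comod k C) (m : M.carrier) :
    ∃ φ ∈ M.homSub, φ (traceElem k C) = m := by
  let e := LinearEquiv.ofBijective _ (traceMap_bijective hC)
  -- The map sending `χ(e²) e¹` to `χ · m`, well defined because `traceMap` is bijective. It sends
  -- `e` to `m` because `e` corresponds to `χ = ε`.
  let φ : C →ₗ[k] M.carrier := M.dualAct ∘ₗ (TensorProduct.mk k _ _).flip m ∘ₗ e.symm.toLinearMap
  have hφ : ∀ χ, φ (traceMap k C χ) = M.act χ m := fun χ =>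
    congrArg (fun χ => M.act χ m) (e.symm_apply_apply χ)
  refine ⟨φ, (M.mem_homSub_iff φ).2 fun χ c => ?_, ?_⟩
  · obtain ⟨ξ, rfl⟩ := (traceMap_bijective hC).2 c
    rw [act_traceMap, hφ, hφ, M.act_act]
  · have h := hφ Coalgebra.counit
    rwa [traceMap_apply, act_counit, act_counit] at h

end Comod

end Simple

/-! ### Evaluation at the symmetric elements of all blocks -/

section HatSum

variable {k H ι : Type u} [Field k] [AddCommGroup H] [Module k H] [Coalgebra k H]
  [DecidableEq ι] {C : ι → Type u} [∀ i, AddCommGroup (C i)] [∀ i, Module k (C i)]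
  [∀ i, Coalgebra k (C i)] {j : ∀ i, C i →ₗc[k] H}
  (hj : Function.Bijective (DirectSum.toModule k ι H fun i => (j i).toLinearMap))

theorem regular_act_coalgHom (ξ : Module.Dual k H) (i : ι) (c : C i) :
    (Comod.regular k H).act ξ (j i c) =
      j i ((Comod.regular k (C i)).act (ξ ∘ₗ (j i).toLinearMap) c) := by
  rw [Comod.regular_act, comul_coalgHom, slice_map]
  rfl

variable [∀ i, FiniteDimensional k (C i)]

variable (j) in
/-- The map `φ ↦ (φ(jᵢ(eᵢ)))ᵢ`, for the symmetric elements `eᵢ` of `C i`. -/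
noncomputable def hatSumMap (M : ∀ i, Comod k (C i)) :
    (sumObj j M).homSub →ₗ[k] ∀ i, (M i).carrier :=
  LinearMap.pi fun i => DirectSum.component k ι (fun i => (M i).carrier) i ∘ₗ
    LinearMap.applyₗ (j i (traceElem k (C i))) ∘ₗ (sumObj j M).homSub.subtype

include hj in
-- A comodule morphism commutes with functionals supported on `C i`. On that block it therefore
-- takes values in the `i`-th summand and is determined by its value at the symmetric element.
theorem homSub_apply_coalgHom (M : ∀ i, Comod k (C i)) (φ : (sumObj j M).homSub) (i : ι)
    (χ : Module.Dual k (C i)) : φ.1 (j i (traceMap k (C i) χ)) =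
      DirectSum.lof k ι (fun i => (M i).carrier) i ((M i).act χ (hatSumMap j M φ i)) := by
  have h := regular_act_coalgHom (j := j) (χ ∘ₗ sumProj hj i) i (traceElem k (C i))
  rw [LinearMap.comp_assoc, sumProj_comp_self, LinearMap.comp_id] at h
  rw [traceMap_apply, ← h, ((sumObj j M).mem_homSub_iff φ.1).1 φ.2]
  exact sumObj_act_proj hj M i χ _

include hj in
-- Each block is generated by its symmetric element, which gives injectivity. Surjectivity glues the
-- morphisms of `Comod.exists_homSub`; an infinite family is allowed since the source `H` is a
-- direct sum, and this is why a product appears.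
theorem hatSumMap_bijective [CharZero k] (hC : ∀ i, IsSimpleCoalg k (C i))
    (M : ∀ i, Comod k (C i)) : Function.Bijective (hatSumMap j M) := by
  constructor
  · rw [← LinearMap.ker_eq_bot, LinearMap.ker_eq_bot']
    intro φ hφ
    refine Subtype.ext (sumCoalg_ext hj fun i c => ?_)
    obtain ⟨χ, rfl⟩ := (traceMap_bijective (hC i)).2 c
    rw [homSub_apply_coalgHom hj, hφ, Pi.zero_apply, map_zero, map_zero]
    rfl
  · intro m
    choose φ hφ hm using fun i => (M i).exists_homSub (hC i) (m i)
    let f : H →ₗ[k] DirectSum ι fun i => (M i).carrier :=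
      sumDesc hj fun i => DirectSum.lof k ι (fun i => (M i).carrier) i ∘ₗ φ i
    have hf : ∀ i c, f (j i c) = DirectSum.lof k ι (fun i => (M i).carrier) i (φ i c) :=
      fun i c => sumDesc_apply hj _ i c
    have hf' : f ∈ (sumObj j M).homSub := by
      refine ((sumObj j M).mem_homSub_iff f).2 fun ξ x => ?_
      refine LinearMap.congr_fun (f := f ∘ₗ (Comod.regular k H).act ξ)
        (g := (sumObj j M).act ξ ∘ₗ f) (sumCoalg_ext hj fun i c => ?_) x
      refine (congrArg f (regular_act_coalgHom ξ i c)).trans ?_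
      refine Eq.trans ?_ (congrArg ((sumObj j M).act ξ) (hf i c)).symm
      refine (hf _ _).trans (Eq.trans ?_ (sumObj_act M ξ i _).symm)
      rw [((M i).mem_homSub_iff (φ i)).1 (hφ i)]
    refine ⟨⟨f, hf'⟩, funext fun i => ?_⟩
    refine (congrArg (DirectSum.component k ι (fun i => (M i).carrier) i) (hf i _)).trans ?_
    rw [DirectSum.component.lof_self, hm]

include hj in
-- After restriction to `C i` both sides are linear in a map from the finite dimensional `C i` to
-- `Hom(H, ⨁ Mᵢ)^H`, so rank one maps `c ↦ χ(c) φ` suffice. For these the left side is `φ` at `χ(e¹)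
-- e²` and the right side is `χ` acting on the value of `φ` at `e`; symmetry of `e` identifies them.
theorem hatSumMap_contr (M : ∀ i, Comod k (C i)) (θ : H →ₗ[k] (sumObj j M).homSub) :
    hatSumMap j M ((hatObj (sumObj j M)).contr θ) = (prodObj j M).contr (hatSumMap j M ∘ₗ θ) := by
  funext i
  let R : (sumObj j M).homSub →ₗ[k] (C i →ₗ[k] DirectSum ι fun i => (M i).carrier) :=
    LinearMap.lcomp k _ (j i).toLinearMap ∘ₗ (sumObj j M).homSub.subtype
  have hR : ∀ φ c, R φ c = φ.1 (j i c) := fun _ _ => rfl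
  let P : (C i →ₗ[k] (sumObj j M).homSub) →ₗ[k] (M i).carrier :=
    DirectSum.component k ι (fun i => (M i).carrier) i ∘ₗ
      LinearMap.applyₗ (Coalgebra.comul (R := k) (traceElem k (C i))) ∘ₗ
      TensorProduct.uncurry (RingHom.id k) (C i) (C i) _ ∘ₗ LinearMap.compRight k R
  let Q : (C i →ₗ[k] (sumObj j M).homSub) →ₗ[k] (M i).carrier :=
    (M i).finContr ∘ₗ LinearMap.compRight k (LinearMap.proj i ∘ₗ hatSumMap j M)
  have hPQ : P = Q := by
    refine finHom_ext fun χ φ => ?_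
    have h1 : P (dualTensorHom k (C i) _ (χ ⊗ₜ φ)) =
        DirectSum.component k ι (fun i => (M i).carrier) i (R φ (traceMap k (C i) χ)) := by
      rw [← lid_rTensor_traceElem]
      refine congrArg (DirectSum.component k ι (fun i => (M i).carrier) i) ?_
      change TensorProduct.lift (R ∘ₗ dualTensorHom k (C i) _ (χ ⊗ₜ φ)) _ = _
      generalize Coalgebra.comul (R := k) (traceElem k (C i)) = t
      induction t using TensorProduct.induction_on with
      | zero => simp
      | tmul a b => simp
      | add x y hx hy => simp only [map_add, hx, hy]
    have h2 : Q (dualTensorHom k (C i) _ (χ ⊗ₜ φ)) = (M i).act χ (hatSumMap j M φ i) := by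
      rw [← (M i).finContr_act]
      refine congrArg (M i).finContr (LinearMap.ext fun c => ?_)
      change hatSumMap j M (χ c • φ) i = χ c • hatSumMap j M φ i
      rw [map_smul, Pi.smul_apply]
    rw [h1, h2, hR, homSub_apply_coalgHom hj, DirectSum.component.lof_self]
  refine Eq.trans ?_ (LinearMap.congr_fun hPQ (θ ∘ₗ (j i).toLinearMap))
  refine congrArg (DirectSum.component k ι (fun i => (M i).carrier) i) ?_
  change TensorProduct.lift ((sumObj j M).homSub.subtype ∘ₗ θ)
      (Coalgebra.comul (R := k) (j i (traceElem k (C i)))) =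
    TensorProduct.lift (R ∘ₗ θ ∘ₗ (j i).toLinearMap) _
  rw [comul_coalgHom]
  generalize Coalgebra.comul (R := k) (traceElem k (C i)) = t
  induction t using TensorProduct.induction_on with
  | zero => rw [map_zero, map_zero]; exact (map_zero _).symm
  | tmul a b => rfl
  | add x y hx hy => rw [map_add, map_add, hx, hy]; exact (map_add _ _ _).symm

/-- The natural isomorphism `Hom(H, ⨁ Mᵢ)^H ≅ ∏ Mᵢ`. -/
noncomputable def hatSumIso [CharZero k] (hC : ∀ i, IsSimpleCoalg k (C i)) :
    sumComod j ⋙ hat k H ≅ prodContra j :=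
  NatIso.ofComponents
    (fun M =>
      let F : (sumComod j ⋙ hat k H).obj M ⟶ (prodContra j).obj M :=
        ⟨hatSumMap j M, hatSumMap_contr hj M⟩
      have : IsIso F := Contra.isIso_of_bijective F (hatSumMap_bijective hj hC M)
      asIso F)
    (fun _ => Contra.hom_ext (LinearMap.ext fun _ => rfl))

end HatSum

/-! ### The adjunction -/

section Adjunction

variable {k C : Type u} [Field k] [AddCommGroup C] [Module k C] [Coalgebra k C]

/-- The unit `n ↦ (c ↦ c ⊗ n)`. -/
noncomputable def unitMap (N : Contra k C) : N.carrier →ₗ[k] (primeObj N).homSub :=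
  LinearMap.codRestrict (primeObj N).homSub
    (LinearMap.compRight k N.relSub.mkQ ∘ₗ (TensorProduct.mk k C N.carrier).flip)
    (fun n => by
      refine LinearMap.ext fun c => ?_
      change odotCoact N (N.relSub.mkQ (c ⊗ₜ n)) = _
      rw [odotCoact_mk, freeCoact_tmul, LinearMap.comp_apply]
      generalize Coalgebra.comul (R := k) c = t
      induction t using TensorProduct.induction_on with
      | zero =>
        rw [TensorProduct.zero_tmul, map_zero, map_zero]
        exact (map_zero _).symm
      | tmul a b => rfl
      | add x y hx hy =>
        rw [TensorProduct.add_tmul, map_add, map_add, hx, hy]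
        exact (map_add _ _ _).symm)

theorem unitMap_apply (N : Contra k C) (n : N.carrier) (c : C) :
    (unitMap N n).1 c = N.relSub.mkQ (c ⊗ₜ n) := rfl

/-- The defining relation of the cokernel, and the reason why the unit is a contramodule morphism.
-/
theorem mkQ_tmul_contr (N : Contra k C) (c : C) (g : C →ₗ[k] N.carrier) :
    N.relSub.mkQ (c ⊗ₜ N.contr g) = N.relSub.mkQ (spread k C N.carrier (c ⊗ₜ g)) :=
  (Submodule.Quotient.eq _).2 ⟨c ⊗ₜ g, by rw [LinearMap.sub_apply, LinearMap.lTensor_tmul]⟩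

theorem unitMap_contr (N : Contra k C) (g : C →ₗ[k] N.carrier) :
    unitMap N (N.contr g) = (hatObj (primeObj N)).contr (unitMap N ∘ₗ g) := by
  refine Subtype.ext (LinearMap.ext fun c => ?_)
  rw [unitMap_apply, mkQ_tmul_contr, spread_tmul]
  change _ = TensorProduct.lift ((primeObj N).homSub.subtype ∘ₗ unitMap N ∘ₗ g)
    (Coalgebra.comul (R := k) c)
  generalize Coalgebra.comul (R := k) c = t
  induction t using TensorProduct.induction_on with
  | zero => rw [map_zero, map_zero, map_zero]; exact (map_zero _).symm
  | tmul a b => rfl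
  | add x y hx hy => rw [map_add, map_add, map_add, hx, hy]; exact (map_add _ _ _).symm

/-- The counit `c ⊗ φ ↦ φ(c)`. -/
noncomputable def counitMap (M : Comod k C) : (hatObj M).odot →ₗ[k] M.carrier :=
  (hatObj M).relSub.liftQ (TensorProduct.lift M.homSub.subtype.flip) (by
    rw [Contra.relSub, LinearMap.range_le_ker_iff, LinearMap.comp_sub, sub_eq_zero]
    refine TensorProduct.ext' fun c θ => ?_
    rw [LinearMap.comp_apply, LinearMap.comp_apply, LinearMap.lTensor_tmul, spread_tmul]
    change TensorProduct.lift (M.homSub.subtype ∘ₗ θ) (Coalgebra.comul (R := k) c) = _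
    generalize Coalgebra.comul (R := k) c = t
    induction t using TensorProduct.induction_on with
    | zero => rw [map_zero, map_zero, map_zero]; exact (map_zero _).symm
    | tmul a b => rfl
    | add x y hx hy => rw [map_add, map_add, map_add, hx, hy]; exact (map_add _ _ _).symm)

theorem counitMap_comm (M : Comod k C) :
    M.coact ∘ₗ counitMap M = (counitMap M).rTensor C ∘ₗ (primeObj (hatObj M)).coact := by
  refine Submodule.linearMap_qext _ (TensorProduct.ext' fun c (φ : M.homSub) => ?_)
  refine (LinearMap.congr_fun φ.2 c).trans ?_
  have h : φ.1.rTensor C = (counitMap M).rTensor C ∘ₗ (hatObj M).relSub.mkQ.rTensor C ∘ₗ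
      (TensorProduct.rightComm k C C M.homSub).toLinearMap ∘ₗ
        (TensorProduct.mk k (C ⊗[k] C) M.homSub).flip φ := TensorProduct.ext' fun _ _ => rfl
  exact LinearMap.congr_fun h _

/-- The adjunction between contramodules and comodules. -/
noncomputable def primeHatAdj (k C : Type u) [Field k] [AddCommGroup C] [Module k C]
    [Coalgebra k C] : prime k C ⊣ hat k C :=
  Adjunction.mkOfUnitCounit
    { unit :=
        { app := fun N => ⟨unitMap N, unitMap_contr N⟩
          naturality := fun _ _ _ => rfl }
      counit :=
        { app := fun M => ⟨counitMap M, counitMap_comm M⟩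
          naturality := fun M N f => Comod.hom_ext
            (Submodule.linearMap_qext _ (TensorProduct.ext' fun _ _ => rfl)) }
      left_triangle := by
        ext N : 2
        exact Comod.hom_ext (Submodule.linearMap_qext _ (TensorProduct.ext' fun _ _ => rfl))
      right_triangle := by
        ext M : 2
        rfl }

end Adjunction

/-! ### Equivariance of unit and counit -/

section EquivariantAdjunction

open WithConv

variable {k H : Type u} [Field k] [Ring H] [HopfAlgebra k H]

section

variable {V : Type u} [AddCommGroup V] [Module k V] (L : H →ₐ[k] Module.End k V)

/-- Used once the actions are regrouped around a middle factor: the two outer pairs have cancelled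
to the convolution unit and only the middle one survives. -/
theorem Intertw.mul_one_one {V W : Type u} [AddCommMonoid V] [Module k V] [AddCommMonoid W]
    [Module k W] {T : V →ₗ[k] W} {F : WithConv (H →ₗ[k] Module.End k V)}
    {P G Q : WithConv (H →ₗ[k] Module.End k W)} (hP : Intertw T 1 P) (h : Intertw T F G)
    (hQ : Intertw T 1 Q) : Intertw T F (P * (G * Q)) := by
  have := hP.mul (h.mul hQ)
  rwa [one_mul, mul_one] at this

theorem Intertw.one_mul_one {V W : Type u} [AddCommMonoid V] [Module k V] [AddCommMonoid W]
    [Module k W] {T : V →ₗ[k] W} {G : WithConv (H →ₗ[k] Module.End k W)}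
    {P F Q : WithConv (H →ₗ[k] Module.End k V)} (hP : Intertw T P 1) (h : Intertw T F G)
    (hQ : Intertw T Q 1) : Intertw T (P * (F * Q)) G := by
  have := hP.mul (h.mul hQ)
  rwa [one_mul, mul_one] at this

/-- This becomes linearity of the unit after passing to the quotient. Right multiplication in the
argument cancels against right multiplication by `S` on `H ⊗ V`, and left multiplication by `S` in
the argument against left multiplication on `H ⊗ V`. -/
theorem contraAct_freeAct_mk (x : H) (v : V) :
    (TensorProduct.mk k H V).flip (L x v) =
      contraAct (freeAct L) x ((TensorProduct.mk k H V).flip v) := by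
  have : Intertw (TensorProduct.mk k H V).flip (toConv L.toLinearMap)
      (toConv (contraAct (freeAct L)).toLinearMap) := by
    -- Five convolution factors are regrouped so that each factor containing an antipode is adjacent
    -- to the one it cancels, with the action on `V` in the middle.
    rw [toConv_contraAct, postAct_decomp (freeAct L) (toConv_freeAct L), mul_regroup]
    refine Intertw.mul_one_one (fun x v => ?_) (fun x v => rfl) (fun x v => ?_)
    · ext h
      symm
      refine (conv_transport (P := toConv (LinearMap.id (R := k) (M := H)))
        (Q := toConv (HopfAlgebra.antipode k (A := H)))
        (LinearMap.applyₗ h ∘ₗ LinearMap.applyₗ ((TensorProduct.mk k H V).flip v))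
        ((TensorProduct.mk k H V).flip v ∘ₗ LinearMap.mulLeft k h) (fun a b => ?_) x).trans ?_
      · change ((h * a) * HopfAlgebra.antipode k b) ⊗ₜ[k] v =
          (h * (a * HopfAlgebra.antipode k b)) ⊗ₜ[k] v
        rw [mul_assoc]
      · rw [LinearMap.id_mul_antipode]
        change (h * algebraMap k H (Coalgebra.counit (R := k) x)) ⊗ₜ[k] v =
          h ⊗ₜ[k] ((Coalgebra.counit (R := k) x) • v)
        rw [← Algebra.commutes, ← Algebra.smul_def, TensorProduct.smul_tmul]
    · ext h
      symm
      refine (conv_transport (P := toConv (LinearMap.id (R := k) (M := H)))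
        (Q := toConv (HopfAlgebra.antipode k (A := H)))
        (LinearMap.applyₗ h ∘ₗ LinearMap.applyₗ ((TensorProduct.mk k H V).flip v))
        ((TensorProduct.mk k H V).flip v ∘ₗ LinearMap.mulRight k h) (fun a b => ?_) x).trans ?_
      · change (a * (HopfAlgebra.antipode k b * h)) ⊗ₜ[k] v =
          ((a * HopfAlgebra.antipode k b) * h) ⊗ₜ[k] v
        rw [mul_assoc]
      · rw [LinearMap.id_mul_antipode]
        change (algebraMap k H (Coalgebra.counit (R := k) x) * h) ⊗ₜ[k] v =
          h ⊗ₜ[k] ((Coalgebra.counit (R := k) x) • v)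
        rw [← Algebra.smul_def, TensorProduct.smul_tmul]
  exact this x v

/-- Linearity of evaluation, behind that of the counit: the antipode on one side of `h` cancels
against the multiplication in the argument of `φ`, and likewise on the other side. -/
theorem eval_freeAct_contraAct (x : H) (t : H ⊗[k] (H →ₗ[k] V)) :
    TensorProduct.lift (LinearMap.id (R := k) (M := H →ₗ[k] V)).flip
        (freeAct (contraAct L) x t) =
      L x (TensorProduct.lift (LinearMap.id (R := k) (M := H →ₗ[k] V)).flip t) := by
  have : Intertw (TensorProduct.lift (LinearMap.id (R := k) (M := H →ₗ[k] V)).flip)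
      (toConv (freeAct (contraAct L)).toLinearMap) (toConv L.toLinearMap) := by
    rw [toConv_freeAct, freeMid_decomp (contraAct L) (toConv_contraAct L), mul_regroup]
    refine Intertw.one_mul_one (fun x t => ?_) (fun x t => ?_) (fun x t => ?_) <;>
      induction t using TensorProduct.induction_on with
      | zero => simp
      | add x y hx hy => simp only [map_add, hx, hy]
      | tmul h φ => ?_
    · refine (conv_transport (P := toConv (HopfAlgebra.antipode k (A := H)))
        (Q := toConv (LinearMap.id (R := k) (M := H)))
        (TensorProduct.lift (LinearMap.id (R := k) (M := H →ₗ[k] V)).flip ∘ₗ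
          LinearMap.applyₗ (h ⊗ₜ[k] φ))
        (φ ∘ₗ LinearMap.mulLeft k h) (fun a b => ?_) x).trans ?_
      · change φ ((h * HopfAlgebra.antipode k a) * b) = φ (h * (HopfAlgebra.antipode k a * b))
        rw [mul_assoc]
      · rw [LinearMap.antipode_mul_id]
        change φ (h * algebraMap k H (Coalgebra.counit (R := k) x)) =
          (Coalgebra.counit (R := k) x) • φ h
        rw [← Algebra.commutes, ← Algebra.smul_def, map_smul]
    · rfl
    · refine (conv_transport (P := toConv (HopfAlgebra.antipode k (A := H)))
        (Q := toConv (LinearMap.id (R := k) (M := H)))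
        (TensorProduct.lift (LinearMap.id (R := k) (M := H →ₗ[k] V)).flip ∘ₗ
          LinearMap.applyₗ (h ⊗ₜ[k] φ))
        (φ ∘ₗ LinearMap.mulRight k h) (fun a b => ?_) x).trans ?_
      · change φ (HopfAlgebra.antipode k a * (b * h)) = φ ((HopfAlgebra.antipode k a * b) * h)
        rw [mul_assoc]
      · rw [LinearMap.antipode_mul_id]
        change φ (algebraMap k H (Coalgebra.counit (R := k) x) * h) =
          (Coalgebra.counit (R := k) x) • φ h
        rw [← Algebra.smul_def, map_smul]
  exact this x t

end

theorem unitMap_smul (N : AYDContra k H) (x : H) (n : N.carrier) :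
    unitMap N.toContra (x • n) = hatAct (primeHObj N) x (unitMap N.toContra n) := by
  refine Subtype.ext ?_
  have h1 := contraAct_natural (T := N.relSub.mkQ) (L := freeAct (Algebra.lsmul k k N.carrier))
    (L' := odotAct N) (fun _ _ => rfl) x ((TensorProduct.mk k H N.carrier).flip n)
  rw [← contraAct_freeAct_mk] at h1
  exact h1

theorem counitMap_smul (M : AYDMod k H) (x : H) (m : (hatObj M.toComod).odot) :
    counitMap M.toComod (odotAct (hatHObj M) x m) = x • counitMap M.toComod m := by
  obtain ⟨t, rfl⟩ := (hatObj M.toComod).relSub.mkQ_surjective m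
  -- On representatives the counit is the restriction of the evaluation `H ⊗ Hom(H, M) → M`, to
  -- which `eval_freeAct_contraAct` applies.
  have h0 : ∀ t : H ⊗[k] M.homSub, counitMap M.toComod ((hatObj M.toComod).relSub.mkQ t) =
      TensorProduct.lift (LinearMap.id (R := k) (M := H →ₗ[k] M.carrier)).flip
        (M.homSub.subtype.lTensor H t) := by
    intro t
    refine LinearMap.congr_fun (f := counitMap M.toComod ∘ₗ (hatObj M.toComod).relSub.mkQ)
      (g := TensorProduct.lift (LinearMap.id (R := k) (M := H →ₗ[k] M.carrier)).flip ∘ₗ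
        M.homSub.subtype.lTensor H) ?_ t
    exact TensorProduct.ext' fun _ _ => rfl
  refine (h0 (freeAct (hatAct M) x t)).trans ?_
  refine (congrArg _ (freeAct_natural (T := M.homSub.subtype) (L := hatAct M)
    (L' := contraAct (Algebra.lsmul k k M.carrier)) (fun _ _ => rfl) x t)).trans ?_
  exact (eval_freeAct_contraAct _ x _).trans (congrArg (x • ·) (h0 t).symm)

/-- The adjunction between anti-Yetter-Drinfeld contramodules and modules. -/
noncomputable def primeHatHAdj (k H : Type u) [Field k] [Ring H] [HopfAlgebra k H] :
    primeH k H ⊣ hatH k H :=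
  Adjunction.mkOfUnitCounit
    { unit :=
        { app := fun N => ⟨⟨unitMap N.toContra, unitMap_contr N.toContra⟩, unitMap_smul N⟩
          naturality := fun _ _ _ => rfl }
      counit :=
        { app := fun M => ⟨⟨counitMap M.toComod, counitMap_comm M.toComod⟩, counitMap_smul M⟩
          naturality := fun M N f => AYDMod.Hom.ext
            (Submodule.linearMap_qext _ (TensorProduct.ext' fun _ _ => rfl)) }
      left_triangle := by
        ext N : 2
        exact AYDMod.Hom.ext (Submodule.linearMap_qext _ (TensorProduct.ext' fun _ _ => rfl))
      right_triangle := by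
        ext M : 2
        rfl }

/-- The adjunction between stable anti-Yetter-Drinfeld contramodules and modules. -/
noncomputable def primeHatSHAdj (k H : Type u) [Field k] [Ring H] [HopfAlgebra k H] :
    primeSH k H ⊣ hatSH k H :=
  Adjunction.mkOfUnitCounit
    { unit :=
        { app := fun N => ⟨(primeHatHAdj k H).unit.app N.obj⟩
          naturality := fun _ _ _ => rfl }
      counit :=
        { app := fun M => ⟨(primeHatHAdj k H).counit.app M.obj⟩
          naturality := fun M N f => ObjectProperty.hom_ext _
            ((primeHatHAdj k H).counit.naturality f.hom) }
      left_triangle := by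
        ext N : 2
        exact ObjectProperty.hom_ext _ ((primeHatHAdj k H).left_triangle_components N.obj)
      right_triangle := by
        ext M : 2
        rfl }

/-! ### From bijective unit and counit to equivalences -/

/-- A bijective morphism of anti-Yetter-Drinfeld modules is an isomorphism. -/
theorem AYDMod.isIso_of_bijective {M N : AYDMod k H} (f : M ⟶ N)
    (h : Function.Bijective f.toLin) : IsIso f := by
  let g : M.toComod ⟶ N.toComod := f.toHom
  have : IsIso g := Comod.isIso_of_bijective g h
  have h1 : ∀ n, f.toLin ((inv g).toLin n) = n := fun n =>
    LinearMap.congr_fun (congrArg Comod.Hom.toLin (IsIso.inv_hom_id g)) n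
  have h2 : ∀ m, (inv g).toLin (f.toLin m) = m := fun m =>
    LinearMap.congr_fun (congrArg Comod.Hom.toLin (IsIso.hom_inv_id g)) m
  refine ⟨⟨⟨inv g, fun x n => h.1 ?_⟩, ?_, ?_⟩⟩
  · rw [h1, f.map_smul, h1]
  · exact AYDMod.Hom.ext (LinearMap.ext h2)
  · exact AYDMod.Hom.ext (LinearMap.ext h1)

/-- A bijective morphism of anti-Yetter-Drinfeld contramodules is an isomorphism. -/
theorem AYDContra.isIso_of_bijective {M N : AYDContra k H} (f : M ⟶ N)
    (h : Function.Bijective f.toLin) : IsIso f := by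
  let g : M.toContra ⟶ N.toContra := f.toHom
  have : IsIso g := Contra.isIso_of_bijective g h
  have h1 : ∀ n, f.toLin ((inv g).toLin n) = n := fun n =>
    LinearMap.congr_fun (congrArg Contra.Hom.toLin (IsIso.inv_hom_id g)) n
  have h2 : ∀ m, (inv g).toLin (f.toLin m) = m := fun m =>
    LinearMap.congr_fun (congrArg Contra.Hom.toLin (IsIso.hom_inv_id g)) m
  refine ⟨⟨⟨inv g, fun x n => h.1 ?_⟩, ?_, ?_⟩⟩
  · rw [h1, f.map_smul, h1]
  · exact AYDContra.Hom.ext (LinearMap.ext h2)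
  · exact AYDContra.Hom.ext (LinearMap.ext h1)

theorem unitMap_bijective [(hat k H).IsEquivalence] (N : Contra k H) :
    Function.Bijective (unitMap N) := by
  have := (primeHatAdj k H).isEquivalence_left_of_isEquivalence_right
  have : IsIso ((primeHatAdj k H).unit.app N) := inferInstance
  let g := (primeHatAdj k H).unit.app N
  exact Function.bijective_iff_has_inverse.2 ⟨(inv g).toLin,
    fun n => LinearMap.congr_fun (congrArg Contra.Hom.toLin (IsIso.hom_inv_id g)) n,
    fun n => LinearMap.congr_fun (congrArg Contra.Hom.toLin (IsIso.inv_hom_id g)) n⟩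

theorem counitMap_bijective [(hat k H).IsEquivalence] (M : Comod k H) :
    Function.Bijective (counitMap M) := by
  have : IsIso ((primeHatAdj k H).counit.app M) := inferInstance
  let g := (primeHatAdj k H).counit.app M
  exact Function.bijective_iff_has_inverse.2 ⟨(inv g).toLin,
    fun n => LinearMap.congr_fun (congrArg Comod.Hom.toLin (IsIso.hom_inv_id g)) n,
    fun n => LinearMap.congr_fun (congrArg Comod.Hom.toLin (IsIso.inv_hom_id g)) n⟩

/-- The lifted unit has the same underlying linear map as the unit over the bare coalgebra, and for
anti-Yetter-Drinfeld contramodules too bijectivity suffices. -/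
theorem isIso_unit_primeHatHAdj [(hat k H).IsEquivalence] (N : AYDContra k H) :
    IsIso ((primeHatHAdj k H).unit.app N) :=
  AYDContra.isIso_of_bijective _ (unitMap_bijective N.toContra)

theorem isIso_counit_primeHatHAdj [(hat k H).IsEquivalence] (M : AYDMod k H) :
    IsIso ((primeHatHAdj k H).counit.app M) :=
  AYDMod.isIso_of_bijective _ (counitMap_bijective M.toComod)

theorem hatH_isEquivalence [(hat k H).IsEquivalence] : (hatH k H).IsEquivalence :=
  have := isIso_unit_primeHatHAdj (k := k) (H := H)
  have := isIso_counit_primeHatHAdj (k := k) (H := H)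
  (primeHatHAdj k H).toEquivalence.isEquivalence_inverse

/-- The inclusions of the stable objects are full, so they reflect isomorphisms and the unstable
case applies to unit and counit. -/
theorem hatSH_isEquivalence [(hat k H).IsEquivalence] : (hatSH k H).IsEquivalence :=
  have _ : ∀ N, IsIso ((primeHatSHAdj k H).unit.app N) := fun N =>
    have : IsIso ((ObjectProperty.ι _).map ((primeHatSHAdj k H).unit.app N)) :=
      isIso_unit_primeHatHAdj N.obj
    isIso_of_reflects_iso _ (ObjectProperty.ι _)
  have _ : ∀ M, IsIso ((primeHatSHAdj k H).counit.app M) := fun M =>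
    have : IsIso ((ObjectProperty.ι _).map ((primeHatSHAdj k H).counit.app M)) :=
      isIso_counit_primeHatHAdj M.obj
    isIso_of_reflects_iso _ (ObjectProperty.ι _)
  (primeHatSHAdj k H).toEquivalence.isEquivalence_inverse

end EquivariantAdjunction

/-- Let `H` be a Hopf algebra with bijective antipode over a field `k` of characteristic zero which
as a coalgebra is the direct sum of finite dimensional simple coalgebras `C i` (through the
coalgebra maps `j i`). -/
theorem mainTheorem4 {k H ι : Type u} [Field k] [CharZero k] [Ring H] [HopfAlgebra k H]
    (hS : Function.Bijective (HopfAlgebra.antipode k (A := H))) [DecidableEq ι]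
    (C : ι → Type u) [∀ i, AddCommGroup (C i)] [∀ i, Module k (C i)] [∀ i, Coalgebra k (C i)]
    [∀ i, FiniteDimensional k (C i)] (hC : ∀ i, IsSimpleCoalg k (C i))
    (j : ∀ i, C i →ₗc[k] H)
    (hj : Function.Bijective (DirectSum.toModule k ι H fun i => (j i).toLinearMap)) :
    -- the correspondence `⨁ Mᵢ ↔ ∏ Mᵢ` is an equivalence, realized by the two functors
    (sumComod j).IsEquivalence ∧ (prodContra j).IsEquivalence ∧
    Nonempty (sumComod j ⋙ hat k H ≅ prodContra j) ∧
    Nonempty (prodContra j ⋙ prime k H ≅ sumComod j) ∧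
    -- the adjoint pair between comodules and contramodules
    (∃ adj : prime k H ⊣ hat k H,
      (∀ (N : Contra k H) (n : N.carrier) (h : H),
        (Contra.Hom.toLin (adj.unit.app N) n : ((prime k H).obj N).homSub).1 h =
          N.relSub.mkQ (h ⊗ₜ n)) ∧
      (∀ (M : Comod k H) (φ : M.homSub) (h : H),
        Comod.Hom.toLin (adj.counit.app M) (((hat k H).obj M).relSub.mkQ (h ⊗ₜ φ)) = φ.1 h)) ∧
    (hat k H).IsEquivalence ∧ (prime k H).IsEquivalence ∧
    -- the adjoint pair between anti-Yetter-Drinfeld modules and contramodules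
    (∃ adj : primeH k H ⊣ hatH k H,
      (∀ (N : AYDContra k H) (n : N.carrier) (h : H),
        ((adj.unit.app N).toLin n : ((primeH k H).obj N).homSub).1 h =
          N.relSub.mkQ (h ⊗ₜ n)) ∧
      (∀ (M : AYDMod k H) (φ : M.homSub) (h : H),
        (adj.counit.app M).toLin (((hatH k H).obj M).relSub.mkQ (h ⊗ₜ φ)) = φ.1 h)) ∧
    (hatH k H).IsEquivalence ∧ (primeH k H).IsEquivalence ∧
    -- the adjoint pair between the stable anti-Yetter-Drinfeld modules and contramodules
    (∃ adj : primeSH k H ⊣ hatSH k H,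
      (∀ (N : (AYDContra.IsStable (k := k) (H := H)).FullSubcategory) (n : N.obj.carrier) (h : H),
        ((adj.unit.app N).hom.toLin n : ((primeH k H).obj N.obj).homSub).1 h =
          N.obj.relSub.mkQ (h ⊗ₜ n)) ∧
      (∀ (M : (AYDMod.IsStable (k := k) (H := H)).FullSubcategory) (φ : M.obj.homSub) (h : H),
        (adj.counit.app M).hom.toLin (((hatH k H).obj M.obj).relSub.mkQ (h ⊗ₜ φ)) = φ.1 h)) ∧
    (hatSH k H).IsEquivalence ∧ (primeSH k H).IsEquivalence := by
  have hsum := sumComod_isEquivalence hj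
  have hprod := prodContra_isEquivalence hj
  -- The composite is isomorphic to `prodContra j`, an equivalence; cancelling the equivalence
  -- `sumComod j` leaves `hat k H`.
  have hcomp : (sumComod j ⋙ hat k H).IsEquivalence :=
    Functor.isEquivalence_of_iso (hatSumIso hj hC).symm
  have hhat : (hat k H).IsEquivalence := Functor.isEquivalence_of_comp_left (sumComod j) (hat k H)
  have hhatH : (hatH k H).IsEquivalence := hatH_isEquivalence
  have hhatSH : (hatSH k H).IsEquivalence := hatSH_isEquivalence
  refine ⟨hsum, hprod, ⟨hatSumIso hj hC⟩, ⟨?_⟩,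
    ⟨primeHatAdj k H, fun _ _ _ => rfl, fun _ _ _ => rfl⟩, hhat,
    (primeHatAdj k H).isEquivalence_left_of_isEquivalence_right,
    ⟨primeHatHAdj k H, fun _ _ _ => rfl, fun _ _ _ => rfl⟩, hhatH,
    (primeHatHAdj k H).isEquivalence_left_of_isEquivalence_right,
    ⟨primeHatSHAdj k H, fun _ _ _ => rfl, fun _ _ _ => rfl⟩, hhatSH,
    (primeHatSHAdj k H).isEquivalence_left_of_isEquivalence_right⟩
  -- Replacing `∏` by `⨁` followed by `hat`, the isomorphism is the counit of the adjunction,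
  -- invertible because `hat` is an equivalence.
  exact Functor.isoWhiskerRight (hatSumIso hj hC).symm (prime k H) ≪≫
    Functor.associator _ _ _ ≪≫
    Functor.isoWhiskerLeft (sumComod j) (asIso (primeHatAdj k H).counit) ≪≫
    Functor.rightUnitor _
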